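/- **Setting.** A *rank one ray geometry* on $\mathbb R^n$ is a group $G=\mathbb R^n\rtimes KA$ of affine transformations, where for some basis $(e_1,\dots,e_n)$ of $\mathbb R^n$ and some exponents $d_1,\dots,d_n\in\mathbb R$, not all zero, $A=\{\mathrm{diag}(\beta^{d_1},\dots,\beta^{d_n}) : \beta>0\}$, and where $K\subset \mathrm{GL}(\mathbb R^n)$ is a compact subgroup centralizing $A$. Let $M$ be a closed manifold with a $(G,\mathbb R^n)$-structure, let $\pi:\widetilde M\to M$ be its universal cover, $D:\widetilde M\to\mathbb R^n$ its developing map and $\rho:\pi_1(M)\to G$ its holonomy, and fix a metric on $M$ that induces its topology. $M$ is *complete* if $D$ is a diffeomorphism. A set $C\subset\widetilde M$ is *convex* if $D$ is injective on $C$ and $D(C)$ is convex. An *incomplete (invisible) geodesic ending at* $w\in\mathbb R^n$ is a continuous curve $\gamma:[0,1)\to\widetilde M$ with $D(\gamma(t))=(1-t)D(\gamma(0))+tw$ that has no continuous extension to $t=1$. A *Fried dynamics* associated to such a $\gamma$ consists of a point $y\in M$; a compact, convex neighborhood $U$ of $y$ that trivializes $\pi$ (convex meaning that its lifts are); decreasing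 $\epsilon_i\to0$ and increasing times $t_i\to1$ such that $\pi(\gamma(t_i))$ is at distance at most $\epsilon_i$ from $y$ and $\pi\circ\gamma$ leaves $U$ between $t_i$ and $t_{i+1}$; lifts $y_i\in U_i$ of $y\in U$ with $\gamma(t_i)\in U_i$; and the deck transformations $g_{ji}$ with $g_{ji}(U_i)=U_j$. Write the linear part of $\rho(g_{ji})$ as $k_{ji}\,\mathrm{diag}(\beta_{ji}^{d_1},\dots,\beta_{ji}^{d_n})$ with $k_{ji}\in K$, $\beta_{ji}>0$. The sequence is chosen (by passing to a subsequence) such that for fixed $i$ the $k_{ji}$ converge as $j\to\infty$ and each $\beta_{ji}^{d_q}$ is monotone in $j>i$, that $\lim_{i\to\infty}\lim_{j\to\infty}k_{ji}=\mathrm{id}$, and that $\omega_q=\lim_{i\to\infty}\lim_{j\to\infty}\beta_{ji}^{d_q}$ exists in $[0,\infty]$ for every $q$ (it is then $0$, $1$ or $\infty$). The contracted, neutral and expanded subspaces $E,P,F$ are spanned by the $e_q$ with $\omega_q=0$, $\omega_q=1$ and $\omega_q=\infty$ respectively. For $w\in\mathbb R^n$ put $P|_w=w+P$. An affine subspace $I\subset\mathbb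 R^n$ is *the invisible subspace avoided by $D$* if $I$ is the set of the endpoints of all incomplete geodesics, $D(\widetilde M)\cap I=\emptyset$, and $D$ is a covering map onto a connected component of $\mathbb R^n\setminus I$ (which is all of $\mathbb R^n\setminus I$ unless $I$ is a hyperplane). $M$ is *radiant* if for some point $w$ the holonomy fixes $w$ and $\{w\}$ is the invisible subspace avoided by $D$. **Proposition.** Let $M$ be a closed manifold with a rank one ray structure as above, and suppose that $M$ is not complete. 1. If $F=\{0\}$ for every Fried dynamics of $M$, then there is a nonempty invisible affine subspace $I$ avoided by the developing map. Every incomplete geodesic ends at a point of $I$ and has an associated Fried dynamics, and $I=P|_w$ for every Fried dynamics associated to an incomplete geodesic ending at $w$. 2. If $F=P=\{0\}$ for every Fried dynamics of $M$, then $M$ is radiant. 3. In particular (Fried's theorem is the case of the similarity geometry, where $d_1=\dots=d_n=1$), if $d_q>0$ for all $q$, then $M$ is radiant. -/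

import Mathlib

open Set Filter Topology

noncomputable section

/-- The model space `ℝⁿ`. -/
abbrev RSpace (n : ℕ) : Type := EuclideanSpace ℝ (Fin n)

/-- The linear map that is diagonal in the basis `e`, with diagonal entries `β ^ d q`. -/
def diagMap {n : ℕ} (e : Module.Basis (Fin n) ℝ (RSpace n)) (d : Fin n → ℝ) (β : ℝ) :
    RSpace n →ₗ[ℝ] RSpace n :=
  e.constr ℝ fun q => (β ^ d q) • e q

theorem diagMap_one {n : ℕ} (e : Module.Basis (Fin n) ℝ (RSpace n)) (d : Fin n → ℝ) :
    diagMap e d 1 = LinearMap.id := by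
  apply e.ext
  intro q
  simp [diagMap]

theorem diagMap_mul {n : ℕ} (e : Module.Basis (Fin n) ℝ (RSpace n)) (d : Fin n → ℝ)
    {a b : ℝ} (ha : 0 < a) (hb : 0 < b) (x : RSpace n) :
    diagMap e d a (diagMap e d b x) = diagMap e d (a * b) x := by
  have h : (diagMap e d a).comp (diagMap e d b) = diagMap e d (a * b) := by
    apply e.ext
    intro q
    simp only [diagMap, LinearMap.comp_apply, Module.Basis.constr_basis, map_smul, smul_smul]
    rw [Real.mul_rpow ha.le hb.le, mul_comm]
  exact LinearMap.congr_fun h x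

/-- A ray geometry of rank one on `ℝⁿ`: a basis `e` and exponents `d`, not all zero, so that
`β ↦ diag (β ^ d q)` is an isomorphism of the positive reals onto the group `A`, and a compact
group `K` of linear automorphisms that centralizes `A`. -/
structure RankOneRayGeometry (n : ℕ) where
  e : Module.Basis (Fin n) ℝ (RSpace n)
  d : Fin n → ℝ
  d_ne_zero : ∃ q, d q ≠ 0
  K : Subgroup (RSpace n →L[ℝ] RSpace n)ˣ
  K_compact : IsCompact (K : Set (RSpace n →L[ℝ] RSpace n)ˣ)
  K_centralizes : ∀ k ∈ K, ∀ β : ℝ, 0 < β → ∀ x : RSpace n,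
    (k : RSpace n →L[ℝ] RSpace n) (diagMap e d β x) =
      diagMap e d β ((k : RSpace n →L[ℝ] RSpace n) x)

namespace RankOneRayGeometry

variable {n : ℕ} (𝒢 : RankOneRayGeometry n)

/-- The element of `A` with parameter `β`. -/
def a (β : ℝ) : RSpace n →ₗ[ℝ] RSpace n := diagMap 𝒢.e 𝒢.d β

/-- The group `G = ℝⁿ ⋊ K A` of affine transformations with linear part in `K A`. -/
def G : Subgroup (RSpace n ≃ᵃ[ℝ] RSpace n) where
  carrier := {T | ∃ k ∈ 𝒢.K, ∃ β : ℝ, 0 < β ∧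
    ∀ x, T.linear x = (k : RSpace n →L[ℝ] RSpace n) (𝒢.a β x)}
  one_mem' := by
    refine ⟨1, 𝒢.K.one_mem, 1, one_pos, fun x => ?_⟩
    simp [a, diagMap_one, AffineEquiv.one_def]
  mul_mem' := by
    rintro S T ⟨k, hk, β, hβ, hS⟩ ⟨l, hl, β', hβ', hT⟩
    refine ⟨k * l, 𝒢.K.mul_mem hk hl, β * β', mul_pos hβ hβ', fun x => ?_⟩
    have h1 : (S * T).linear x = S.linear (T.linear x) := rfl
    rw [h1, hT, hS, a, ← 𝒢.K_centralizes l hl β hβ, a, diagMap_mul _ _ hβ hβ', a]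
    rfl
  inv_mem' := by
    rintro T ⟨k, hk, β, hβ, hT⟩
    refine ⟨k⁻¹, 𝒢.K.inv_mem hk, β⁻¹, inv_pos.2 hβ, fun x => ?_⟩
    have h1 : (T⁻¹).linear x = T.linear.symm x := rfl
    rw [h1, LinearEquiv.symm_apply_eq, hT, a, a,
      𝒢.K_centralizes _ (𝒢.K.inv_mem hk) _ (inv_pos.2 hβ),
      diagMap_mul _ _ hβ (inv_pos.2 hβ), mul_inv_cancel₀ hβ.ne', diagMap_one]
    change x = ((k * k⁻¹ : (RSpace n →L[ℝ] RSpace n)ˣ) : RSpace n →L[ℝ] RSpace n) x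
    simp

end RankOneRayGeometry

/-- The group of deck transformations of `p`. -/
def deckGroup {M N : Type*} [TopologicalSpace N] (p : N → M) : Subgroup (N ≃ₜ N) where
  carrier := {g | ∀ x, p (g x) = p x}
  one_mem' := fun _ => rfl
  mul_mem' := fun {g h} hg hh x => (hg (h x)).trans (hh x)
  inv_mem' := fun {g} hg x => by
    have h := hg (g⁻¹ x)
    rw [← h]
    exact congrArg p (g.apply_symm_apply x)

/-- A set is convex for `D` if `D` is injective on it and its image is convex. -/
def DevConvex {n : ℕ} {N : Type*} (D : N → RSpace n) (C : Set N) : Prop :=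
  InjOn D C ∧ Convex ℝ (D '' C)

/-- `γ`, considered on `[0, 1)`, is a geodesic that is incomplete (invisible) at `t = 1`:
it develops onto the segment from `D (γ 0)` to `w`, affinely parametrized, and has no continuous
completion at `t = 1`. The point `w` is the endpoint `D(γ)(1)`. -/
structure IsIncompleteGeodesic {n : ℕ} {N : Type*} [TopologicalSpace N] (D : N → RSpace n)
    (γ : ℝ → N) (w : RSpace n) : Prop where
  continuousOn : ContinuousOn γ (Ico 0 1)
  develops : ∀ t ∈ Ico (0 : ℝ) 1, D (γ t) = AffineMap.lineMap (D (γ 0)) w t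
  no_completion : ¬ ∃ z, Tendsto γ (𝓝[<] 1) (𝓝 z)

/-- A `(G, ℝⁿ)`-structure on `M`, with universal cover `p : N → M` (`N` is to be simply
connected). The group `π₁(M)` acts on `N` as the deck group, `D` is the developing map and `ρ` the
holonomy morphism. The smooth structures of `N` and `M` are those for which `D` and `p` are local
diffeomorphisms. -/
structure RayStructure {n : ℕ} (𝒢 : RankOneRayGeometry n) (M N : Type*)
    [TopologicalSpace M] [TopologicalSpace N] where
  p : N → M
  p_covering : IsCoveringMap p
  p_surjective : Function.Surjective p
  D : N → RSpace n
  D_local : IsLocalHomeomorph D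
  ρ : deckGroup p →* 𝒢.G
  equivariant : ∀ (g : deckGroup p) (x : N),
    D ((g : N ≃ₜ N) x) = (ρ g : RSpace n ≃ᵃ[ℝ] RSpace n) (D x)

namespace RayStructure

/-- `M` is complete if the developing map is a diffeomorphism; as it is a local diffeomorphism,
this means a homeomorphism. -/
def IsComplete {n : ℕ} {𝒢 : RankOneRayGeometry n} {M N : Type*}
    [TopologicalSpace M] [TopologicalSpace N] (X : RayStructure 𝒢 M N) : Prop :=
  IsHomeomorph X.D

/-- A Fried dynamics, along a subsequence for which the linear parts behave well. -/
structure FriedDynamics {n : ℕ} {𝒢 : RankOneRayGeometry n} {M N : Type*}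
    [MetricSpace M] [TopologicalSpace N] (X : RayStructure 𝒢 M N) where
  /-- the incomplete geodesic and its endpoint -/
  γ : ℝ → N
  w : RSpace n
  incomplete : IsIncompleteGeodesic X.D γ w
  /-- the recurrent point and its neighborhood -/
  y : M
  U : Set M
  U_nhds : U ∈ 𝓝 y
  U_compact : IsCompact U
  /-- the distances and the times of return; the projected geodesic leaves `U` in between -/
  ε : ℕ → ℝ
  ε_antitone : Antitone ε
  ε_tendsto : Tendsto ε atTop (𝓝 0)
  t : ℕ → ℝ
  t_mem : ∀ i, t i ∈ Ico (0 : ℝ) 1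
  t_strictMono : StrictMono t
  t_tendsto : Tendsto t atTop (𝓝 1)
  close : ∀ i, dist (X.p (γ (t i))) y ≤ ε i
  exits : ∀ i, ∃ s ∈ Ioo (t i) (t (i + 1)), X.p (γ s) ∉ U
  /-- the lifts `Ui i` of `U` and `yi i` of `y`. A compact set that `p` maps bijectively to `U` is
  mapped homeomorphically, and its deck translates are the sheets over `U`: `U` trivializes the
  universal cover, and it is convex as its lifts are. -/
  Ui : ℕ → Set N
  Ui_compact : ∀ i, IsCompact (Ui i)
  Ui_bijOn : ∀ i, BijOn X.p (Ui i) U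
  Ui_convex : ∀ i, DevConvex X.D (Ui i)
  yi : ℕ → N
  yi_mem : ∀ i, yi i ∈ Ui i
  yi_lift : ∀ i, X.p (yi i) = y
  γ_mem : ∀ i, γ (t i) ∈ Ui i
  /-- the transformations `g j i` with `g j i (Ui i) = Ui j` -/
  g : ℕ → ℕ → deckGroup X.p
  g_image : ∀ j i, (g j i : N ≃ₜ N) '' Ui i = Ui j
  /-- the factors in `K` and in `A` of the linear part of `T j i = ρ (g j i)` -/
  k : ℕ → ℕ → (RSpace n →L[ℝ] RSpace n)ˣ
  k_mem : ∀ j i, k j i ∈ 𝒢.K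
  β : ℕ → ℕ → ℝ
  β_pos : ∀ j i, 0 < β j i
  linear_eq : ∀ j i x, (X.ρ (g j i) : RSpace n ≃ᵃ[ℝ] RSpace n).linear x =
    (k j i : RSpace n →L[ℝ] RSpace n) (𝒢.a (β j i) x)
  /-- for fixed `i` the `K`-factors converge, and their limits tend to the identity -/
  kLim : ℕ → (RSpace n →L[ℝ] RSpace n)ˣ
  k_tendsto : ∀ i, Tendsto (fun j => k j i) atTop (𝓝 (kLim i))
  kLim_tendsto : Tendsto kLim atTop (𝓝 1)
  /-- for fixed `i` the diagonal entries are monotone in `j > i` -/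
  β_monotone : ∀ i q, MonotoneOn (fun j => β j i ^ 𝒢.d q) (Ioi i) ∨
    AntitoneOn (fun j => β j i ^ 𝒢.d q) (Ioi i)
  /-- `ω q` is the limit in `[0, ∞]` of the `q`-th diagonal entries when `j ≫ i → ∞` -/
  βLim : ℕ → Fin n → ENNReal
  β_tendsto : ∀ i q, Tendsto (fun j => ENNReal.ofReal (β j i ^ 𝒢.d q)) atTop (𝓝 (βLim i q))
  ω : Fin n → ENNReal
  βLim_tendsto : ∀ q, Tendsto (fun i => βLim i q) atTop (𝓝 (ω q))

namespace FriedDynamics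

variable {n : ℕ} {𝒢 : RankOneRayGeometry n} {M N : Type*}
  [MetricSpace M] [TopologicalSpace N] {X : RayStructure 𝒢 M N} (𝓕 : X.FriedDynamics)

/-- The contracted subspace. -/
def E : Submodule ℝ (RSpace n) := Submodule.span ℝ (𝒢.e '' {q | 𝓕.ω q = 0})

/-- The neutral subspace. -/
def P : Submodule ℝ (RSpace n) := Submodule.span ℝ (𝒢.e '' {q | 𝓕.ω q = 1})

/-- The expanded subspace. -/
def F : Submodule ℝ (RSpace n) := Submodule.span ℝ (𝒢.e '' {q | 𝓕.ω q = ⊤})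

end FriedDynamics

/-- `I` is the invisible subspace avoided by the developing map: its points are the endpoints of
the incomplete geodesics, and the developing map is a covering of (a connected component of) its
complement. The complement is connected unless `I` is a hyperplane, where it has two components,
and the connected space `N` covers one of them. -/
structure IsInvisibleSubspace {n : ℕ} {𝒢 : RankOneRayGeometry n} {M N : Type*}
    [TopologicalSpace M] [TopologicalSpace N] (X : RayStructure 𝒢 M N)
    (I : AffineSubspace ℝ (RSpace n)) : Prop where
  mem_iff : ∀ w, w ∈ I ↔ ∃ γ, IsIncompleteGeodesic X.D γ w
  avoids : ∀ x, X.D x ∉ I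
  range_eq : ∀ x, range X.D = connectedComponentIn (I : Set (RSpace n))ᶜ (X.D x)
  covering : IsCoveringMap (rangeFactorization X.D)

/-- `M` is radiant: the holonomy fixes a point, and the developing map is a covering of (a
connected component of) the complement of this point. -/
def IsRadiant {n : ℕ} {𝒢 : RankOneRayGeometry n} {M N : Type*}
    [TopologicalSpace M] [TopologicalSpace N] (X : RayStructure 𝒢 M N) : Prop :=
  ∃ w : RSpace n, (∀ g, (X.ρ g : RSpace n ≃ᵃ[ℝ] RSpace n) w = w) ∧
    X.IsInvisibleSubspace (AffineSubspace.mk' w ⊥)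

end RayStructure

end

/-!
If nothing is expanded in a single Fried dynamics, then the exponents `d q` have the same sign, as
some direction is contracted: otherwise `w` would lie in the developed image of a compact convex
set that meets `γ`. The neutral directions are then those with `d q = 0`, and as `A` is unchanged
if all exponents change sign, they may be taken nonnegative.

Around the developed image of a point `z` of the universal cover there is a largest visible box,
of a size `radius z`, which the holonomy rescales, and an invisible point `w` on its boundary. Pull
`z` towards `w` by the contractions in `A` that fix `w`. Since `M` is compact, the pulled points
recur up to deck transformations, which nearly fix `w` but expand. If another nearby point had a
nearest invisible point `w'` such that `w' - w` is not neutral, then a common recurrence would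
stretch `w' - w` while moving `w` and `w'` by little. So all nearest invisible points lie in one
translate `I` of the neutral subspace. The radius of `z` is bounded below by the distance from
`D z` to `I`, so that visible neighborhoods of uniform size make `D` a covering over the complement
of `I`.
-/

section Lifting

open unitInterval

variable {A E N : Type*} [TopologicalSpace A] [TopologicalSpace E] [TopologicalSpace N] {D : N → E}
  (hD : IsLocalHomeomorph D)

include hD

theorem locallyCompactSpace_of_isLocalHomeomorph [LocallyCompactSpace E] : LocallyCompactSpace N :=
  let _ : ChartedSpace E N := ⟨range fun x => (hD x).choose, fun x => (hD x).choose,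
    fun x => (hD x).choose_spec.1, mem_range_self⟩
  ChartedSpace.locallyCompactSpace E N

theorem locallyPathConnectedSpace_of_isLocalHomeomorph [LocallyPathConnectedSpace E] :
    LocallyPathConnectedSpace N :=
  let _ : ChartedSpace E N := ⟨range fun x => (hD x).choose, fun x => (hD x).choose,
    fun x => (hD x).choose_spec.1, mem_range_self⟩
  ChartedSpace.locallyPathConnectedSpace E N

theorem eqOn_of_comp_eqOn [T2Space N] {s : Set A} (hs : IsPreconnected s) {f g : A → N}
    (hf : ContinuousOn f s) (hg : ContinuousOn g s) (hfg : EqOn (D ∘ f) (D ∘ g) s) {a : A}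
    (ha : a ∈ s) (h : f a = g a) : EqOn f g s :=
  (T2Space.isSeparatedMap D).eqOn_of_comp_eqOn hD.isLocallyInjective hs hf hg hfg ha h

/-- A family of paths lifts near a member that lifts: Mathlib's lifting lemma applies once the
parameter space is cut down so that the whole family stays in the range of `D`. -/
theorem exists_lift_nhds_of_path {F : I × A → E} (hF : Continuous F) {f₀ : A → N}
    (hf₀ : Continuous f₀) (hFf₀ : ∀ a, D (f₀ a) = F (0, a)) {a₀ : A} {Γ : C(I, N)}
    (hΓ₀ : Γ 0 = f₀ a₀) (hΓ : ∀ t, D (Γ t) = F (t, a₀)) :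
    ∃ W ∈ 𝓝 a₀, ∃ G : I × A → N, ContinuousOn G (univ ×ˢ W) ∧ (∀ a ∈ W, G (0, a) = f₀ a) ∧
      ∀ a ∈ W, ∀ t, D (G (t, a)) = F (t, a) := by
  classical
  have hrange : ∀ᶠ a in 𝓝 a₀, ∀ t ∈ (univ : Set I), F (t, a) ∈ range D :=
    isCompact_univ.eventually_forall_of_forall_eventually fun t _ =>
      (by fun_prop : ContinuousAt (fun x : A × I => F (x.2, x.1)) (a₀, t)).eventually
        (hD.isOpenMap.isOpen_range.mem_nhds ⟨Γ t, hΓ t⟩)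
  obtain ⟨S, hS, hSo, ha₀⟩ := mem_nhds_iff.1 hrange
  choose lift hlift using fun x : I × S => hS x.2.2 x.1 (mem_univ _)
  let a₁ : S := ⟨a₀, ha₀⟩
  let f : C(I × S, E) := ⟨fun x => F (x.1, x.2), by fun_prop⟩
  let g : I × S → N := fun x => if x.1 = 0 then f₀ x.2 else if x.2 = a₁ then Γ x.1 else lift x
  have hg₀ : ∀ a : S, g (0, a) = f₀ a := fun a => if_pos rfl
  have hg₁ : ∀ t, g (t, a₁) = Γ t := fun t => by
    by_cases ht : t = 0 <;> simp [g, ht, hΓ₀, a₁]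
  have hgf : D ∘ g = f := by
    ext ⟨t, a⟩
    by_cases ht : t = 0
    · simp [g, f, ht, hFf₀]
    · by_cases ha : a = a₁
      · simp [g, f, ht, ha, hΓ, a₁]
      · simp [g, f, ht, ha, hlift]
  obtain ⟨W, hW, g', hg', hg'f, hg'₀, -⟩ := hD.exists_lift_nhds hgf
    (by simpa only [hg₀] using (by fun_prop : Continuous fun a : S => f₀ a)) a₁
    (by simpa only [hg₁] using Γ.continuous)
  let r : A → S := fun a => if h : a ∈ S then ⟨a, h⟩ else a₁
  have hrS : ∀ a (h : a ∈ S), r a = ⟨a, h⟩ := fun a h => dif_pos h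
  have hr : ContinuousOn r S := by
    rw [continuousOn_iff_continuous_domRestrict]
    exact continuous_id.congr fun a => (hrS a a.2).symm
  have hrW : r ⁻¹' W ∈ 𝓝 a₀ :=
    (hr.continuousAt (hSo.mem_nhds ha₀)).preimage_mem_nhds (by rwa [hrS a₀ ha₀])
  refine ⟨S ∩ r ⁻¹' W, inter_mem (hSo.mem_nhds ha₀) hrW, fun x => g' (x.1, r x.2), ?_, ?_, ?_⟩
  · exact hg'.comp (continuousOn_fst.prodMk (hr.comp continuousOn_snd fun x hx => hx.2.1))
      fun x hx => ⟨mem_univ _, hx.2.2⟩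
  · exact fun a ha => by simp only [hg'₀, hg₀, hrS a ha.1]
  · exact fun a ha t => by simpa [f, hrS a ha.1] using congrFun hg'f (t, r a)

end Lifting

theorem tendsto_lineMap_one {E : Type*} [AddCommGroup E] [Module ℝ E]
    [TopologicalSpace E] [IsTopologicalAddGroup E] [ContinuousSMul ℝ E] (x w : E) :
    Tendsto (fun t : ℝ => AffineMap.lineMap x w t) (𝓝[<] 1) (𝓝 w) := by
  simpa using ((AffineMap.lineMap_continuous (p := x) (q := w)).tendsto (1 : ℝ)).mono_left
    nhdsWithin_le_nhds

section Visibility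

open unitInterval

variable {E N : Type*} [AddCommGroup E] [Module ℝ E] [TopologicalSpace N] {D : N → E}
  {z : N} {v : E}

/-- `v` is visible from `z` if the segment from `D z` to `v` lifts through `D` to a path
starting at `z`. -/
def Visible (D : N → E) (z : N) (v : E) : Prop :=
  ∃ Γ : C(I, N), Γ 0 = z ∧ ∀ t : I, D (Γ t) = AffineMap.lineMap (D z) v (t : ℝ)

open Classical in
/-- The exponential map of the flat structure: the endpoint of the lift, starting at `z`, of the
segment from `D z` to `v`, and `z` itself if `v` is not visible from `z`. -/
noncomputable def expMap (D : N → E) (z : N) (v : E) : N :=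
  if h : Visible D z v then h.choose 1 else z

theorem Visible.apply_expMap (h : Visible D z v) : D (expMap D z v) = v := by
  rw [expMap, dif_pos h, h.choose_spec.2 1]
  simp

variable (D z) in
theorem visible_self : Visible D z (D z) :=
  ⟨ContinuousMap.const I z, rfl, fun t => by simp⟩

variable [TopologicalSpace E] [T2Space N] (hD : IsLocalHomeomorph D)

include hD

theorem expMap_eq_of_path {Γ : C(I, N)} (h₀ : Γ 0 = z)
    (h : ∀ t : I, D (Γ t) = AffineMap.lineMap (D z) v (t : ℝ)) : expMap D z v = Γ 1 := by
  have hv : Visible D z v := ⟨Γ, h₀, h⟩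
  rw [expMap, dif_pos hv]
  exact eqOn_of_comp_eqOn hD isPreconnected_univ hv.choose.continuous.continuousOn
    Γ.continuous.continuousOn (fun t _ => (hv.choose_spec.2 t).trans (h t).symm) (mem_univ 0)
    (hv.choose_spec.1.trans h₀.symm) (mem_univ 1)

theorem visible_and_expMap_eq_of_continuousOn {f : ℝ → N} (hf : ContinuousOn f (Icc 0 1))
    (h₀ : f 0 = z) (h : ∀ t ∈ Icc (0 : ℝ) 1, D (f t) = AffineMap.lineMap (D z) v t) :
    Visible D z v ∧ expMap D z v = f 1 := by
  let Γ : C(I, N) := ⟨fun t => f t, hf.comp_continuous continuous_subtype_val fun t => t.2⟩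
  have hΓ₀ : Γ 0 = z := by simpa [Γ] using h₀
  have hΓ : ∀ t : I, D (Γ t) = AffineMap.lineMap (D z) v (t : ℝ) := fun t => h t t.2
  exact ⟨⟨Γ, hΓ₀, hΓ⟩, by rw [expMap_eq_of_path hD hΓ₀ hΓ]; simp [Γ]⟩

theorem Visible.exists_continuous (h : Visible D z v) :
    ∃ f : ℝ → N, Continuous f ∧ f 0 = z ∧ f 1 = expMap D z v ∧
      ∀ t ∈ Icc (0 : ℝ) 1, D (f t) = AffineMap.lineMap (D z) v t := by
  obtain ⟨Γ, h₀, hΓ⟩ := h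
  refine ⟨fun t => Γ (projIcc 0 1 zero_le_one t), by fun_prop, ?_, ?_, fun t ht => ?_⟩
  · simpa using h₀
  · simpa using (expMap_eq_of_path hD h₀ hΓ).symm
  · simp [projIcc_of_mem _ ht, hΓ]

theorem expMap_self (z : N) : expMap D z (D z) = z :=
  expMap_eq_of_path hD (Γ := ContinuousMap.const I z) rfl fun t => by simp

theorem Visible.lineMap (h : Visible D z v) {t : ℝ} (ht : t ∈ Icc (0 : ℝ) 1) :
    Visible D z (AffineMap.lineMap (D z) v t) := by
  obtain ⟨f, hf, h₀, -, hDf⟩ := h.exists_continuous hD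
  refine (visible_and_expMap_eq_of_continuousOn hD (f := fun s => f (s * t)) (by fun_prop)
    (by simpa using h₀) fun s hs => ?_).1
  rw [hDf _ ⟨mul_nonneg hs.1 ht.1, mul_le_one₀ hs.2 ht.1 ht.2⟩, AffineMap.lineMap_lineMap_right]

section Equivariance

variable (g : N ≃ₜ N) (T : E ≃ᵃ[ℝ] E) (hg : ∀ x, D (g x) = T (D x))

include hg

theorem Visible.map (h : Visible D z v) :
    Visible D (g z) (T v) ∧ expMap D (g z) (T v) = g (expMap D z v) := by
  obtain ⟨f, hf, h₀, h₁, hDf⟩ := h.exists_continuous hD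
  have := visible_and_expMap_eq_of_continuousOn hD (z := g z) (v := T v) (f := fun t => g (f t))
    (by fun_prop) (by simp [h₀]) fun t ht => by
      rw [hg, hg, hDf t ht]
      exact AffineMap.apply_lineMap (T : E →ᵃ[ℝ] E) _ _ _
  rwa [h₁] at this

theorem visible_map_iff : Visible D (g z) (T v) ↔ Visible D z v := by
  refine ⟨fun h => ?_, fun h => (h.map hD g T hg).1⟩
  have := (h.map hD g.symm T.symm fun x => by
    rw [T.eq_symm_apply, ← hg, g.apply_symm_apply]).1
  simpa using this

end Equivariance

variable [IsTopologicalAddGroup E] [ContinuousSMul ℝ E]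

theorem Visible.eventually_and_continuousAt_expMap (h : Visible D z v) :
    (∀ᶠ x : N × E in 𝓝 (z, v), Visible D x.1 x.2) ∧
      ContinuousAt (fun x : N × E => expMap D x.1 x.2) (z, v) := by
  have hDc := hD.continuous
  obtain ⟨Γ, h₀, hΓ⟩ := h
  obtain ⟨W, hW, G, hG, hG₀, hDG⟩ := exists_lift_nhds_of_path hD
    (F := fun x : I × N × E => AffineMap.lineMap (D x.2.1) x.2.2 (x.1 : ℝ))
    (by simp only [AffineMap.lineMap_apply_module']; fun_prop) continuous_fst
    (fun a => by simp) (a₀ := (z, v)) h₀ hΓ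
  have hpath : ∀ x ∈ W, Visible D x.1 x.2 ∧ expMap D x.1 x.2 = G (1, x) := fun x hx => by
    let Γ' : C(I, N) := ⟨fun t => G (t, x), hG.comp_continuous (by fun_prop)
      fun t => ⟨mem_univ _, hx⟩⟩
    exact ⟨⟨Γ', hG₀ x hx, hDG x hx⟩, expMap_eq_of_path hD (Γ := Γ') (hG₀ x hx) (hDG x hx)⟩
  have hG₁ : ContinuousAt (fun x : N × E => G (1, x)) (z, v) :=
    (hG.continuousAt (x := (1, (z, v))) (prod_mem_nhds univ_mem hW)).comp
      (f := fun x : N × E => ((1 : I), x)) (by fun_prop)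
  exact ⟨mem_of_superset hW fun x hx => (hpath x hx).1,
    hG₁.congr (mem_of_superset hW fun x hx => (hpath x hx).2.symm)⟩

theorem isOpen_setOf_visible (z : N) : IsOpen {v | Visible D z v} :=
  isOpen_iff_mem_nhds.2 fun v hv => (by fun_prop : ContinuousAt (fun v : E => (z, v)) v).eventually
    (hv.eventually_and_continuousAt_expMap hD).1

theorem continuousOn_expMap {C : Set E} (h : ∀ v ∈ C, Visible D z v) :
    ContinuousOn (expMap D z) C := fun v hv =>
  ((h v hv).eventually_and_continuousAt_expMap hD).2.comp_continuousWithinAt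
    (f := fun v : E => (z, v)) (by fun_prop)

theorem Visible.tendsto_of_expMap_eq {ι : Type*} {l : Filter ι} {u : ι → N} (h : Visible D z v)
    (hu : ∀ i, expMap D z (D (u i)) = u i) (hlim : Tendsto (fun i => D (u i)) l (𝓝 v)) :
    Tendsto u l (𝓝 (expMap D z v)) :=
  ((h.eventually_and_continuousAt_expMap hD).2.tendsto.comp
    (tendsto_const_nhds.prodMk_nhds hlim)).congr hu

/-- A segment lifts if it is swept out by segments that lift from a moving origin. -/
theorem visible_of_forall_visible_path {f : ℝ → N} (hf : ContinuousOn f (Icc 0 1)) (h₀ : f 0 = z)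
    (hv : ∀ t ∈ Icc (0 : ℝ) 1, Visible D (f t) (AffineMap.lineMap (D z) v t)) :
    Visible D z v := by
  refine (visible_and_expMap_eq_of_continuousOn hD
    (f := fun t => expMap D (f t) (AffineMap.lineMap (D z) v t)) (fun t ht => ?_)
    (by simp [h₀, expMap_self hD]) fun t ht => (hv t ht).apply_expMap).1
  exact ((hv t ht).eventually_and_continuousAt_expMap hD).2.comp_continuousWithinAt
    (f := fun t => (f t, AffineMap.lineMap (D z) v t))
    ((hf t ht).prodMk AffineMap.lineMap_continuous.continuousWithinAt)

theorem visible_of_tendsto [T2Space E] {f : ℝ → N} (hf : ContinuousOn f (Ico 0 1)) (h₀ : f 0 = z)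
    (h : ∀ t ∈ Ico (0 : ℝ) 1, D (f t) = AffineMap.lineMap (D z) v t) {y : N}
    (hy : Tendsto f (𝓝[<] 1) (𝓝 y)) : Visible D z v := by
  have hDy : D y = v := by
    refine tendsto_nhds_unique ((hD.continuous.tendsto y).comp hy)
      ((tendsto_lineMap_one (D z) v).congr' ?_)
    filter_upwards [Ico_mem_nhdsLT (zero_lt_one' ℝ)] with t ht using (h t ht).symm
  refine (visible_and_expMap_eq_of_continuousOn hD (f := Function.update f 1 y) ?_ ?_ ?_).1
  · rw [continuousOn_update_iff, Icc_sdiff_right]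
    exact ⟨hf, fun _ => hy.mono_left (nhdsWithin_mono _ fun t ht => ht.2)⟩
  · rwa [Function.update_of_ne (zero_ne_one' ℝ)]
  · intro t ht
    rcases ht.2.lt_or_eq with ht₁ | rfl
    · rw [Function.update_of_ne ht₁.ne, h t ⟨ht.1, ht₁⟩]
    · simpa using hDy

theorem exists_isLeast_not_visible (h : ¬ Visible D z v) :
    ∃ s, 0 < s ∧ IsLeast {t ∈ Icc (0 : ℝ) 1 | ¬ Visible D z (AffineMap.lineMap (D z) v t)} s := by
  set B := {t ∈ Icc (0 : ℝ) 1 | ¬ Visible D z (AffineMap.lineMap (D z) v t)}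
  have hB : IsClosed B := isClosed_Icc.inter
    ((isOpen_setOf_visible hD z).preimage AffineMap.lineMap_continuous).isClosed_compl
  have hB₁ : B.Nonempty := ⟨1, ⟨zero_le_one, le_rfl⟩, by simpa using h⟩
  have hmin := hB.isLeast_csInf hB₁ ⟨0, fun t ht => ht.1.1⟩
  refine ⟨sInf B, hmin.1.1.1.lt_of_ne fun h0 => hmin.1.2 ?_, hmin⟩
  rw [← h0, AffineMap.lineMap_apply_zero]
  exact visible_self D z

section Convex

variable {C : Set E} (hC : Convex ℝ C) (hCz : ∀ v ∈ C, Visible D z v)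

include hC hCz

theorem visible_expMap_of_convex {c : E} (hc : c ∈ C) (hv : v ∈ C) :
    Visible D (expMap D z c) v ∧ expMap D (expMap D z c) v = expMap D z v := by
  have hm : MapsTo (fun t : ℝ => AffineMap.lineMap c v t) (Icc 0 1) C := fun t ht =>
    hC.lineMap_mem hc hv ht
  have := visible_and_expMap_eq_of_continuousOn hD (z := expMap D z c) (v := v)
    (f := fun t => expMap D z (AffineMap.lineMap c v t))
    ((continuousOn_expMap hD hCz).comp AffineMap.lineMap_continuous.continuousOn hm)
    (by simp) fun t ht => by rw [(hCz _ (hm ht)).apply_expMap, (hCz _ hc).apply_expMap]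
  simpa using this

theorem visible_expMap_of_mem_closure {c c' w : E} (hc : c ∈ C) (hc' : c' ∈ C)
    (hw : ∀ t ∈ Ico (0 : ℝ) 1, AffineMap.lineMap c w t ∈ C) (hv : Visible D (expMap D z c') w) :
    Visible D (expMap D z c) w := by
  refine visible_of_forall_visible_path hD (f := fun t => expMap D z (AffineMap.lineMap c c' t))
    ((continuousOn_expMap hD hCz).comp AffineMap.lineMap_continuous.continuousOn fun t ht =>
      hC.lineMap_mem hc hc' ht) (by simp) fun t ht => ?_
  rw [(hCz c hc).apply_expMap]
  rcases ht.2.lt_or_eq with ht₁ | rfl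
  · exact (visible_expMap_of_convex hD hC hCz (hC.lineMap_mem hc hc' ht) (hw t ⟨ht.1, ht₁⟩)).1
  · simpa using hv

theorem expMap_eqOn_inter {C' : Set E} (hC' : Convex ℝ C') {z' : N}
    (hCz' : ∀ v ∈ C', Visible D z' v) {c : E} (hc : c ∈ C) (hc' : c ∈ C')
    (h : expMap D z c = expMap D z' c) : EqOn (expMap D z) (expMap D z') (C ∩ C') :=
  eqOn_of_comp_eqOn hD (hC.inter hC').isPreconnected
    ((continuousOn_expMap hD hCz).mono inter_subset_left)
    ((continuousOn_expMap hD hCz').mono inter_subset_right)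
    (fun v hv => by simp [(hCz v hv.1).apply_expMap, (hCz' v hv.2).apply_expMap]) ⟨hc, hc'⟩ h

end Convex

theorem eventually_expMap_apply_eq (z : N) :
    ∀ᶠ y : N × N in 𝓝 (z, z), Visible D y.1 (D y.2) ∧ expMap D y.1 (D y.2) = y.2 := by
  have hDc := hD.continuous
  obtain ⟨U, hU, hzU, hinj⟩ := hD.isLocallyInjective z
  obtain ⟨hvis, hexp⟩ := (visible_self D z).eventually_and_continuousAt_expMap hD
  have hc : ContinuousAt (fun y : N × N => (y.1, D y.2)) (z, z) := by fun_prop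
  have hexpU : ∀ᶠ y : N × N in 𝓝 (z, z), expMap D y.1 (D y.2) ∈ U :=
    (ContinuousAt.comp (x := (z, z)) (f := fun y : N × N => (y.1, D y.2)) hexp hc).eventually
      (hU.mem_nhds (by simpa [expMap_self hD] using hzU))
  filter_upwards [hc.eventually hvis, hexpU, continuous_snd.continuousAt.eventually
    (hU.mem_nhds hzU)] with y hy hyU hyU'
  exact ⟨hy, hinj hyU hyU' hy.apply_expMap⟩

theorem expMap_apply_of_forall_visible [PathConnectedSpace N] (h : ∀ v, Visible D z v) (y : N) :
    expMap D z (D y) = y := by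
  have hDc := hD.continuous
  let γ := PathConnectedSpace.somePath z y
  have := eqOn_of_comp_eqOn hD (s := (univ : Set I)) isPreconnected_univ
    (f := fun t => expMap D z (D (γ t))) (g := γ)
    ((continuousOn_expMap hD (C := univ) fun v _ => h v).comp (by fun_prop) (mapsTo_univ _ _))
    (by fun_prop) (fun t _ => by simp [(h _).apply_expMap]) (mem_univ 0)
    (by simp [expMap_self hD]) (mem_univ 1)
  simpa using this

theorem isHomeomorph_of_forall_visible [PathConnectedSpace N] (h : ∀ v, Visible D z v) :
    IsHomeomorph D :=
  ⟨hD.continuous, hD.isOpenMap,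
    (Function.LeftInverse.injective fun y => expMap_apply_of_forall_visible hD h y),
    fun v => ⟨expMap D z v, (h v).apply_expMap⟩⟩

end Visibility

section IncompleteGeodesic

variable {n : ℕ} {N : Type*} [TopologicalSpace N] {D : N → RSpace n} {γ : ℝ → N} {w : RSpace n}

theorem IsIncompleteGeodesic.tendsto_develop (h : IsIncompleteGeodesic D γ w) :
    Tendsto (fun t => D (γ t)) (𝓝[<] 1) (𝓝 w) := by
  refine (tendsto_lineMap_one (D (γ 0)) w).congr' ?_
  filter_upwards [Ico_mem_nhdsLT (zero_lt_one' ℝ)] with t ht using (h.develops t ht).symm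

theorem IsIncompleteGeodesic.develop_mem_segment (h : IsIncompleteGeodesic D γ w) {t r : ℝ}
    (ht : t ∈ Ico (0 : ℝ) 1) (hr : r ∈ Ico t 1) : D (γ r) ∈ segment ℝ (D (γ t)) w := by
  have h1t : 0 < 1 - t := sub_pos.2 ht.2
  rw [segment_eq_image_lineMap, h.develops t ht, h.develops r ⟨ht.1.trans hr.1, hr.2⟩]
  refine ⟨(r - t) / (1 - t), ⟨div_nonneg (sub_nonneg.2 hr.1) h1t.le, ?_⟩, ?_⟩
  · rw [div_le_one h1t]
    linarith [hr.2]
  · simp only [AffineMap.lineMap_apply_module']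
    match_scalars <;> field_simp <;> ring

variable [T2Space N] (hD : IsLocalHomeomorph D)

include hD

theorem IsIncompleteGeodesic.notMem_of_continuousOn_section (h : IsIncompleteGeodesic D γ w) {t : ℝ}
    (ht : t ∈ Ico (0 : ℝ) 1) {s : RSpace n → N} {C : Set (RSpace n)} (hs : ContinuousOn s C)
    (hDs : ∀ v ∈ C, D (s v) = v) (hst : s (D (γ t)) = γ t) (hC : ∀ r ∈ Ico t 1, D (γ r) ∈ C) :
    w ∉ C := by
  intro hw
  have hγ := h.continuousOn.mono (Ico_subset_Ico_left ht.1)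
  have hsγ : EqOn (fun r => s (D (γ r))) γ (Ico t 1) :=
    eqOn_of_comp_eqOn hD isPreconnected_Ico (hs.comp (hD.continuous.comp_continuousOn hγ) hC) hγ
      (fun r hr => hDs _ (hC r hr)) (left_mem_Ico.2 ht.2) hst
  have hIco := Ico_mem_nhdsLT ht.2
  have hlim : Tendsto (fun r => s (D (γ r))) (𝓝[<] 1) (𝓝 (s w)) :=
    (hs w hw).tendsto.comp (tendsto_nhdsWithin_iff.2
      ⟨h.tendsto_develop, mem_of_superset hIco hC⟩)
  exact h.no_completion ⟨s w, hlim.congr' (mem_of_superset hIco hsγ)⟩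

theorem IsIncompleteGeodesic.not_visible (h : IsIncompleteGeodesic D γ w) {t : ℝ}
    (ht : t ∈ Ico (0 : ℝ) 1) : ¬ Visible D (γ t) w := by
  intro hv
  have hvis : ∀ v ∈ segment ℝ (D (γ t)) w, Visible D (γ t) v := by
    rw [segment_eq_image_lineMap]
    rintro _ ⟨s, hs, rfl⟩
    exact hv.lineMap hD hs
  exact h.notMem_of_continuousOn_section hD ht (continuousOn_expMap hD hvis)
    (fun v hv' => (hvis v hv').apply_expMap) (expMap_self hD _)
    (fun r hr => h.develop_mem_segment ht hr) (right_mem_segment ℝ _ _)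

theorem exists_isIncompleteGeodesic_of_not_visible {z : N} {v : RSpace n} (h : ¬ Visible D z v) :
    ∃ s ∈ Ioc (0 : ℝ) 1, ∃ γ : ℝ → N, γ 0 = z ∧
      IsIncompleteGeodesic D γ (AffineMap.lineMap (D z) v s) := by
  obtain ⟨s, hs, ⟨hs₁, hvis⟩, hmin⟩ := exists_isLeast_not_visible hD h
  have hlt : ∀ t ∈ Ico (0 : ℝ) 1,
      Visible D z (AffineMap.lineMap (D z) (AffineMap.lineMap (D z) v s) t) := fun t ht => by
    rw [AffineMap.lineMap_lineMap_right]
    by_contra hcon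
    have hle : s ≤ t * s :=
      hmin ⟨⟨mul_nonneg ht.1 hs.le, mul_le_one₀ ht.2.le hs.le hs₁.2⟩, hcon⟩
    exact hle.not_gt (mul_lt_of_lt_one_left hs ht.2)
  set w := AffineMap.lineMap (D z) v s
  set γ : ℝ → N := fun t => expMap D z (AffineMap.lineMap (D z) w t)
  have hγ₀ : γ 0 = z := by simp [γ, expMap_self hD]
  have hγ : ContinuousOn γ (Ico 0 1) :=
    (continuousOn_expMap hD (forall_mem_image.2 hlt)).comp
      AffineMap.lineMap_continuous.continuousOn fun t ht => mem_image_of_mem _ ht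
  have hDγ : ∀ t ∈ Ico (0 : ℝ) 1, D (γ t) = AffineMap.lineMap (D z) w t := fun t ht =>
    (hlt t ht).apply_expMap
  exact ⟨s, ⟨hs, hs₁.2⟩, γ, hγ₀, hγ, fun t ht => by rw [hγ₀, hDγ t ht],
    fun ⟨y, hy⟩ => hvis (visible_of_tendsto hD hγ hγ₀ hDγ hy)⟩

end IncompleteGeodesic
theorem Visible.add_of_forall_visible {E N : Type*} [AddCommGroup E] [Module ℝ E]
    [TopologicalSpace E] [IsTopologicalAddGroup E] [ContinuousSMul ℝ E] [TopologicalSpace N]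
    [T2Space N] {D : N → E} {z : N} {v p : E} (h : Visible D z v) (hD : IsLocalHomeomorph D)
    (hp : ∀ y, ∀ t ∈ Icc (0 : ℝ) 1, Visible D y (D y + t • p)) : Visible D z (v + p) := by
  obtain ⟨f, hf, h₀, -, hDf⟩ := h.exists_continuous hD
  refine visible_of_forall_visible_path hD hf.continuousOn h₀ fun t ht => ?_
  convert hp (f t) t ht using 1
  rw [hDf t ht, AffineMap.lineMap_apply_module, AffineMap.lineMap_apply_module, smul_add, add_assoc]

namespace RayStructure

variable {n : ℕ} {𝒢 : RankOneRayGeometry n} {M N : Type*} [TopologicalSpace M] [TopologicalSpace N]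
  (X : RayStructure 𝒢 M N)

include X in
theorem t2Space [T2Space M] : T2Space N := by
  refine ⟨fun x y hxy => ?_⟩
  by_cases h : X.p x = X.p y
  · exact X.p_covering.isSeparatedMap x y h hxy
  · obtain ⟨u, v, hu, hv, hxu, hyv, huv⟩ := t2_separation h
    exact ⟨_, _, hu.preimage X.p_covering.continuous, hv.preimage X.p_covering.continuous, hxu,
      hyv, huv.preimage _⟩

theorem p_deck (g : deckGroup X.p) (x : N) : X.p ((g : N ≃ₜ N) x) = X.p x := g.2 x

theorem deck_eq_of_apply_eq [PreconnectedSpace N] {g h : deckGroup X.p} {x : N}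
    (hx : (g : N ≃ₜ N) x = (h : N ≃ₜ N) x) : g = h :=
  Subtype.ext <| DFunLike.coe_injective <|
    X.p_covering.eq_of_comp_eq (g : N ≃ₜ N).continuous (h : N ≃ₜ N).continuous
      (funext fun y => (g.2 y).trans (h.2 y).symm) x hx

theorem exists_deck_apply_eq [SimplyConnectedSpace N] {x y : N} (h : X.p x = X.p y) :
    ∃ g : deckGroup X.p, (g : N ≃ₜ N) x = y := by
  have := locallyPathConnectedSpace_of_isLocalHomeomorph X.D_local
  let P : C(N, M) := ⟨X.p, X.p_covering.continuous⟩
  obtain ⟨F, ⟨hF, hFp⟩, -⟩ := X.p_covering.existsUnique_continuousMap_lifts P x y h.symm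
  obtain ⟨H, ⟨hH, hHp⟩, -⟩ := X.p_covering.existsUnique_continuousMap_lifts P y x h
  have hHF : H ∘ F = id := X.p_covering.eq_of_comp_eq (H.continuous.comp F.continuous) continuous_id
    (by rw [← Function.comp_assoc, hHp, Function.comp_id]; exact hFp) x (by simp [hF, hH])
  have hFH : F ∘ H = id := X.p_covering.eq_of_comp_eq (F.continuous.comp H.continuous) continuous_id
    (by rw [← Function.comp_assoc, hFp, Function.comp_id]; exact hHp) y (by simp [hF, hH])
  exact ⟨⟨⟨⟨F, H, congrFun hHF, congrFun hFH⟩, F.continuous, H.continuous⟩, congrFun hFp⟩, hF⟩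

theorem exists_isCompact_forall_exists_deck_mem [SimplyConnectedSpace N] [CompactSpace M] :
    ∃ Q : Set N, IsCompact Q ∧ ∀ x, ∃ g : deckGroup X.p, (g : N ≃ₜ N) x ∈ Q := by
  have := locallyCompactSpace_of_isLocalHomeomorph X.D_local
  choose s hs using X.p_surjective
  choose C hC hCs using fun m => exists_compact_mem_nhds (s m)
  have hn : ∀ m ∈ (univ : Set M), X.p '' C m ∈ 𝓝 m := fun m _ => by
    simpa only [hs] using X.p_covering.isOpenMap.image_mem_nhds (hCs m)
  obtain ⟨t, -, ht⟩ := isCompact_univ.elim_nhds_subcover (fun m => X.p '' C m) hn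
  refine ⟨⋃ m ∈ t, C m, t.isCompact_biUnion fun m _ => hC m, fun x => ?_⟩
  obtain ⟨m, hm, y, hy, hxy⟩ : ∃ m ∈ t, ∃ y ∈ C m, X.p y = X.p x := by
    simpa using ht (mem_univ (X.p x))
  obtain ⟨g, hg⟩ := X.exists_deck_apply_eq hxy.symm
  exact ⟨g, mem_biUnion hm (hg ▸ hy)⟩

end RayStructure

namespace RankOneRayGeometry

variable {n : ℕ} (𝒢 : RankOneRayGeometry n)

theorem repr_a (s : ℝ) (v : RSpace n) (q : Fin n) :
    𝒢.e.repr (𝒢.a s v) q = s ^ 𝒢.d q * 𝒢.e.repr v q := by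
  simp only [a, diagMap, Module.Basis.constr_apply_fintype, map_sum, map_smul, smul_smul,
    Finsupp.coe_finsetSum, Finset.sum_apply, Finsupp.smul_apply, Module.Basis.repr_self,
    Module.Basis.equivFun_apply, smul_eq_mul]
  rw [Finset.sum_eq_single q (fun b _ hb => by simp [hb]) (by simp)]
  simp [mul_comm]

theorem a_mul {s t : ℝ} (hs : 0 ≤ s) (ht : 0 ≤ t) (v : RSpace n) :
    𝒢.a (s * t) v = 𝒢.a s (𝒢.a t v) := by
  apply 𝒢.e.repr.injective
  ext q
  rw [repr_a, repr_a, repr_a, Real.mul_rpow hs ht, mul_assoc]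

theorem a_zero_a {s : ℝ} (hs : 0 ≤ s) (v : RSpace n) : 𝒢.a 0 (𝒢.a s v) = 𝒢.a 0 v := by
  rw [← 𝒢.a_mul le_rfl hs, zero_mul]

theorem a_inv_a {s : ℝ} (hs : 0 < s) (v : RSpace n) : 𝒢.a s⁻¹ (𝒢.a s v) = v := by
  rw [← 𝒢.a_mul (inv_nonneg.2 hs.le) hs.le, inv_mul_cancel₀ hs.ne', a, diagMap_one,
    LinearMap.id_apply]

/-- The subspace fixed by `A`, the candidate for the direction of the invisible subspace. As
`0 ^ 0 = 1`, the linear map `a 0` is the projection to it along the other basis vectors. -/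
def neutral : Submodule ℝ (RSpace n) := Submodule.span ℝ (𝒢.e '' {q | 𝒢.d q = 0})

theorem a_zero_eq_self_iff {p : RSpace n} : 𝒢.a 0 p = p ↔ p ∈ 𝒢.neutral := by
  rw [neutral, Module.Basis.mem_span_image, ← 𝒢.e.repr.injective.eq_iff, Finsupp.ext_iff]
  refine forall_congr' fun q => ?_
  by_cases hq : 𝒢.d q = 0
  · simp [repr_a, hq]
  · simp [repr_a, hq, eq_comm (a := (0 : ℝ))]

theorem a_zero_mem_neutral (v : RSpace n) : 𝒢.a 0 v ∈ 𝒢.neutral :=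
  𝒢.a_zero_eq_self_iff.1 (𝒢.a_zero_a le_rfl v)

theorem bddAbove_range_abs_repr_smul (q : Fin n) (v : RSpace n) :
    BddAbove (range fun k : 𝒢.K => |𝒢.e.repr ((k : (RSpace n →L[ℝ] RSpace n)ˣ) • v) q|) := by
  have hrepr : Continuous fun x : RSpace n => 𝒢.e.repr x q :=
    (𝒢.e.coord q).continuous_of_finiteDimensional
  have hsmul : Continuous fun k : (RSpace n →L[ℝ] RSpace n)ˣ =>
      (k : RSpace n →L[ℝ] RSpace n) v := by
    fun_prop
  have := (𝒢.K_compact.image (hrepr.comp hsmul).abs).bddAbove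
  rwa [image_eq_range] at this

/-- The maximum of the absolute value of the `q`-th coordinate over the `K`-orbit. These
seminorms are `K`-invariant, and an element of `G` multiplies the `q`-th one by a power with
exponent `d q`. -/
noncomputable def seminorm (q : Fin n) : Seminorm ℝ (RSpace n) :=
  Seminorm.of (fun v => ⨆ k : 𝒢.K, |𝒢.e.repr ((k : (RSpace n →L[ℝ] RSpace n)ˣ) • v) q|)
    (fun v w => ciSup_le fun k => by
      rw [smul_add, map_add, Finsupp.add_apply]
      exact (abs_add_le _ _).trans (add_le_add
        (le_ciSup (𝒢.bddAbove_range_abs_repr_smul q v) k)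
        (le_ciSup (𝒢.bddAbove_range_abs_repr_smul q w) k)))
    (fun c v => by
      rw [Real.norm_eq_abs, Real.mul_iSup_of_nonneg (abs_nonneg c)]
      refine iSup_congr fun k => ?_
      rw [smul_comm, map_smul, Finsupp.smul_apply, smul_eq_mul, abs_mul])

theorem seminorm_apply (q : Fin n) (v : RSpace n) :
    𝒢.seminorm q v = ⨆ k : 𝒢.K, |𝒢.e.repr ((k : (RSpace n →L[ℝ] RSpace n)ˣ) • v) q| := rfl

theorem abs_repr_le_seminorm (q : Fin n) (v : RSpace n) : |𝒢.e.repr v q| ≤ 𝒢.seminorm q v := by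
  simpa only [seminorm_apply, OneMemClass.coe_one, one_smul] using
    le_ciSup (𝒢.bddAbove_range_abs_repr_smul q v) 1

theorem seminorm_smul {k : (RSpace n →L[ℝ] RSpace n)ˣ} (hk : k ∈ 𝒢.K) (q : Fin n) (v : RSpace n) :
    𝒢.seminorm q (k • v) = 𝒢.seminorm q v :=
  Equiv.iSup_congr (Equiv.mulRight ⟨k, hk⟩) fun l => by simp [mul_smul]

theorem norm_le_sum_seminorm (v : RSpace n) : ‖v‖ ≤ ∑ q, 𝒢.seminorm q v * ‖𝒢.e q‖ := by
  conv_lhs => rw [← 𝒢.e.sum_repr v]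
  refine norm_sum_le_of_le _ fun q _ => ?_
  rw [norm_smul, Real.norm_eq_abs]
  gcongr
  exact 𝒢.abs_repr_le_seminorm q v

theorem continuous_seminorm (q : Fin n) : Continuous (𝒢.seminorm q) :=
  continuousOn_univ.1 ((𝒢.seminorm q).convexOn.continuousOn isOpen_univ)

theorem tendsto_of_forall_tendsto_seminorm {ι : Type*} {l : Filter ι} {f : ι → RSpace n}
    {v : RSpace n} (h : ∀ q, Tendsto (fun i => 𝒢.seminorm q (f i - v)) l (𝓝 0)) :
    Tendsto f l (𝓝 v) := by
  rw [tendsto_iff_norm_sub_tendsto_zero]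
  refine squeeze_zero (fun i => norm_nonneg _) (fun i => 𝒢.norm_le_sum_seminorm _) ?_
  simpa using tendsto_finsetSum Finset.univ fun q _ => (h q).mul_const ‖𝒢.e q‖

theorem exists_forall_seminorm_lt_imp_mem {U : Set (RSpace n)} (hU : U ∈ 𝓝 0) :
    ∃ ε > 0, ∀ v, (∀ q, 𝒢.seminorm q v < ε) → v ∈ U := by
  let f : RSpace n → Fin n → ℝ := fun v q => 𝒢.seminorm q v
  have hf : Tendsto id (comap f (𝓝 0)) (𝓝 0) := 𝒢.tendsto_of_forall_tendsto_seminorm fun q => by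
    simpa using tendsto_pi_nhds.1 (tendsto_comap (f := f) (x := 𝓝 0)) q
  obtain ⟨ε, hε, hεU⟩ := (Metric.nhds_basis_ball.comap f).mem_iff.1 (hf hU)
  refine ⟨ε, hε, fun v hv => hεU ?_⟩
  rw [mem_preimage, mem_ball_zero_iff, pi_norm_lt_iff hε]
  exact fun q => by simpa only [f, Real.norm_of_nonneg (apply_nonneg _ _)] using hv q

theorem isCompact_setOf_forall_seminorm_le (c : RSpace n) (R : Fin n → ℝ) :
    IsCompact {v | ∀ q, 𝒢.seminorm q (v - c) ≤ R q} := by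
  refine Metric.isCompact_of_isClosed_isBounded ?_ ?_
  · simp only [ofPred_forall]
    exact isClosed_iInter fun q => isClosed_le
      ((𝒢.continuous_seminorm q).comp (by fun_prop)) continuous_const
  · refine (Metric.isBounded_closedBall (x := c) (r := ∑ q, R q * ‖𝒢.e q‖)).subset fun v hv => ?_
    rw [Metric.mem_closedBall, dist_eq_norm]
    exact (𝒢.norm_le_sum_seminorm _).trans (Finset.sum_le_sum fun q _ =>
      mul_le_mul_of_nonneg_right (hv q) (norm_nonneg _))

theorem mem_neutral_of_forall_seminorm_eq_zero {p : RSpace n}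
    (hp : ∀ q, 𝒢.d q ≠ 0 → 𝒢.seminorm q p = 0) : p ∈ 𝒢.neutral := by
  rw [neutral, Module.Basis.mem_span_image]
  intro q hq
  by_contra hdq
  have := 𝒢.abs_repr_le_seminorm q p
  rw [hp q hdq, abs_nonpos_iff] at this
  exact Finsupp.mem_support_iff.1 hq this

theorem seminorm_a {s : ℝ} (hs : 0 < s) (q : Fin n) (v : RSpace n) :
    𝒢.seminorm q (𝒢.a s v) = s ^ 𝒢.d q * 𝒢.seminorm q v := by
  rw [seminorm_apply, seminorm_apply, Real.mul_iSup_of_nonneg (Real.rpow_nonneg hs.le _)]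
  refine iSup_congr fun k => ?_
  have hk : (k : (RSpace n →L[ℝ] RSpace n)ˣ) • 𝒢.a s v =
      𝒢.a s ((k : (RSpace n →L[ℝ] RSpace n)ˣ) • v) := 𝒢.K_centralizes k k.2 s hs v
  rw [hk, repr_a, abs_mul, abs_of_nonneg (Real.rpow_nonneg hs.le _)]

section Nonneg

variable (hd : ∀ q, 0 ≤ 𝒢.d q)

include hd

theorem eventually_forall_rpow_lt {ε : ℝ} (hε : 0 < ε) :
    ∀ᶠ s : ℝ in 𝓝[>] 0, ∀ q, 𝒢.d q ≠ 0 → s ^ 𝒢.d q < ε := by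
  refine eventually_all.2 fun q => eventually_imp_distrib_left.2 fun hq => ?_
  have := (Real.continuous_rpow_const (hd q)).tendsto 0
  rw [Real.zero_rpow hq] at this
  exact (this.mono_left nhdsWithin_le_nhds).eventually_lt_const hε

theorem tendsto_a (v : RSpace n) (s : ℝ) : Tendsto (fun t => 𝒢.a t v) (𝓝 s) (𝓝 (𝒢.a s v)) := by
  have h : ∀ t, 𝒢.a t v = ∑ q, (t ^ 𝒢.d q * 𝒢.e.repr v q) • 𝒢.e q := fun t => by
    rw [← 𝒢.e.sum_repr (𝒢.a t v)]
    simp only [repr_a]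
  simp only [h]
  exact tendsto_finsetSum _ fun q _ =>
    (((Real.continuous_rpow_const (hd q)).tendsto s).mul_const _).smul_const _

theorem smul_a {k : (RSpace n →L[ℝ] RSpace n)ˣ} (hk : k ∈ 𝒢.K) {s : ℝ} (hs : 0 ≤ s)
    (v : RSpace n) : k • 𝒢.a s v = 𝒢.a s (k • v) := by
  rcases hs.lt_or_eq with h | rfl
  · exact 𝒢.K_centralizes k hk s h v
  · have hlim : Tendsto (fun t => k • 𝒢.a t v) (𝓝[>] 0) (𝓝 (k • 𝒢.a 0 v)) :=
      ((k : RSpace n →L[ℝ] RSpace n).continuous.tendsto _).comp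
        ((𝒢.tendsto_a hd v 0).mono_left nhdsWithin_le_nhds)
    refine tendsto_nhds_unique hlim
      (((𝒢.tendsto_a hd (k • v) 0).mono_left nhdsWithin_le_nhds).congr' ?_)
    filter_upwards [self_mem_nhdsWithin] with t ht using (𝒢.K_centralizes k hk t ht v).symm

theorem seminorm_sub_a {s : ℝ} (hs : 0 ≤ s) (q : Fin n) (v : RSpace n) :
    𝒢.seminorm q (v - 𝒢.a s v) = |1 - s ^ 𝒢.d q| * 𝒢.seminorm q v := by
  rw [seminorm_apply, seminorm_apply, Real.mul_iSup_of_nonneg (abs_nonneg _)]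
  refine iSup_congr fun k => ?_
  rw [smul_sub, 𝒢.smul_a hd k.2 hs, map_sub, Finsupp.sub_apply, repr_a, ← abs_mul, sub_mul, one_mul]

theorem seminorm_eq_zero_of_mem_neutral {p : RSpace n} (hp : p ∈ 𝒢.neutral) {q : Fin n}
    (hq : 𝒢.d q ≠ 0) : 𝒢.seminorm q p = 0 := by
  have := 𝒢.seminorm_sub_a hd le_rfl q p
  rwa [𝒢.a_zero_eq_self_iff.2 hp, sub_self, map_zero, Real.zero_rpow hq, sub_zero, abs_one, one_mul,
    eq_comm] at this

theorem seminorm_eq_zero_of_a_zero_eq_zero {u : RSpace n} (hu : 𝒢.a 0 u = 0) {q : Fin n}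
    (hq : 𝒢.d q = 0) : 𝒢.seminorm q u = 0 := by
  have := 𝒢.seminorm_sub_a hd le_rfl q u
  rwa [hu, hq, sub_zero, Real.rpow_zero, sub_self, abs_zero, zero_mul] at this

end Nonneg

theorem exists_linear_eq_smul_a (T : 𝒢.G) : ∃ s : ℝ, 0 < s ∧ ∃ k ∈ 𝒢.K,
    ∀ v, (T : RSpace n ≃ᵃ[ℝ] RSpace n).linear v = k • 𝒢.a s v := by
  obtain ⟨T, k, hk, s, hs, h⟩ := T
  exact ⟨s, hs, k, hk, h⟩

/-- The parameter `s` of a factor `a s` in a decomposition of the linear part of `T` in `K A`. -/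
noncomputable def scale (T : 𝒢.G) : ℝ := (𝒢.exists_linear_eq_smul_a T).choose

theorem scale_pos (T : 𝒢.G) : 0 < 𝒢.scale T := (𝒢.exists_linear_eq_smul_a T).choose_spec.1

theorem exists_linear_eq_smul_a_scale (T : 𝒢.G) : ∃ k ∈ 𝒢.K,
    ∀ v, (T : RSpace n ≃ᵃ[ℝ] RSpace n).linear v = k • 𝒢.a (𝒢.scale T) v :=
  (𝒢.exists_linear_eq_smul_a T).choose_spec.2

theorem seminorm_linear (T : 𝒢.G) (q : Fin n) (v : RSpace n) :
    𝒢.seminorm q ((T : RSpace n ≃ᵃ[ℝ] RSpace n).linear v) =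
      𝒢.scale T ^ 𝒢.d q * 𝒢.seminorm q v := by
  obtain ⟨k, hk, h⟩ := 𝒢.exists_linear_eq_smul_a_scale T
  rw [h, 𝒢.seminorm_smul hk, 𝒢.seminorm_a (𝒢.scale_pos T)]

theorem linear_a (hd : ∀ q, 0 ≤ 𝒢.d q) (T : 𝒢.G) {t : ℝ} (ht : 0 ≤ t) (v : RSpace n) :
    (T : RSpace n ≃ᵃ[ℝ] RSpace n).linear (𝒢.a t v) =
      𝒢.a t ((T : RSpace n ≃ᵃ[ℝ] RSpace n).linear v) := by
  obtain ⟨k, hk, h⟩ := 𝒢.exists_linear_eq_smul_a_scale T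
  have hs := (𝒢.scale_pos T).le
  rw [h, h, ← 𝒢.a_mul hs ht, mul_comm, 𝒢.a_mul ht hs, 𝒢.smul_a hd hk ht]

/-- The box of size `R` around `c`, of half-width `R ^ d q` in the `q`-th coordinate. It is
unbounded in the neutral directions, so that elements of `G` map boxes to boxes. -/
def box (c : RSpace n) (R : ℝ) : Set (RSpace n) :=
  {v | ∀ q, 𝒢.d q ≠ 0 → 𝒢.seminorm q (v - c) < R ^ 𝒢.d q}

theorem convex_box (c : RSpace n) (R : ℝ) : Convex ℝ (𝒢.box c R) := by
  have : 𝒢.box c R = ⋂ q, ⋂ (_ : 𝒢.d q ≠ 0), (𝒢.seminorm q).ball c (R ^ 𝒢.d q) := by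
    ext v
    simp [box, Seminorm.mem_ball]
  rw [this]
  exact convex_iInter fun q => convex_iInter fun _ => (𝒢.seminorm q).convex_ball _ _

theorem mem_box_self (c : RSpace n) {R : ℝ} (hR : 0 < R) : c ∈ 𝒢.box c R := fun q _ => by
  simpa using Real.rpow_pos_of_pos hR _

theorem isOpen_box (c : RSpace n) (R : ℝ) : IsOpen (𝒢.box c R) := by
  simp only [box, ofPred_forall]
  exact isOpen_iInter_of_finite fun q => isOpen_iInter_of_finite fun _ =>
    isOpen_lt ((𝒢.continuous_seminorm q).comp (by fun_prop)) continuous_const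

theorem lineMap_mem_box {c x w : RSpace n} {R : ℝ} (hx : x ∈ 𝒢.box c R)
    (hw : ∀ q, 𝒢.d q ≠ 0 → 𝒢.seminorm q (w - c) ≤ R ^ 𝒢.d q) {t : ℝ} (ht : t ∈ Ico (0 : ℝ) 1) :
    AffineMap.lineMap x w t ∈ 𝒢.box c R := by
  intro q hq
  have hsub : AffineMap.lineMap x w t - c = (1 - t) • (x - c) + t • (w - c) := by
    rw [AffineMap.lineMap_apply_module]
    module
  have h1t : 0 < 1 - t := sub_pos.2 ht.2
  calc 𝒢.seminorm q (AffineMap.lineMap x w t - c)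
      ≤ (1 - t) * 𝒢.seminorm q (x - c) + t * 𝒢.seminorm q (w - c) := by
        rw [hsub]
        refine (map_add_le_add _ _ _).trans_eq ?_
        rw [map_smul_eq_mul, map_smul_eq_mul, Real.norm_of_nonneg ht.1, Real.norm_of_nonneg h1t.le]
    _ < (1 - t) * R ^ 𝒢.d q + t * R ^ 𝒢.d q :=
        add_lt_add_of_lt_of_le (mul_lt_mul_of_pos_left (hx q hq) h1t)
          (mul_le_mul_of_nonneg_left (hw q hq) ht.1)
    _ = R ^ 𝒢.d q := by ring

theorem box_subset_box (hd : ∀ q, 0 ≤ 𝒢.d q) (c : RSpace n) {R R' : ℝ} (hR : 0 ≤ R) (h : R ≤ R') :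
    𝒢.box c R ⊆ 𝒢.box c R' := fun _ hv q hq =>
  (hv q hq).trans_le (Real.rpow_le_rpow hR h (hd q))

end RankOneRayGeometry

namespace RayStructure

variable {n : ℕ} {𝒢 : RankOneRayGeometry n} {M N : Type*} [TopologicalSpace M] [TopologicalSpace N]
  (X : RayStructure 𝒢 M N)

/-- The factor by which a deck transformation rescales the model space. -/
noncomputable abbrev scale (g : deckGroup X.p) : ℝ := 𝒢.scale (X.ρ g)

/-- The affine map by which a deck transformation acts on the model space. -/
noncomputable abbrev hol (g : deckGroup X.p) : RSpace n ≃ᵃ[ℝ] RSpace n :=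
  (X.ρ g : RSpace n ≃ᵃ[ℝ] RSpace n)

theorem hol_sub (g : deckGroup X.p) (v w : RSpace n) :
    X.hol g v - X.hol g w = (X.hol g).linear (v - w) :=
  (AffineMap.linearMap_vsub (X.hol g : RSpace n →ᵃ[ℝ] RSpace n) v w).symm

theorem hol_add (g : deckGroup X.p) (v w : RSpace n) :
    X.hol g (v + w) = X.hol g v + (X.hol g).linear w := by
  rw [← sub_eq_iff_eq_add', hol_sub, add_sub_cancel_left]

theorem seminorm_hol_sub (g : deckGroup X.p) (q : Fin n) (v w : RSpace n) :
    𝒢.seminorm q (X.hol g v - X.hol g w) = X.scale g ^ 𝒢.d q * 𝒢.seminorm q (v - w) := by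
  rw [hol_sub, 𝒢.seminorm_linear]

theorem hol_mem_box_iff (g : deckGroup X.p) (z : N) {v : RSpace n} {R : ℝ} (hR : 0 ≤ R) :
    X.hol g v ∈ 𝒢.box (X.D ((g : N ≃ₜ N) z)) (X.scale g * R) ↔ v ∈ 𝒢.box (X.D z) R := by
  refine forall₂_congr fun q _ => ?_
  rw [X.equivariant g, X.seminorm_hol_sub, Real.mul_rpow (𝒢.scale_pos _).le hR]
  exact mul_lt_mul_iff_right₀ (Real.rpow_pos_of_pos (𝒢.scale_pos _) _)

/-- The box of size `R` around the developed image of `z` is visible from `z`. -/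
def BoxVisible (z : N) (R : ℝ) : Prop := ∀ v ∈ 𝒢.box (X.D z) R, Visible X.D z v

/-- The size of the largest visible box around `z`. The supremum is junk if `z` sees all of the
model space. -/
noncomputable def radius (z : N) : ℝ := sSup {R | 0 < R ∧ X.BoxVisible z R}

theorem bddAbove_boxVisible (hd : ∀ q, 0 ≤ 𝒢.d q) {z : N} (h : ∃ v, ¬ Visible X.D z v) :
    BddAbove {R | 0 < R ∧ X.BoxVisible z R} := by
  obtain ⟨v, hv⟩ := h
  have hev : ∀ᶠ R : ℝ in atTop, v ∈ 𝒢.box (X.D z) R :=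
    eventually_all.2 fun q => eventually_imp_distrib_left.2 fun hq =>
      (tendsto_rpow_atTop ((hd q).lt_of_ne' hq)).eventually_gt_atTop _
  obtain ⟨R₀, hR₀⟩ := eventually_atTop.1 hev
  exact ⟨R₀, fun R hR => le_of_not_ge fun hle => hv (hR.2 v (hR₀ R hle))⟩

section Visibility

variable [T2Space N]

theorem visible_deck_iff (g : deckGroup X.p) {z : N} {v : RSpace n} :
    Visible X.D ((g : N ≃ₜ N) z) (X.hol g v) ↔ Visible X.D z v :=
  visible_map_iff X.D_local _ _ (X.equivariant g)

theorem expMap_deck (g : deckGroup X.p) {z : N} {v : RSpace n} (h : Visible X.D z v) :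
    expMap X.D ((g : N ≃ₜ N) z) (X.hol g v) = (g : N ≃ₜ N) (expMap X.D z v) :=
  (h.map X.D_local _ _ (X.equivariant g)).2

theorem boxVisible_deck_iff (g : deckGroup X.p) {z : N} {R : ℝ} (hR : 0 ≤ R) :
    X.BoxVisible ((g : N ≃ₜ N) z) (X.scale g * R) ↔ X.BoxVisible z R := by
  rw [BoxVisible, BoxVisible, (X.hol g).surjective.forall]
  simp only [X.hol_mem_box_iff g z hR, X.visible_deck_iff g]

section Neutral

variable [SimplyConnectedSpace N] [CompactSpace M] (hd : ∀ q, 0 ≤ 𝒢.d q)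

include hd

/-- Deck transformations preserve the seminorms of neutral vectors, so that a bound over a compact
fundamental set is uniform. -/
theorem exists_forall_visible_add_of_seminorm_lt : ∃ ε > 0, ∀ (z : N), ∀ p ∈ 𝒢.neutral,
    (∀ q, 𝒢.seminorm q p < ε) → Visible X.D z (X.D z + p) := by
  obtain ⟨Q, hQ, hcov⟩ := X.exists_isCompact_forall_exists_deck_mem
  have hDc := X.D_local.continuous
  have h : ∀ᶠ p in 𝓝 (0 : RSpace n), ∀ z ∈ Q, Visible X.D z (X.D z + p) := by
    refine hQ.eventually_forall_of_forall_eventually fun z _ => ?_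
    have hc : Tendsto (fun x : RSpace n × N => (x.2, X.D x.2 + x.1)) (𝓝 (0, z))
        (𝓝 (z, X.D z)) := by
      have : Continuous fun x : RSpace n × N => (x.2, X.D x.2 + x.1) := by fun_prop
      simpa using this.tendsto (0, z)
    exact hc.eventually ((visible_self X.D z).eventually_and_continuousAt_expMap X.D_local).1
  obtain ⟨ε, hε, hU⟩ := 𝒢.exists_forall_seminorm_lt_imp_mem h
  refine ⟨ε, hε, fun z p hp hpε => ?_⟩
  obtain ⟨g, hg⟩ := hcov z
  rw [← X.visible_deck_iff g, hol_add, ← X.equivariant g]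
  refine hU _ (fun q => ?_) _ hg
  rw [𝒢.seminorm_linear]
  by_cases hq : 𝒢.d q = 0
  · simpa [hq] using hpε q
  · simpa [𝒢.seminorm_eq_zero_of_mem_neutral hd hp hq] using hε

theorem visible_add_of_mem_neutral (z : N) {p : RSpace n} (hp : p ∈ 𝒢.neutral) :
    Visible X.D z (X.D z + p) := by
  obtain ⟨ε, hε, hvis⟩ := X.exists_forall_visible_add_of_seminorm_lt hd
  obtain ⟨m, hm, hm₀⟩ : ∃ m : ℕ, (∀ q, 𝒢.seminorm q ((m : ℝ)⁻¹ • p) < ε) ∧ m ≠ 0 := by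
    refine ((eventually_all.2 fun q => ?_).and (eventually_ne_atTop 0)).exists
    have hlim := (tendsto_inv_atTop_nhds_zero_nat (𝕜 := ℝ)).smul_const p
    rw [zero_smul] at hlim
    exact (((𝒢.continuous_seminorm q).tendsto _).comp hlim).eventually_lt_const (by simpa using hε)
  have hstep : ∀ y, ∀ t ∈ Icc (0 : ℝ) 1, Visible X.D y (X.D y + t • (m : ℝ)⁻¹ • p) := by
    refine fun y t ht => hvis y _ (𝒢.neutral.smul_mem _ (𝒢.neutral.smul_mem _ hp)) fun q => ?_
    rw [map_smul_eq_mul, Real.norm_of_nonneg ht.1]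
    exact (mul_le_of_le_one_left (apply_nonneg _ _) ht.2).trans_lt (hm q)
  have hmul : ∀ j : ℕ, Visible X.D z (X.D z + (j : ℝ) • (m : ℝ)⁻¹ • p) := by
    intro j
    induction j with
    | zero => simpa using visible_self X.D z
    | succ j ih =>
      rw [Nat.cast_succ, add_smul, one_smul, ← add_assoc]
      exact ih.add_of_forall_visible X.D_local hstep
  simpa [smul_smul, hm₀] using hmul m

theorem visible_add_iff_of_mem_neutral {z : N} {v p : RSpace n} (hp : p ∈ 𝒢.neutral) :
    Visible X.D z (v + p) ↔ Visible X.D z v := by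
  have key : ∀ {v p : RSpace n}, p ∈ 𝒢.neutral → Visible X.D z v → Visible X.D z (v + p) :=
    fun hp h => h.add_of_forall_visible X.D_local fun y t _ =>
      X.visible_add_of_mem_neutral hd y (𝒢.neutral.smul_mem t hp)
  exact ⟨fun h => by simpa using key (neg_mem hp) h, key hp⟩

end Neutral

section Radius

variable [SimplyConnectedSpace N] [CompactSpace M] (hd : ∀ q, 0 ≤ 𝒢.d q)

include hd

theorem exists_boxVisible (z : N) : ∃ R > 0, X.BoxVisible z R := by
  have hU : {u | Visible X.D z (X.D z + u)} ∈ 𝓝 (0 : RSpace n) :=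
    ((isOpen_setOf_visible X.D_local z).preimage
      (by fun_prop : Continuous fun u => X.D z + u)).mem_nhds (by simpa using visible_self X.D z)
  obtain ⟨ε, hε, hεU⟩ := 𝒢.exists_forall_seminorm_lt_imp_mem hU
  obtain ⟨R, hR, hR0⟩ := ((𝒢.eventually_forall_rpow_lt hd hε).and self_mem_nhdsWithin).exists
  refine ⟨R, hR0, fun v hv => ?_⟩
  have hvis : Visible X.D z (X.D z + (v - X.D z - 𝒢.a 0 (v - X.D z))) := by
    refine hεU _ fun q => ?_
    rw [𝒢.seminorm_sub_a hd le_rfl]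
    by_cases hq : 𝒢.d q = 0
    · simpa [hq] using hε
    · simpa [Real.zero_rpow hq] using (hv q hq).trans (hR q hq)
  rw [← X.visible_add_iff_of_mem_neutral hd (𝒢.a_zero_mem_neutral (v - X.D z))] at hvis
  rwa [add_assoc, sub_add_cancel, add_sub_cancel] at hvis

variable (hinc : ∀ z, ∃ v, ¬ Visible X.D z v)

include hinc

theorem radius_pos (z : N) : 0 < X.radius z := by
  obtain ⟨R, hR, h⟩ := X.exists_boxVisible hd z
  exact hR.trans_le (le_csSup (X.bddAbove_boxVisible hd (hinc z)) ⟨hR, h⟩)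

theorem boxVisible_radius (z : N) : X.BoxVisible z (X.radius z) := by
  intro v hv
  have hev : ∀ᶠ R : ℝ in 𝓝[<] X.radius z, v ∈ 𝒢.box (X.D z) R :=
    eventually_all.2 fun q => eventually_imp_distrib_left.2 fun hq =>
      (((Real.continuous_rpow_const (hd q)).tendsto (X.radius z)).mono_left
        nhdsWithin_le_nhds).eventually_const_lt (hv q hq)
  obtain ⟨R, hR, hR0, hRr⟩ := (hev.and (Ioo_mem_nhdsLT (X.radius_pos hd hinc z))).exists
  obtain ⟨R', hR', hlt⟩ := exists_lt_of_lt_csSup (X.exists_boxVisible hd z) hRr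
  exact hR'.2 v (𝒢.box_subset_box hd _ hR0.le hlt.le hR)

theorem boxVisible_iff_le_radius (z : N) {R : ℝ} (hR : 0 < R) :
    X.BoxVisible z R ↔ R ≤ X.radius z :=
  ⟨fun h => le_csSup (X.bddAbove_boxVisible hd (hinc z)) ⟨hR, h⟩,
    fun h v hv => X.boxVisible_radius hd hinc z v (𝒢.box_subset_box hd _ hR.le h hv)⟩

theorem radius_le_of_not_visible {z : N} {w : RSpace n} {R : ℝ} (hw : ¬ Visible X.D z w)
    (hR : 0 ≤ R) (h : ∀ q, 𝒢.d q ≠ 0 → 𝒢.seminorm q (w - X.D z) ≤ R ^ 𝒢.d q) :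
    X.radius z ≤ R := by
  by_contra! hlt
  exact hw (X.boxVisible_radius hd hinc z w fun q hq => (h q hq).trans_lt
    (Real.rpow_lt_rpow hR hlt ((hd q).lt_of_ne' hq)))

theorem radius_deck (g : deckGroup X.p) (z : N) :
    X.radius ((g : N ≃ₜ N) z) = X.scale g * X.radius z := by
  have hs := 𝒢.scale_pos (X.ρ g)
  refine eq_of_forall_le_iff fun R => ?_
  rcases le_or_gt R 0 with hR | hR
  · exact iff_of_true (hR.trans (X.radius_pos hd hinc _).le)
      (hR.trans (mul_pos hs (X.radius_pos hd hinc z)).le)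
  · have hR' : 0 < (X.scale g)⁻¹ * R := mul_pos (inv_pos.2 hs) hR
    rw [← inv_mul_le_iff₀ hs, ← X.boxVisible_iff_le_radius hd hinc _ hR,
      ← X.boxVisible_iff_le_radius hd hinc _ hR', ← X.boxVisible_deck_iff g hR'.le,
      mul_inv_cancel_left₀ hs.ne']

end Radius

end Visibility

end RayStructure

namespace RankOneRayGeometry

variable {n : ℕ} (𝒢 : RankOneRayGeometry n) (hd : ∀ q, 0 ≤ 𝒢.d q)

include hd

theorem box_add_a_sub_subset_box {c w : RSpace n} {R s : ℝ} (hs : s ∈ Ioc (0 : ℝ) 1) (hR : 0 ≤ R)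
    (hw : ∀ q, 𝒢.d q ≠ 0 → 𝒢.seminorm q (w - c) ≤ R ^ 𝒢.d q) :
    𝒢.box (w + 𝒢.a s (c - w)) (s * R) ⊆ 𝒢.box c R := by
  intro v hv q hq
  have hs1 : s ^ 𝒢.d q ≤ 1 := Real.rpow_le_one hs.1.le hs.2 (hd q)
  have hsub : v - c = (v - (w + 𝒢.a s (c - w))) + ((w - c) - 𝒢.a s (w - c)) := by
    rw [← neg_sub w c, map_neg]
    abel
  calc 𝒢.seminorm q (v - c)
      ≤ 𝒢.seminorm q (v - (w + 𝒢.a s (c - w))) + 𝒢.seminorm q ((w - c) - 𝒢.a s (w - c)) := by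
        rw [hsub]
        exact map_add_le_add _ _ _
    _ < s ^ 𝒢.d q * R ^ 𝒢.d q + (1 - s ^ 𝒢.d q) * R ^ 𝒢.d q := by
        refine add_lt_add_of_lt_of_le ?_ ?_
        · rw [← Real.mul_rpow hs.1.le hR]
          exact hv q hq
        · rw [𝒢.seminorm_sub_a hd hs.1.le, abs_of_nonneg (sub_nonneg.2 hs1)]
          exact mul_le_mul_of_nonneg_left (hw q hq) (sub_nonneg.2 hs1)
    _ = R ^ 𝒢.d q := by ring

theorem rpow_mul_seminorm_sub_le {c c' w w' : RSpace n} {s : ℝ} (hs : s ∈ Ioc (0 : ℝ) 1)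
    (q : Fin n) :
    s ^ 𝒢.d q * 𝒢.seminorm q (c' - c) ≤
      𝒢.seminorm q (w' + 𝒢.a s (c' - w') - (w + 𝒢.a s (c - w))) + 𝒢.seminorm q (w' - w) := by
  have hs1 : s ^ 𝒢.d q ≤ 1 := Real.rpow_le_one hs.1.le hs.2 (hd q)
  have hs0 : 0 ≤ s ^ 𝒢.d q := Real.rpow_nonneg hs.1.le _
  have hsub : 𝒢.a s (c' - c) = (w' + 𝒢.a s (c' - w') - (w + 𝒢.a s (c - w))) -
      ((w' - w) - 𝒢.a s (w' - w)) := by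
    simp only [map_sub]
    abel
  rw [← 𝒢.seminorm_a hs.1, hsub]
  refine (map_sub_le_add _ _ _).trans (add_le_add_right ?_ _)
  rw [𝒢.seminorm_sub_a hd hs.1.le, abs_of_nonneg (sub_nonneg.2 hs1)]
  exact mul_le_of_le_one_left (apply_nonneg _ _) (sub_le_self _ hs0)

end RankOneRayGeometry

namespace RayStructure

variable {n : ℕ} {𝒢 : RankOneRayGeometry n} {M N : Type*} [TopologicalSpace M] [TopologicalSpace N]
  (X : RayStructure 𝒢 M N)

/-- `w` is a nearest invisible point: it is not visible from `z` and lies on the boundary of the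
largest visible box, at the same height as `z` in the neutral directions. -/
structure Nearest (z : N) (w : RSpace n) : Prop where
  not_visible : ¬ Visible X.D z w
  a_zero_sub_eq_zero : 𝒢.a 0 (w - X.D z) = 0
  seminorm_sub_le : ∀ q, 𝒢.seminorm q (w - X.D z) ≤ X.radius z ^ 𝒢.d q

/-- The point that divides the segment from `z` to `w`, in the sense of the group `A`, with
ratio `s`. -/
noncomputable def shrink (z : N) (w : RSpace n) (s : ℝ) : N := expMap X.D z (w + 𝒢.a s (X.D z - w))

/-- The pairs `(z, w)` and `(z', w')` are `ε`-close at the scale of the largest visible boxes. -/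
structure Near (ε : ℝ) (z : N) (w : RSpace n) (z' : N) (w' : RSpace n) : Prop where
  expMap_eq : expMap X.D z (X.D z') = z'
  base : ∀ q, 𝒢.seminorm q (X.D z' - X.D z) < ε * X.radius z ^ 𝒢.d q
  tip : ∀ q, 𝒢.seminorm q (w' - w) < ε * X.radius z ^ 𝒢.d q
  upper : ∀ q, X.radius z' ^ 𝒢.d q ≤ (1 + ε) * X.radius z ^ 𝒢.d q
  lower : ∀ q, X.radius z ^ 𝒢.d q ≤ (1 + ε) * X.radius z' ^ 𝒢.d q

variable [T2Space N]

theorem exists_forall_seminorm_lt_imp_eq {Q : Set N} (hQ : IsCompact Q) :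
    ∃ δ > 0, ∀ z ∈ Q, ∀ z', (∀ q, 𝒢.seminorm q (X.D z' - X.D z) < δ) →
      expMap X.D z (X.D z') = z' → X.p z' = X.p z → z' = z := by
  have hDc := X.D_local.continuous
  have hev : ∀ᶠ v in 𝓝 (0 : RSpace n), ∀ z ∈ Q, ∀ x, expMap X.D z (X.D z + v) = x →
      X.p x = X.p z → x = z := by
    refine hQ.eventually_forall_of_forall_eventually fun z _ => ?_
    obtain ⟨U, hU, hzU, hinj⟩ := X.p_covering.isLocalHomeomorph.isLocallyInjective z
    have hexp : ContinuousAt (fun x : RSpace n × N => expMap X.D x.2 (X.D x.2 + x.1)) (0, z) :=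
      ContinuousAt.comp_of_eq (g := fun x : N × RSpace n => expMap X.D x.1 x.2)
        (f := fun x : RSpace n × N => (x.2, X.D x.2 + x.1))
        ((visible_self X.D z).eventually_and_continuousAt_expMap X.D_local).2 (by fun_prop)
        (by simp)
    filter_upwards [hexp.eventually (hU.mem_nhds (by simpa [expMap_self X.D_local] using hzU)),
      continuous_snd.continuousAt.eventually (hU.mem_nhds hzU)] with x hx hxU y hy hp
    rw [hy] at hx
    exact hinj hx hxU hp
  obtain ⟨δ, hδ, hδU⟩ := 𝒢.exists_forall_seminorm_lt_imp_mem hev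
  refine ⟨δ, hδ, fun z hz z' hlt hexp => hδU (X.D z' - X.D z) hlt z hz z' ?_⟩
  rwa [add_sub_cancel]

variable [SimplyConnectedSpace N] [CompactSpace M]
  (hd : ∀ q, 0 ≤ 𝒢.d q) (hinc : ∀ z, ∃ v, ¬ Visible X.D z v)

include hd hinc

theorem le_radius_expMap {z : N} {c : RSpace n} (hc : c ∈ 𝒢.box (X.D z) (X.radius z)) {R : ℝ}
    (hR : 0 < R) (hsub : 𝒢.box c R ⊆ 𝒢.box (X.D z) (X.radius z)) :
    R ≤ X.radius (expMap X.D z c) := by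
  have hvis := X.boxVisible_radius hd hinc z
  rw [← X.boxVisible_iff_le_radius hd hinc _ hR]
  intro v hv
  rw [(hvis c hc).apply_expMap] at hv
  exact (visible_expMap_of_convex X.D_local (𝒢.convex_box _ _) hvis hc (hsub hv)).1

theorem not_visible_expMap {z : N} {w c : RSpace n} (hw : ¬ Visible X.D z w)
    (hle : ∀ q, 𝒢.d q ≠ 0 → 𝒢.seminorm q (w - X.D z) ≤ X.radius z ^ 𝒢.d q)
    (hc : c ∈ 𝒢.box (X.D z) (X.radius z)) : ¬ Visible X.D (expMap X.D z c) w := by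
  intro hv
  have hz := 𝒢.mem_box_self (X.D z) (X.radius_pos hd hinc z)
  have := visible_expMap_of_mem_closure X.D_local (𝒢.convex_box _ _)
    (X.boxVisible_radius hd hinc z) hz hc (fun t ht => 𝒢.lineMap_mem_box hz hle ht) hv
  rw [expMap_self X.D_local] at this
  exact hw this

theorem exists_not_visible_of_radius_lt {z : N} {R : ℝ} (hR : X.radius z < R) :
    ∃ w, ¬ Visible X.D z w ∧ 𝒢.a 0 (w - X.D z) = 0 ∧
      ∀ q, 𝒢.seminorm q (w - X.D z) ≤ R ^ 𝒢.d q := by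
  have hR0 : 0 < R := (X.radius_pos hd hinc z).trans hR
  have hbox : ¬ X.BoxVisible z R := by
    rw [X.boxVisible_iff_le_radius hd hinc z hR0]
    exact hR.not_ge
  simp only [BoxVisible, not_forall] at hbox
  obtain ⟨v, hv, hvis⟩ := hbox
  have hsub : v - 𝒢.a 0 (v - X.D z) - X.D z = v - X.D z - 𝒢.a 0 (v - X.D z) := by abel
  have ha : 𝒢.a 0 (v - X.D z - 𝒢.a 0 (v - X.D z)) = 0 := by
    rw [map_sub, 𝒢.a_zero_a le_rfl, sub_self]
  refine ⟨v - 𝒢.a 0 (v - X.D z), fun h => hvis ?_, by rw [hsub, ha], fun q => ?_⟩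
  · rw [← X.visible_add_iff_of_mem_neutral hd (𝒢.a_zero_mem_neutral (v - X.D z))] at h
    rwa [sub_add_cancel] at h
  · rw [hsub]
    by_cases hq : 𝒢.d q = 0
    · rw [𝒢.seminorm_eq_zero_of_a_zero_eq_zero hd ha hq]
      exact Real.rpow_nonneg hR0.le _
    · rw [𝒢.seminorm_sub_a hd le_rfl, Real.zero_rpow hq, sub_zero, abs_one, one_mul]
      exact (hv q hq).le

theorem exists_nearest (z : N) : ∃ w, X.Nearest z w := by
  obtain ⟨R, hRanti, hR, hRlim⟩ := exists_seq_strictAnti_tendsto (X.radius z)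
  choose w hvis ha hle using fun k => X.exists_not_visible_of_radius_lt hd hinc (hR k)
  have hR0 : ∀ k, 0 ≤ R k := fun k => ((X.radius_pos hd hinc z).trans (hR k)).le
  obtain ⟨w₀, -, φ, hφ, hlim⟩ :=
    (𝒢.isCompact_setOf_forall_seminorm_le (X.D z) fun q => R 0 ^ 𝒢.d q).tendsto_subseq
      fun k q => (hle k q).trans
        (Real.rpow_le_rpow (hR0 k) (hRanti.antitone (Nat.zero_le k)) (hd q))
  have hsub : Tendsto (fun k => w (φ k) - X.D z) atTop (𝓝 (w₀ - X.D z)) := hlim.sub_const _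
  refine ⟨w₀, ?_, ?_, fun q => ?_⟩
  · exact (isOpen_setOf_visible X.D_local z).isClosed_compl.mem_of_tendsto hlim
      (Eventually.of_forall fun k => hvis (φ k))
  · refine tendsto_nhds_unique
      (((𝒢.a 0).continuous_of_finiteDimensional.tendsto _).comp hsub) ?_
    exact tendsto_const_nhds.congr fun k => (ha (φ k)).symm
  · exact le_of_tendsto_of_tendsto' (((𝒢.continuous_seminorm q).tendsto _).comp hsub)
      (((Real.continuous_rpow_const (hd q)).tendsto _).comp (hRlim.comp hφ.tendsto_atTop))
      fun k => hle (φ k) q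

theorem rpow_radius_pos (z : N) (q : Fin n) : 0 < X.radius z ^ 𝒢.d q :=
  Real.rpow_pos_of_pos (X.radius_pos hd hinc z) _

theorem rpow_radius_deck (g : deckGroup X.p) (z : N) (q : Fin n) :
    X.radius ((g : N ≃ₜ N) z) ^ 𝒢.d q = X.scale g ^ 𝒢.d q * X.radius z ^ 𝒢.d q := by
  rw [X.radius_deck hd hinc, Real.mul_rpow (𝒢.scale_pos _).le (X.radius_pos hd hinc z).le]

theorem eventually_mem_box_and_expMap_eq (z : N) :
    ∀ᶠ z' in 𝓝 z, X.D z' ∈ 𝒢.box (X.D z) (X.radius z) ∧ expMap X.D z (X.D z') = z' :=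
  (X.D_local.continuous.continuousAt.eventually ((𝒢.isOpen_box _ _).mem_nhds
    (𝒢.mem_box_self _ (X.radius_pos hd hinc z)))).and
    ((eventually_expMap_apply_eq X.D_local z).curry_nhds.self_of_nhds.mono fun _ h => h.2)

theorem eventually_lt_radius {z : N} {R : ℝ} (hR : R < X.radius z) :
    ∀ᶠ z' in 𝓝 z, R < X.radius z' := by
  obtain ⟨R', hR', hlt⟩ := exists_between (max_lt hR (X.radius_pos hd hinc z))
  have hR0 : 0 < R' := (le_max_right _ _).trans_lt hR'
  have hclose : ∀ᶠ z' in 𝓝 z, ∀ q, 𝒢.d q ≠ 0 →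
      𝒢.seminorm q (X.D z' - X.D z) < X.radius z ^ 𝒢.d q - R' ^ 𝒢.d q := by
    refine eventually_all.2 fun q => eventually_imp_distrib_left.2 fun hq => ?_
    refine (((𝒢.continuous_seminorm q).comp
      (X.D_local.continuous.sub continuous_const)).tendsto z).eventually_lt_const ?_
    simpa using Real.rpow_lt_rpow hR0.le hlt ((hd q).lt_of_ne' hq)
  filter_upwards [X.eventually_mem_box_and_expMap_eq hd hinc z, hclose] with z' hz' hclose'
  have hsub : 𝒢.box (X.D z') R' ⊆ 𝒢.box (X.D z) (X.radius z) := fun v hv q hq => by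
    rw [← sub_add_sub_cancel v (X.D z') (X.D z)]
    refine (map_add_le_add _ _ _).trans_lt ?_
    linarith [hv q hq, hclose' q hq]
  have hle := X.le_radius_expMap hd hinc hz'.1 hR0 hsub
  rw [hz'.2] at hle
  exact ((le_max_left _ _).trans_lt hR').trans_le hle

theorem eventually_radius_lt {z : N} {R : ℝ} (hR : X.radius z < R) :
    ∀ᶠ z' in 𝓝 z, X.radius z' < R := by
  obtain ⟨R', hR', hlt⟩ := exists_between hR
  have hr := X.radius_pos hd hinc z
  obtain ⟨w, hw⟩ := X.exists_nearest hd hinc z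
  have hclose : ∀ᶠ z' in 𝓝 z, ∀ q, 𝒢.d q ≠ 0 → 𝒢.seminorm q (w - X.D z') < R' ^ 𝒢.d q := by
    refine eventually_all.2 fun q => eventually_imp_distrib_left.2 fun hq => ?_
    exact (((𝒢.continuous_seminorm q).comp
      (continuous_const.sub X.D_local.continuous)).tendsto z).eventually_lt_const
      ((hw.seminorm_sub_le q).trans_lt (Real.rpow_lt_rpow hr.le hR' ((hd q).lt_of_ne' hq)))
  filter_upwards [X.eventually_mem_box_and_expMap_eq hd hinc z, hclose] with z' hz' hclose'
  have hnv := X.not_visible_expMap hd hinc hw.not_visible (fun q _ => hw.seminorm_sub_le q) hz'.1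
  rw [hz'.2] at hnv
  exact (X.radius_le_of_not_visible hd hinc hnv (hr.trans hR').le
    fun q hq => (hclose' q hq).le).trans_lt hlt

theorem continuous_radius : Continuous X.radius :=
  continuous_iff_continuousAt.2 fun _ => tendsto_order.2
    ⟨fun _ => X.eventually_lt_radius hd hinc, fun _ => X.eventually_radius_lt hd hinc⟩

theorem continuous_rpow_radius (q : Fin n) : Continuous fun z => X.radius z ^ 𝒢.d q :=
  (Real.continuous_rpow_const (hd q)).comp (X.continuous_radius hd hinc)

variable {X}

namespace Nearest

variable {z : N} {w : RSpace n}

theorem deck (h : X.Nearest z w) (g : deckGroup X.p) :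
    X.Nearest ((g : N ≃ₜ N) z) (X.hol g w) where
  not_visible := by
    rw [X.visible_deck_iff]
    exact h.not_visible
  a_zero_sub_eq_zero := by
    rw [X.equivariant g, X.hol_sub, ← 𝒢.linear_a hd _ le_rfl, h.a_zero_sub_eq_zero, map_zero]
  seminorm_sub_le q := by
    rw [X.equivariant g, X.seminorm_hol_sub, X.rpow_radius_deck hd hinc]
    exact mul_le_mul_of_nonneg_left (h.seminorm_sub_le q)
      (Real.rpow_nonneg (𝒢.scale_pos _).le _)

theorem of_tendsto {ι : Type*} {l : Filter ι} [l.NeBot] {u : ι → N} {v : ι → RSpace n}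
    (h : ∀ i, X.Nearest (u i) (v i)) (hz : Tendsto u l (𝓝 z)) (hw : Tendsto v l (𝓝 w)) :
    X.Nearest z w := by
  have hsub : Tendsto (fun i => v i - X.D (u i)) l (𝓝 (w - X.D z)) :=
    hw.sub ((X.D_local.continuous.tendsto _).comp hz)
  refine ⟨fun hvis => ?_, ?_, fun q => ?_⟩
  · obtain ⟨i, hi⟩ := ((hz.prodMk_nhds hw).eventually
      (hvis.eventually_and_continuousAt_expMap X.D_local).1).exists
    exact (h i).not_visible hi
  · refine tendsto_nhds_unique
      (((𝒢.a 0).continuous_of_finiteDimensional.tendsto _).comp hsub) ?_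
    exact tendsto_const_nhds.congr fun i => (h i).a_zero_sub_eq_zero.symm
  · exact le_of_tendsto_of_tendsto' (((𝒢.continuous_seminorm q).tendsto _).comp hsub)
      (((X.continuous_rpow_radius hd hinc q).tendsto _).comp hz) fun i => (h i).seminorm_sub_le q

variable {s t : ℝ}

theorem add_a_sub_mem_box (h : X.Nearest z w) (hs : s ∈ Ioc (0 : ℝ) 1) :
    w + 𝒢.a s (X.D z - w) ∈ 𝒢.box (X.D z) (X.radius z) :=
  𝒢.box_add_a_sub_subset_box hd hs (X.radius_pos hd hinc z).le (fun q _ => h.seminorm_sub_le q)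
    (𝒢.mem_box_self _ (mul_pos hs.1 (X.radius_pos hd hinc z)))

theorem apply_shrink (h : X.Nearest z w) (hs : s ∈ Ioc (0 : ℝ) 1) :
    X.D (X.shrink z w s) = w + 𝒢.a s (X.D z - w) :=
  (X.boxVisible_radius hd hinc z _ (h.add_a_sub_mem_box hd hinc hs)).apply_expMap

theorem box_shrink_subset_box (h : X.Nearest z w) (hs : s ∈ Ioc (0 : ℝ) 1) :
    𝒢.box (X.D (X.shrink z w s)) (s * X.radius z) ⊆ 𝒢.box (X.D z) (X.radius z) := by
  rw [h.apply_shrink hd hinc hs]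
  exact 𝒢.box_add_a_sub_subset_box hd hs (X.radius_pos hd hinc z).le
    fun q _ => h.seminorm_sub_le q

theorem sub_apply_shrink (h : X.Nearest z w) (hs : s ∈ Ioc (0 : ℝ) 1) :
    w - X.D (X.shrink z w s) = 𝒢.a s (w - X.D z) := by
  rw [h.apply_shrink hd hinc hs, ← neg_sub w (X.D z), map_neg]
  abel

theorem not_visible_shrink (h : X.Nearest z w) (hs : s ∈ Ioc (0 : ℝ) 1) :
    ¬ Visible X.D (X.shrink z w s) w :=
  X.not_visible_expMap hd hinc h.not_visible (fun q _ => h.seminorm_sub_le q)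
    (h.add_a_sub_mem_box hd hinc hs)

theorem seminorm_sub_apply_shrink_le (h : X.Nearest z w) (hs : s ∈ Ioc (0 : ℝ) 1) (q : Fin n) :
    𝒢.seminorm q (w - X.D (X.shrink z w s)) ≤ (s * X.radius z) ^ 𝒢.d q := by
  rw [h.sub_apply_shrink hd hinc hs, 𝒢.seminorm_a hs.1,
    Real.mul_rpow hs.1.le (X.radius_pos hd hinc z).le]
  exact mul_le_mul_of_nonneg_left (h.seminorm_sub_le q) (Real.rpow_nonneg hs.1.le _)

theorem radius_shrink (h : X.Nearest z w) (hs : s ∈ Ioc (0 : ℝ) 1) :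
    X.radius (X.shrink z w s) = s * X.radius z := by
  have hsr : 0 < s * X.radius z := mul_pos hs.1 (X.radius_pos hd hinc z)
  refine le_antisymm (X.radius_le_of_not_visible hd hinc (h.not_visible_shrink hd hinc hs) hsr.le
    fun q _ => h.seminorm_sub_apply_shrink_le hd hinc hs q)
    (X.le_radius_expMap hd hinc (h.add_a_sub_mem_box hd hinc hs) hsr ?_)
  rw [← h.apply_shrink hd hinc hs]
  exact h.box_shrink_subset_box hd hinc hs

theorem rpow_radius_shrink (h : X.Nearest z w) (hs : s ∈ Ioc (0 : ℝ) 1) (q : Fin n) :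
    X.radius (X.shrink z w s) ^ 𝒢.d q = s ^ 𝒢.d q * X.radius z ^ 𝒢.d q := by
  rw [h.radius_shrink hd hinc hs, Real.mul_rpow hs.1.le (X.radius_pos hd hinc z).le]

theorem shrink (h : X.Nearest z w) (hs : s ∈ Ioc (0 : ℝ) 1) :
    X.Nearest (X.shrink z w s) w where
  not_visible := h.not_visible_shrink hd hinc hs
  a_zero_sub_eq_zero := by
    rw [h.sub_apply_shrink hd hinc hs, 𝒢.a_zero_a hs.1.le, h.a_zero_sub_eq_zero]
  seminorm_sub_le q := by
    rw [h.radius_shrink hd hinc hs]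
    exact h.seminorm_sub_apply_shrink_le hd hinc hs q

theorem shrink_shrink (h : X.Nearest z w) (hs : s ∈ Ioc (0 : ℝ) 1) (ht : t ∈ Ioc (0 : ℝ) 1) :
    X.shrink (X.shrink z w s) w t = X.shrink z w (t * s) := by
  have hts : t * s ∈ Ioc (0 : ℝ) 1 := ⟨mul_pos ht.1 hs.1, mul_le_one₀ ht.2 hs.1.le hs.2⟩
  have htip : w + 𝒢.a t (X.D (X.shrink z w s) - w) = w + 𝒢.a (t * s) (X.D z - w) := by
    rw [h.apply_shrink hd hinc hs, add_sub_cancel_left, 𝒢.a_mul ht.1.le hs.1.le]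
  rw [RayStructure.shrink, htip]
  exact (visible_expMap_of_convex X.D_local (𝒢.convex_box _ _) (X.boxVisible_radius hd hinc z)
    (h.add_a_sub_mem_box hd hinc hs) (h.add_a_sub_mem_box hd hinc hts)).2

theorem shrink_deck (h : X.Nearest z w) (hs : s ∈ Ioc (0 : ℝ) 1) (g : deckGroup X.p) :
    X.shrink ((g : N ≃ₜ N) z) (X.hol g w) s = (g : N ≃ₜ N) (X.shrink z w s) := by
  rw [RayStructure.shrink, RayStructure.shrink, ← X.expMap_deck g
    (X.boxVisible_radius hd hinc z _ (h.add_a_sub_mem_box hd hinc hs)), X.equivariant g, X.hol_sub,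
    ← 𝒢.linear_a hd _ hs.1.le, X.hol_add]

end Nearest

namespace Near

variable {ε ε' : ℝ} {z z' z'' : N} {w w' w'' : RSpace n}

theorem mono (h : X.Near ε z w z' w') (hε : ε ≤ ε') : X.Near ε' z w z' w' where
  expMap_eq := h.expMap_eq
  base q := (h.base q).trans_le (by gcongr; exact (X.rpow_radius_pos hd hinc z q).le)
  tip q := (h.tip q).trans_le (by gcongr; exact (X.rpow_radius_pos hd hinc z q).le)
  upper q := (h.upper q).trans (by gcongr; exact (X.rpow_radius_pos hd hinc z q).le)
  lower q := (h.lower q).trans (by gcongr; exact (X.rpow_radius_pos hd hinc z' q).le)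

theorem mem_box (h : X.Near ε z w z' w') (hε : ε ≤ 1) :
    X.D z' ∈ 𝒢.box (X.D z) (X.radius z) := fun q _ =>
  (h.base q).trans_le (mul_le_of_le_one_left (X.rpow_radius_pos hd hinc z q).le hε)

theorem mul_rpow_radius_le_left (h : X.Near ε z w z' w') (hε : ε ∈ Icc (0 : ℝ) 1) (q : Fin n) :
    ε * X.radius z ^ 𝒢.d q ≤ 2 * ε * X.radius z' ^ 𝒢.d q := by
  have hr' := (X.rpow_radius_pos hd hinc z' q).le
  calc ε * X.radius z ^ 𝒢.d q
      ≤ ε * ((1 + 1) * X.radius z' ^ 𝒢.d q) :=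
        mul_le_mul_of_nonneg_left ((h.lower q).trans (by gcongr; exact hε.2)) hε.1
    _ = 2 * ε * X.radius z' ^ 𝒢.d q := by ring

theorem mul_rpow_radius_le_right (h : X.Near ε z w z' w') (hε : ε ∈ Icc (0 : ℝ) 1) (q : Fin n) :
    ε * X.radius z' ^ 𝒢.d q ≤ 2 * ε * X.radius z ^ 𝒢.d q := by
  have hr := (X.rpow_radius_pos hd hinc z q).le
  calc ε * X.radius z' ^ 𝒢.d q
      ≤ ε * ((1 + 1) * X.radius z ^ 𝒢.d q) :=
        mul_le_mul_of_nonneg_left ((h.upper q).trans (by gcongr; exact hε.2)) hε.1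
    _ = 2 * ε * X.radius z ^ 𝒢.d q := by ring

theorem symm (h : X.Near ε z w z' w') (hε : ε ∈ Icc (0 : ℝ) 1) :
    X.Near (2 * ε) z' w' z w where
  expMap_eq := by
    have := (visible_expMap_of_convex X.D_local (𝒢.convex_box _ _) (X.boxVisible_radius hd hinc z)
      (h.mem_box hd hinc hε.2) (𝒢.mem_box_self _ (X.radius_pos hd hinc z))).2
    rwa [h.expMap_eq, expMap_self X.D_local] at this
  base q := by
    rw [map_sub_rev]
    exact (h.base q).trans_le (h.mul_rpow_radius_le_left hd hinc hε q)
  tip q := by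
    rw [map_sub_rev]
    exact (h.tip q).trans_le (h.mul_rpow_radius_le_left hd hinc hε q)
  upper q := (h.mono hd hinc (le_mul_of_one_le_left hε.1 one_le_two)).lower q
  lower q := (h.mono hd hinc (le_mul_of_one_le_left hε.1 one_le_two)).upper q

theorem trans (h : X.Near ε z w z' w') (h' : X.Near ε z' w' z'' w'') (hε0 : 0 ≤ ε)
    (hε : 3 * ε ≤ 1) : X.Near (3 * ε) z w z'' w'' := by
  have hε1 : ε ∈ Icc (0 : ℝ) 1 := ⟨hε0, by linarith⟩
  have hsq : (1 + ε) * (1 + ε) ≤ 1 + 3 * ε := by nlinarith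
  have hbase : ∀ q, 𝒢.seminorm q (X.D z'' - X.D z) < 3 * ε * X.radius z ^ 𝒢.d q := fun q => by
    rw [← sub_add_sub_cancel (X.D z'') (X.D z') (X.D z)]
    refine (map_add_le_add _ _ _).trans_lt ?_
    linarith [h.base q, h'.base q, h.mul_rpow_radius_le_right hd hinc hε1 q]
  refine ⟨?_, hbase, fun q => ?_, fun q => ?_, fun q => ?_⟩
  · have := (visible_expMap_of_convex X.D_local (𝒢.convex_box _ _) (X.boxVisible_radius hd hinc z)
      (h.mem_box hd hinc hε1.2) fun q _ => (hbase q).trans_le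
        (mul_le_of_le_one_left (X.rpow_radius_pos hd hinc z q).le hε)).2
    rw [h.expMap_eq, h'.expMap_eq] at this
    exact this.symm
  · rw [← sub_add_sub_cancel w'' w' w]
    refine (map_add_le_add _ _ _).trans_lt ?_
    linarith [h.tip q, h'.tip q, h.mul_rpow_radius_le_right hd hinc hε1 q]
  · calc X.radius z'' ^ 𝒢.d q
        ≤ (1 + ε) * ((1 + ε) * X.radius z ^ 𝒢.d q) :=
          (h'.upper q).trans (mul_le_mul_of_nonneg_left (h.upper q) (by linarith))
      _ ≤ (1 + 3 * ε) * X.radius z ^ 𝒢.d q := by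
          rw [← mul_assoc]
          exact mul_le_mul_of_nonneg_right hsq (X.rpow_radius_pos hd hinc z q).le
  · calc X.radius z ^ 𝒢.d q
        ≤ (1 + ε) * ((1 + ε) * X.radius z'' ^ 𝒢.d q) :=
          (h.lower q).trans (mul_le_mul_of_nonneg_left (h'.lower q) (by linarith))
      _ ≤ (1 + 3 * ε) * X.radius z'' ^ 𝒢.d q := by
          rw [← mul_assoc]
          exact mul_le_mul_of_nonneg_right hsq (X.rpow_radius_pos hd hinc z'' q).le

theorem deck (h : X.Near ε z w z' w') (hε : ε ≤ 1) (g : deckGroup X.p) :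
    X.Near ε ((g : N ≃ₜ N) z) (X.hol g w) ((g : N ≃ₜ N) z') (X.hol g w') := by
  have hs : ∀ q, 0 < X.scale g ^ 𝒢.d q := fun q => Real.rpow_pos_of_pos (𝒢.scale_pos _) _
  refine ⟨?_, fun q => ?_, fun q => ?_, fun q => ?_, fun q => ?_⟩
  · rw [X.equivariant g z', X.expMap_deck g (X.boxVisible_radius hd hinc z _
      (h.mem_box hd hinc hε)), h.expMap_eq]
  · rw [X.equivariant g, X.equivariant g, X.seminorm_hol_sub, X.rpow_radius_deck hd hinc,
      mul_left_comm]
    exact mul_lt_mul_of_pos_left (h.base q) (hs q)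
  · rw [X.seminorm_hol_sub, X.rpow_radius_deck hd hinc, mul_left_comm]
    exact mul_lt_mul_of_pos_left (h.tip q) (hs q)
  · rw [X.rpow_radius_deck hd hinc, X.rpow_radius_deck hd hinc, mul_left_comm]
    exact mul_le_mul_of_nonneg_left (h.upper q) (hs q).le
  · rw [X.rpow_radius_deck hd hinc, X.rpow_radius_deck hd hinc, mul_left_comm]
    exact mul_le_mul_of_nonneg_left (h.lower q) (hs q).le

section Shrink

variable {s : ℝ}

theorem base_of_shrink (hs : s ∈ Ioc (0 : ℝ) 1) (hn : X.Nearest z w) (hn' : X.Nearest z' w')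
    (h : X.Near ε (X.shrink z w s) w (X.shrink z' w' s) w') (q : Fin n) :
    𝒢.seminorm q (X.D z' - X.D z) < 2 * ε * X.radius z ^ 𝒢.d q := by
  have hle := 𝒢.rpow_mul_seminorm_sub_le hd (c := X.D z) (c' := X.D z') (w := w) (w' := w') hs q
  have hbase := h.base q
  have htip := h.tip q
  rw [hn.apply_shrink hd hinc hs, hn'.apply_shrink hd hinc hs,
    hn.rpow_radius_shrink hd hinc hs] at hbase
  rw [hn.rpow_radius_shrink hd hinc hs] at htip
  refine lt_of_mul_lt_mul_left ?_ (Real.rpow_nonneg hs.1.le (𝒢.d q))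
  linarith

theorem expMap_eq_of_shrink (hs : s ∈ Ioc (0 : ℝ) 1) (hn : X.Nearest z w) (hn' : X.Nearest z' w')
    (h : X.Near ε (X.shrink z w s) w (X.shrink z' w' s) w') (hε : ε ≤ 1)
    (hz' : X.D z' ∈ 𝒢.box (X.D z) (X.radius z)) : expMap X.D z (X.D z') = z' := by
  have hvis := X.boxVisible_radius hd hinc
  have hmem : X.D (X.shrink z' w' s) ∈ 𝒢.box (X.D z) (X.radius z) := by
    refine hn.box_shrink_subset_box hd hinc hs ?_
    have := h.mem_box hd hinc hε
    rwa [hn.radius_shrink hd hinc hs] at this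
  have hmem' : X.D (X.shrink z' w' s) ∈ 𝒢.box (X.D z') (X.radius z') := by
    rw [hn'.apply_shrink hd hinc hs]
    exact hn'.add_a_sub_mem_box hd hinc hs
  have heq : expMap X.D z (X.D (X.shrink z' w' s)) = expMap X.D z' (X.D (X.shrink z' w' s)) := by
    rw [← (visible_expMap_of_convex X.D_local (𝒢.convex_box _ _) (hvis z)
      (hn.add_a_sub_mem_box hd hinc hs) hmem).2]
    refine h.expMap_eq.trans ?_
    rw [hn'.apply_shrink hd hinc hs]
    rfl
  rw [expMap_eqOn_inter X.D_local (𝒢.convex_box _ _) (hvis z) (𝒢.convex_box _ _) (hvis z')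
    hmem hmem' heq ⟨hz', 𝒢.mem_box_self _ (X.radius_pos hd hinc z')⟩, expMap_self X.D_local]

theorem of_shrink (hs : s ∈ Ioc (0 : ℝ) 1) (hn : X.Nearest z w) (hn' : X.Nearest z' w')
    (h : X.Near ε (X.shrink z w s) w (X.shrink z' w' s) w') (hε0 : 0 ≤ ε) (hε : 2 * ε ≤ 1) :
    X.Near (2 * ε) z w z' w' := by
  have hr := X.rpow_radius_pos hd hinc z
  have hs0 : ∀ q, 0 < s ^ 𝒢.d q := fun q => Real.rpow_pos_of_pos hs.1 _
  have hbase := base_of_shrink hd hinc hs hn hn' h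
  refine ⟨expMap_eq_of_shrink hd hinc hs hn hn' h (by linarith) fun q _ =>
    (hbase q).trans_le (mul_le_of_le_one_left (hr q).le hε), hbase, fun q => ?_, fun q => ?_,
    fun q => ?_⟩
  · have htip := h.tip q
    rw [hn.rpow_radius_shrink hd hinc hs] at htip
    refine htip.trans_le (mul_le_mul (by linarith)
      (mul_le_of_le_one_left (hr q).le (Real.rpow_le_one hs.1.le hs.2 (hd q)))
      (mul_pos (hs0 q) (hr q)).le (by linarith))
  · have hle := (h.mono hd hinc (by linarith : ε ≤ 2 * ε)).upper q
    rw [hn.rpow_radius_shrink hd hinc hs, hn'.rpow_radius_shrink hd hinc hs, mul_left_comm] at hle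
    exact le_of_mul_le_mul_left hle (hs0 q)
  · have hle := (h.mono hd hinc (by linarith : ε ≤ 2 * ε)).lower q
    rw [hn.rpow_radius_shrink hd hinc hs, hn'.rpow_radius_shrink hd hinc hs, mul_left_comm] at hle
    exact le_of_mul_le_mul_left hle (hs0 q)

end Shrink

end Near

variable (X)

theorem eventually_near {ε : ℝ} (hε : 0 < ε) (z : N) (w : RSpace n) :
    ∀ᶠ u : (N × RSpace n) × (N × RSpace n) in 𝓝 ((z, w), (z, w)),
      X.Near ε u.1.1 u.1.2 u.2.1 u.2.2 := by
  have hDc := X.D_local.continuous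
  have hr := X.rpow_radius_pos hd hinc z
  have hrc := X.continuous_rpow_radius hd hinc
  have hr₁ : ∀ q, Continuous fun u : (N × RSpace n) × (N × RSpace n) => X.radius u.1.1 ^ 𝒢.d q :=
    fun q => (hrc q).comp continuous_fst.fst
  have hr₂ : ∀ q, Continuous fun u : (N × RSpace n) × (N × RSpace n) => X.radius u.2.1 ^ 𝒢.d q :=
    fun q => (hrc q).comp continuous_snd.fst
  have hev : ∀ {f h : Fin n → (N × RSpace n) × (N × RSpace n) → ℝ}, (∀ q, Continuous (f q)) →
      (∀ q, Continuous (h q)) → (∀ q, f q ((z, w), (z, w)) < h q ((z, w), (z, w))) →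
      ∀ᶠ u in 𝓝 ((z, w), (z, w)), ∀ q, f q u < h q u := fun hf hh hlt =>
    eventually_all.2 fun q => (hf q).continuousAt.eventually_lt (hh q).continuousAt (hlt q)
  have hexp : ∀ᶠ u : (N × RSpace n) × (N × RSpace n) in 𝓝 ((z, w), (z, w)),
      expMap X.D u.1.1 (X.D u.2.1) = u.2.1 :=
    ((continuous_fst.fst.prodMk continuous_snd.fst).tendsto
      ((z, w), (z, w))).eventually (eventually_expMap_apply_eq X.D_local z) |>.mono fun _ h => h.2
  filter_upwards [hexp,
    hev (fun q => (𝒢.continuous_seminorm q).comp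
      ((hDc.comp continuous_snd.fst).sub (hDc.comp continuous_fst.fst)))
      (fun q => (hr₁ q).const_mul ε) fun q => by simpa using mul_pos hε (hr q),
    hev (fun q => (𝒢.continuous_seminorm q).comp (continuous_snd.snd.sub continuous_fst.snd))
      (fun q => (hr₁ q).const_mul ε) fun q => by simpa using mul_pos hε (hr q),
    hev hr₂ (fun q => (hr₁ q).const_mul (1 + ε)) fun q =>
      lt_mul_of_one_lt_left (hr q) (lt_add_of_pos_right 1 hε),
    hev hr₁ (fun q => (hr₂ q).const_mul (1 + ε)) fun q =>
      lt_mul_of_one_lt_left (hr q) (lt_add_of_pos_right 1 hε)] with u hexp hbase htip hup hlow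
  exact ⟨hexp, hbase, htip, fun q => (hup q).le, fun q => (hlow q).le⟩

theorem exists_forall_rpow_radius_le {Q : Set N} (hQ : IsCompact Q) :
    ∃ B > 0, ∀ z ∈ Q, ∀ q, X.radius z ^ 𝒢.d q ≤ B := by
  obtain ⟨B, hB⟩ := hQ.exists_bound_of_continuousOn (f := fun z => ∑ q, X.radius z ^ 𝒢.d q)
    (continuous_finsetSum _ fun q _ => X.continuous_rpow_radius hd hinc q).continuousOn
  refine ⟨max B 1, lt_max_of_lt_right one_pos, fun z hz q => ?_⟩
  calc X.radius z ^ 𝒢.d q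
      ≤ ∑ q, X.radius z ^ 𝒢.d q := Finset.single_le_sum
        (fun q _ => (X.rpow_radius_pos hd hinc z q).le) (Finset.mem_univ q)
    _ ≤ max B 1 := ((le_abs_self _).trans (hB z hz)).trans (le_max_left _ _)

theorem exists_forall_near_imp_eq : ∃ ε > 0, ε ≤ 1 ∧ ∀ (z z' : N) (w w' : RSpace n),
    X.Near ε z w z' w' → X.p z' = X.p z → z' = z := by
  obtain ⟨Q, hQ, hcov⟩ := X.exists_isCompact_forall_exists_deck_mem
  obtain ⟨δ, hδ, hinj⟩ := X.exists_forall_seminorm_lt_imp_eq hQ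
  obtain ⟨B, hB, hle⟩ := X.exists_forall_rpow_radius_le hd hinc hQ
  refine ⟨min 1 (δ / B), lt_min one_pos (div_pos hδ hB), min_le_left _ _,
    fun z z' w w' h hp => ?_⟩
  obtain ⟨g, hg⟩ := hcov z
  have hnear := h.deck hd hinc (min_le_left _ _) g
  refine (g : N ≃ₜ N).injective (hinj _ hg _ (fun q => (hnear.base q).trans_le ?_)
    hnear.expMap_eq ?_)
  · calc min 1 (δ / B) * X.radius ((g : N ≃ₜ N) z) ^ 𝒢.d q
        ≤ δ / B * B := mul_le_mul (min_le_right _ _) (hle _ hg q)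
          (X.rpow_radius_pos hd hinc _ q).le (div_pos hδ hB).le
      _ = δ := div_mul_cancel₀ _ hB.ne'
  · rw [X.p_deck, X.p_deck, hp]

end RayStructure

theorem exists_rel_of_isCompact {α : Type*} [TopologicalSpace α] {K : Set α} (hK : IsCompact K)
    {f : ℕ → α} (hf : ∀ k, f k ∈ K) {r : α → α → Prop}
    (hr : ∀ x ∈ K, ∀ᶠ u in 𝓝 (x, x), r u.1 u.2) (m : ℕ) : ∃ i k, r (f i) (f (i + (m + k))) := by
  obtain ⟨x, hx, hcl⟩ := hK.exists_mapClusterPt (u := f) (f := atTop)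
    (le_principal_iff.2 (mem_map.2 (Eventually.of_forall hf)))
  have hx' := hr x hx
  rw [nhds_prod_eq, eventually_prod_self_iff] at hx'
  obtain ⟨U, hU, hrU⟩ := hx'
  have hfreq := mapClusterPt_iff_frequently.1 hcl U hU
  obtain ⟨i, -, hi⟩ := frequently_atTop.1 hfreq 0
  obtain ⟨j, hij, hj⟩ := frequently_atTop.1 hfreq (i + m)
  obtain ⟨k, rfl⟩ := Nat.exists_eq_add_of_le hij
  rw [add_assoc] at hj
  exact ⟨i, k, hrU _ hi _ hj⟩

namespace RayStructure

variable {n : ℕ} {𝒢 : RankOneRayGeometry n} {M N : Type*} [TopologicalSpace M] [TopologicalSpace N]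
  (X : RayStructure 𝒢 M N)

theorem hol_mul (g h : deckGroup X.p) (v : RSpace n) :
    X.hol (g * h) v = X.hol g (X.hol h v) := by
  simp only [hol, map_mul]
  rfl

theorem hol_inv_hol (g : deckGroup X.p) (v : RSpace n) : X.hol g⁻¹ (X.hol g v) = v := by
  rw [← hol_mul, inv_mul_cancel]
  simp only [hol, map_one]
  rfl

theorem deck_inv_deck (g : deckGroup X.p) (x : N) :
    ((g⁻¹ : deckGroup X.p) : N ≃ₜ N) ((g : N ≃ₜ N) x) = x :=
  (g : N ≃ₜ N).symm_apply_apply x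

section Basic

variable {X} {z : N} {w w' : RSpace n}

theorem Nearest.a_zero_sub_eq_zero_of_nearest (h : X.Nearest z w) (h' : X.Nearest z w') :
    𝒢.a 0 (w' - w) = 0 := by
  rw [← sub_sub_sub_cancel_right w' w (X.D z), map_sub, h'.a_zero_sub_eq_zero,
    h.a_zero_sub_eq_zero, sub_zero]

variable {ι : Type*} {l : Filter ι} {u : ι → N} {v : ι → RSpace n} {δ : ι → ℝ}

theorem Near.tendsto_base_and_tip (hδ : Tendsto δ l (𝓝 0))
    (h : ∀ i, X.Near (δ i) z w (u i) (v i)) :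
    Tendsto (fun i => X.D (u i)) l (𝓝 (X.D z)) ∧ Tendsto v l (𝓝 w) := by
  have hlim : ∀ q, Tendsto (fun i => δ i * X.radius z ^ 𝒢.d q) l (𝓝 0) := fun q => by
    simpa only [zero_mul] using hδ.mul_const (X.radius z ^ 𝒢.d q)
  exact ⟨𝒢.tendsto_of_forall_tendsto_seminorm fun q =>
      squeeze_zero (fun i => apply_nonneg _ _) (fun i => ((h i).base q).le) (hlim q),
    𝒢.tendsto_of_forall_tendsto_seminorm fun q =>
      squeeze_zero (fun i => apply_nonneg _ _) (fun i => ((h i).tip q).le) (hlim q)⟩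

theorem Near.tendsto [T2Space N] (hδ : Tendsto δ l (𝓝 0))
    (h : ∀ i, X.Near (δ i) z w (u i) (v i)) : Tendsto u l (𝓝 z) := by
  have := (visible_self X.D z).tendsto_of_expMap_eq X.D_local (fun i => (h i).expMap_eq)
    (Near.tendsto_base_and_tip hδ h).1
  rwa [expMap_self X.D_local] at this

end Basic

variable [T2Space N] [SimplyConnectedSpace N] [CompactSpace M] (hd : ∀ q, 0 ≤ 𝒢.d q)
  (hinc : ∀ z, ∃ v, ¬ Visible X.D z v) {ε s t : ℝ} {z z' : N} {w w' : RSpace n}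

include hd hinc

theorem isCompact_nearest {Q : Set N} (hQ : IsCompact Q) :
    ∃ T : Set (N × RSpace n), IsCompact T ∧ ∀ z ∈ Q, ∀ w, X.Nearest z w → (z, w) ∈ T := by
  obtain ⟨B, -, hB⟩ := X.exists_forall_rpow_radius_le hd hinc hQ
  have hDc := X.D_local.continuous
  refine ⟨(fun x : N × RSpace n => (x.1, X.D x.1 + x.2)) ''
    (Q ×ˢ {v | ∀ q, 𝒢.seminorm q (v - 0) ≤ B}),
    (hQ.prod (𝒢.isCompact_setOf_forall_seminorm_le 0 fun _ => B)).image (by fun_prop),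
    fun z hz w hw => ⟨(z, w - X.D z), ⟨hz, fun q => ?_⟩, by simp⟩⟩
  rw [sub_zero]
  exact (hw.seminorm_sub_le q).trans (hB z hz q)

variable {X}

theorem Nearest.near_of_near_shrink (hn : X.Nearest z w) (hs : s ∈ Ioc (0 : ℝ) 1)
    (ht : t ∈ Ioc (0 : ℝ) 1) {g g' : deckGroup X.p} (hε0 : 0 ≤ ε) (hε : 2 * ε ≤ 1)
    (h : X.Near ε ((g : N ≃ₜ N) (X.shrink z w t)) (X.hol g w)
      ((g' : N ≃ₜ N) (X.shrink z w (t * s))) (X.hol g' w)) :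
    X.Near (2 * ε) z w (((g⁻¹ * g' : deckGroup X.p) : N ≃ₜ N) (X.shrink z w s))
      (X.hol (g⁻¹ * g') w) := by
  have hns := hn.shrink hd hinc hs
  rw [← hn.shrink_shrink hd hinc hs ht, ← hn.shrink_deck hd hinc ht,
    ← hns.shrink_deck hd hinc ht] at h
  have hnear := (Near.of_shrink hd hinc ht (hn.deck hd hinc g) (hns.deck hd hinc g') h
    hε0 hε).deck hd hinc hε g⁻¹
  rw [X.hol_inv_hol, X.deck_inv_deck] at hnear
  rw [X.hol_mul]
  exact hnear

/-- The iterates of `shrink` meet a compact fundamental set, up to deck transformations, so that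
two of them are close; shrinking is then undone by `Near.of_shrink`. -/
theorem Nearest.exists_recurrence (hn : X.Nearest z w) (hn' : X.Nearest z' w') (hε0 : 0 < ε)
    (hε : ε ≤ 1) {s₀ : ℝ} (hs₀ : 0 < s₀) : ∃ s ∈ Ioc (0 : ℝ) 1, s ≤ s₀ ∧ ∃ h h' : deckGroup X.p,
      X.Near ε z w ((h : N ≃ₜ N) (X.shrink z w s)) (X.hol h w) ∧
      X.Near ε z' w' ((h' : N ≃ₜ N) (X.shrink z' w' s)) (X.hol h' w') := by
  obtain ⟨Q, hQ, hcov⟩ := X.exists_isCompact_forall_exists_deck_mem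
  obtain ⟨T, hT, hTn⟩ := X.isCompact_nearest hd hinc hQ
  have hpow : ∀ k : ℕ, (2⁻¹ : ℝ) ^ k ∈ Ioc (0 : ℝ) 1 := fun k =>
    ⟨by positivity, pow_le_one₀ (by norm_num) (by norm_num)⟩
  choose g hg using fun k : ℕ => hcov (X.shrink z w (2⁻¹ ^ k))
  choose g' hg' using fun k : ℕ => hcov (X.shrink z' w' (2⁻¹ ^ k))
  have hmem : ∀ k, (((g k : N ≃ₜ N) (X.shrink z w (2⁻¹ ^ k)), X.hol (g k) w),
      ((g' k : N ≃ₜ N) (X.shrink z' w' (2⁻¹ ^ k)), X.hol (g' k) w')) ∈ T ×ˢ T := fun k =>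
    ⟨hTn _ (hg k) _ ((hn.shrink hd hinc (hpow k)).deck hd hinc _),
      hTn _ (hg' k) _ ((hn'.shrink hd hinc (hpow k)).deck hd hinc _)⟩
  obtain ⟨m, hm⟩ := exists_pow_lt_of_lt_one hs₀ (by norm_num : (2⁻¹ : ℝ) < 1)
  obtain ⟨i, k, hnear, hnear'⟩ := exists_rel_of_isCompact (hT.prod hT) hmem
    (r := fun x y => X.Near (ε / 2) x.1.1 x.1.2 y.1.1 y.1.2 ∧
      X.Near (ε / 2) x.2.1 x.2.2 y.2.1 y.2.2)
    (fun x _ => (((continuous_fst.fst.prodMk continuous_snd.fst).tendsto (x, x)).eventually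
        (X.eventually_near hd hinc (half_pos hε0) x.1.1 x.1.2)).and
      (((continuous_fst.snd.prodMk continuous_snd.snd).tendsto (x, x)).eventually
        (X.eventually_near hd hinc (half_pos hε0) x.2.1 x.2.2))) m
  have hε2 : 2 * (ε / 2) = ε := by ring
  simp only [pow_add _ i] at hnear hnear'
  refine ⟨2⁻¹ ^ (m + k), hpow _, ?_, (g i)⁻¹ * g (i + (m + k)), (g' i)⁻¹ * g' (i + (m + k)),
    ?_, ?_⟩
  · rw [pow_add]
    exact (mul_le_of_le_one_right (hpow m).1.le (hpow k).2).trans hm.le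
  · have := hn.near_of_near_shrink hd hinc (hpow _) (hpow i) (half_pos hε0).le (hε2.trans_le hε)
      hnear
    rwa [hε2] at this
  · have := hn'.near_of_near_shrink hd hinc (hpow _) (hpow i) (half_pos hε0).le (hε2.trans_le hε)
      hnear'
    rwa [hε2] at this

theorem Nearest.deck_eq_of_near (hε0 : 0 ≤ ε) (hε : 108 * ε ≤ 1)
    (hrigid : ∀ (z z' : N) (w w' : RSpace n), X.Near (108 * ε) z w z' w' → X.p z' = X.p z → z' = z)
    (hn : X.Nearest z w) (hn' : X.Nearest z' w') (hnear : X.Near ε z w z' w')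
    (hs : s ∈ Ioc (0 : ℝ) 1) {h h' : deckGroup X.p}
    (hh : X.Near ε z w ((h : N ≃ₜ N) (X.shrink z w s)) (X.hol h w))
    (hh' : X.Near ε z' w' ((h' : N ≃ₜ N) (X.shrink z' w' s)) (X.hol h' w')) : h' = h := by
  have hε1 : ε ∈ Icc (0 : ℝ) 1 := ⟨hε0, by linarith⟩
  have hshrink := ((hh.symm hd hinc hε1).trans hd hinc (hnear.mono hd hinc (by linarith))
    (by linarith) (by linarith)).trans hd hinc (hh'.mono hd hinc (by linarith)) (by linarith)
    (by linarith)
  rw [← hn.shrink_deck hd hinc hs, ← hn'.shrink_deck hd hinc hs] at hshrink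
  have hdeck := Near.of_shrink hd hinc hs (hn.deck hd hinc h) (hn'.deck hd hinc h') hshrink
    (by linarith) (by linarith)
  have hback := ((hnear.symm hd hinc hε1).deck hd hinc (by linarith) h').mono hd hinc
    (ε' := 2 * (3 * (3 * (2 * ε)))) (by linarith)
  have hloop := (hdeck.trans hd hinc hback (by linarith) (by linarith)).mono hd hinc
    (ε' := 108 * ε) (by linarith)
  exact X.deck_eq_of_apply_eq (hrigid _ _ _ _ hloop (by rw [X.p_deck, X.p_deck]))

theorem Nearest.two_le_rpow_scale (hε : ε ≤ 1) (hn : X.Nearest z w) (hs : s ∈ Ioc (0 : ℝ) 1)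
    {h : deckGroup X.p} (hh : X.Near ε z w ((h : N ≃ₜ N) (X.shrink z w s)) (X.hol h w)) {q : Fin n}
    (hsq : s ^ 𝒢.d q ≤ 1 / 4) : 2 ≤ X.scale h ^ 𝒢.d q := by
  have hr := X.rpow_radius_pos hd hinc z q
  have hscale : 0 ≤ X.scale h ^ 𝒢.d q := Real.rpow_nonneg (𝒢.scale_pos _).le _
  have hlow := (hh.mono hd hinc hε).lower q
  rw [X.rpow_radius_deck hd hinc, hn.rpow_radius_shrink hd hinc hs, ← mul_assoc, ← mul_assoc,
    le_mul_iff_one_le_left hr] at hlow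
  linarith [mul_le_mul_of_nonneg_left hsq hscale]

variable (X)

/-- If `w' - w` is not neutral, a recurrence of both pairs is realised by one deck transformation,
which stretches `w' - w` although it nearly fixes `w` and `w'`. -/
theorem exists_forall_near_imp_sub_mem_neutral : ∃ ε > 0, ∀ (z z' : N) (w w' : RSpace n),
    X.Nearest z w → X.Nearest z' w' → X.Near ε z w z' w' → w' - w ∈ 𝒢.neutral := by
  obtain ⟨ε₁, hε₁, hε₁1, hrigid⟩ := X.exists_forall_near_imp_eq hd hinc
  obtain ⟨ε, hε, rfl⟩ : ∃ ε > 0, 108 * ε = ε₁ := ⟨ε₁ / 108, by positivity, by ring⟩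
  refine ⟨ε, hε, fun z z' w w' hn hn' hnear =>
    𝒢.mem_neutral_of_forall_seminorm_eq_zero fun q hq => ?_⟩
  by_contra hne
  have hpos : 0 < 𝒢.seminorm q (w' - w) := (apply_nonneg _ _).lt_of_ne' hne
  obtain ⟨s₀, hs₀q, hs₀⟩ := ((𝒢.eventually_forall_rpow_lt hd
    (by norm_num : (0 : ℝ) < 1 / 4)).and self_mem_nhdsWithin).exists
  have hrr : 0 < X.radius z ^ 𝒢.d q + X.radius z' ^ 𝒢.d q :=
    add_pos (X.rpow_radius_pos hd hinc z q) (X.rpow_radius_pos hd hinc z' q)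
  obtain ⟨η, hη0, hη⟩ := exists_between (lt_min hε (div_pos hpos hrr))
  have hηε : η ≤ ε := (hη.trans_le (min_le_left _ _)).le
  have hηlt : η * (X.radius z ^ 𝒢.d q + X.radius z' ^ 𝒢.d q) < 𝒢.seminorm q (w' - w) :=
    (lt_div_iff₀ hrr).1 (hη.trans_le (min_le_right _ _))
  obtain ⟨s, hs, hss₀, h, h', hh, hh'⟩ :=
    hn.exists_recurrence hd hinc hn' hη0 (by linarith) hs₀
  obtain rfl : h' = h := Nearest.deck_eq_of_near hd hinc hε.le hε₁1 hrigid hn hn' hnear hs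
    (hh.mono hd hinc hηε) (hh'.mono hd hinc hηε)
  have hstretch : 2 * 𝒢.seminorm q (w' - w) ≤ 𝒢.seminorm q (X.hol h' w' - X.hol h' w) := by
    rw [X.seminorm_hol_sub]
    exact mul_le_mul_of_nonneg_right (Nearest.two_le_rpow_scale hd hinc (by linarith) hn hs hh
      ((Real.rpow_le_rpow hs.1.le hss₀ (hd q)).trans (hs₀q q hq).le)) hpos.le
  have hsub : X.hol h' w' - X.hol h' w =
      (X.hol h' w' - w') - (X.hol h' w - w) + (w' - w) := by abel
  have hle : 𝒢.seminorm q (X.hol h' w' - X.hol h' w) ≤ 𝒢.seminorm q (X.hol h' w' - w') +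
      𝒢.seminorm q (X.hol h' w - w) + 𝒢.seminorm q (w' - w) := by
    rw [hsub]
    exact (map_add_le_add _ _ _).trans (add_le_add_left (map_sub_le_add _ _ _) _)
  linarith [hh.tip q, hh'.tip q]

variable {X}

section Limits

variable {ι : Type*} {l : Filter ι} {u : ι → N} {v : ι → RSpace n}

theorem Nearest.tendsto_shrink (hn : X.Nearest z w) (hs : s ∈ Ioc (0 : ℝ) 1)
    (hu : Tendsto u l (𝓝 z)) (hv : Tendsto v l (𝓝 w)) :
    Tendsto (fun i => X.shrink (u i) (v i) s) l (𝓝 (X.shrink z w s)) :=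
  ((X.boxVisible_radius hd hinc z _ (hn.add_a_sub_mem_box hd hinc
      hs)).eventually_and_continuousAt_expMap X.D_local).2.tendsto.comp
    (hu.prodMk_nhds (hv.add (((𝒢.a s).continuous_of_finiteDimensional.tendsto _).comp
      (((X.D_local.continuous.tendsto _).comp hu).sub hv))))

theorem Nearest.exists_shrink_eq_of_tendsto {x : N} {b : RSpace n} [l.NeBot]
    (hn : ∀ i, X.Nearest (u i) (v i)) (hs : s ∈ Ioc (0 : ℝ) 1)
    (hnear : ∀ i, X.Near (1 / 2) x b (u i) (v i))
    (hz : Tendsto (fun i => X.shrink (u i) (v i) s) l (𝓝 z)) (hv : Tendsto v l (𝓝 w)) :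
    ∃ x', X.Nearest x' w ∧ X.shrink x' w s = z := by
  set c := w + 𝒢.a s⁻¹ (X.D z - w)
  have hD : ∀ i, X.D (u i) = v i + 𝒢.a s⁻¹ (X.D (X.shrink (u i) (v i) s) - v i) := fun i => by
    rw [(hn i).apply_shrink hd hinc hs, add_sub_cancel_left, 𝒢.a_inv_a hs.1, add_sub_cancel]
  have hDlim : Tendsto (fun i => X.D (u i)) l (𝓝 c) := by
    refine Tendsto.congr (fun i => (hD i).symm) ?_
    exact hv.add (((𝒢.a s⁻¹).continuous_of_finiteDimensional.tendsto _).comp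
      (((X.D_local.continuous.tendsto _).comp hz).sub hv))
  have hc : c ∈ 𝒢.box (X.D x) (X.radius x) := fun q _ => by
    have hle := le_of_tendsto' (((𝒢.continuous_seminorm q).tendsto _).comp (hDlim.sub_const _))
      fun i => ((hnear i).base q).le
    linarith [X.rpow_radius_pos hd hinc x q]
  have hu := (X.boxVisible_radius hd hinc x c hc).tendsto_of_expMap_eq X.D_local
    (fun i => (hnear i).expMap_eq) hDlim
  have hn' := Nearest.of_tendsto hd hinc hn hu hv
  exact ⟨_, hn', tendsto_nhds_unique (hn'.tendsto_shrink hd hinc hs hu hv) hz⟩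

end Limits

/-- A recurrence of the iterates of `shrink` at `z` is also one at the preceding points, which
therefore accumulate at a preimage of `z`. -/
theorem Nearest.exists_shrink_eq (hn : X.Nearest z w) (hs : s ∈ Ioc (0 : ℝ) 1) :
    ∃ x, X.Nearest x w ∧ X.shrink x w s = z := by
  obtain ⟨δ, -, hδ, hδlim⟩ := exists_seq_strictAnti_tendsto' (by norm_num : (0 : ℝ) < 1 / 36)
  choose t ht hts h _ hnear _ using fun j : ℕ =>
    hn.exists_recurrence hd hinc hn (hδ j).1 ((hδ j).2.le.trans (by norm_num)) hs.1
  have hq : ∀ j, t j / s ∈ Ioc (0 : ℝ) 1 := fun j =>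
    ⟨div_pos (ht j).1 hs.1, (div_le_one hs.1).2 (hts j)⟩
  set x : ℕ → N := fun j => (h j : N ≃ₜ N) (X.shrink z w (t j / s))
  set u : ℕ → RSpace n := fun j => X.hol (h j) w
  have hxn : ∀ j, X.Nearest (x j) (u j) := fun j =>
    (hn.shrink hd hinc (hq j)).deck hd hinc (h j)
  have hshrink : ∀ j, (h j : N ≃ₜ N) (X.shrink z w (t j)) = X.shrink (x j) (u j) s := fun j => by
    rw [(hn.shrink hd hinc (hq j)).shrink_deck hd hinc hs, hn.shrink_shrink hd hinc (hq j) hs,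
      mul_div_cancel₀ _ hs.1.ne']
  simp only [hshrink] at hnear
  refine Nearest.exists_shrink_eq_of_tendsto hd hinc hxn hs (x := x 0) (b := u 0) (fun j => ?_)
    (Near.tendsto hδlim hnear) (Near.tendsto_base_and_tip hδlim hnear).2
  have hnear' := (((hnear 0).mono hd hinc (hδ 0).2.le).symm hd hinc (by norm_num)).trans hd hinc
    ((hnear j).mono hd hinc ((hδ j).2.le.trans (by norm_num))) (by norm_num) (by norm_num)
  exact (hnear'.of_shrink hd hinc hs (hxn 0) (hxn j) (by norm_num) (by norm_num)).mono hd hinc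
    (by norm_num)

theorem Nearest.of_shrink (hs : s ∈ Ioc (0 : ℝ) 1) (h : X.Nearest z w)
    (h' : X.Nearest (X.shrink z w s) w') : X.Nearest z w' := by
  have hbox := h.add_a_sub_mem_box hd hinc hs
  have hsub : X.D (X.shrink z w s) - X.D z = (w - X.D z) - 𝒢.a s (w - X.D z) := by
    rw [← h.sub_apply_shrink hd hinc hs]
    abel
  have hle : ∀ q, 𝒢.seminorm q (w' - X.D z) ≤ X.radius z ^ 𝒢.d q := fun q => by
    have hsq : 0 ≤ 1 - s ^ 𝒢.d q := sub_nonneg.2 (Real.rpow_le_one hs.1.le hs.2 (hd q))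
    have htip := h'.seminorm_sub_le q
    rw [h.rpow_radius_shrink hd hinc hs] at htip
    have hbase : 𝒢.seminorm q (X.D (X.shrink z w s) - X.D z) ≤
        (1 - s ^ 𝒢.d q) * X.radius z ^ 𝒢.d q := by
      rw [hsub, 𝒢.seminorm_sub_a hd hs.1.le, abs_of_nonneg hsq]
      exact mul_le_mul_of_nonneg_left (h.seminorm_sub_le q) hsq
    rw [← sub_add_sub_cancel w' (X.D (X.shrink z w s)) (X.D z)]
    linarith [map_add_le_add (𝒢.seminorm q) (w' - X.D (X.shrink z w s))
      (X.D (X.shrink z w s) - X.D z)]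
  refine ⟨fun hv => h'.not_visible ?_, ?_, hle⟩
  · refine visible_expMap_of_mem_closure X.D_local (𝒢.convex_box _ _)
      (X.boxVisible_radius hd hinc z) hbox (𝒢.mem_box_self _ (X.radius_pos hd hinc z))
      (fun t ht => 𝒢.lineMap_mem_box hbox (fun q _ => hle q) ht) ?_
    rwa [expMap_self X.D_local]
  · rw [← sub_add_sub_cancel w' (X.D (X.shrink z w s)) (X.D z), map_add,
      h'.a_zero_sub_eq_zero, hsub, map_sub, 𝒢.a_zero_a hs.1.le, sub_self, add_zero]

/-- Two nearest points of `z` are nearest points of every preimage of `z` under `shrink` towards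
one of them, from where they look close to each other. -/
theorem Nearest.unique (h : X.Nearest z w) (h' : X.Nearest z w') : w' = w := by
  obtain ⟨ε, hε, htip⟩ := X.exists_forall_near_imp_sub_mem_neutral hd hinc
  obtain ⟨s, hsq, hs⟩ := ((𝒢.eventually_forall_rpow_lt hd (by positivity : (0 : ℝ) < ε / 2)).and
    (Ioc_mem_nhdsGT one_pos)).exists
  obtain ⟨x, hx, rfl⟩ := h.exists_shrink_eq hd hinc hs
  have hr := X.rpow_radius_pos hd hinc x
  have hzero := h.a_zero_sub_eq_zero_of_nearest h'
  have hnear : X.Near ε x w x w' := by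
    refine ⟨expMap_self X.D_local x, fun q => ?_, fun q => ?_, fun q => ?_, fun q => ?_⟩
    · rw [sub_self, map_zero]
      exact mul_pos hε (hr q)
    · by_cases hq : 𝒢.d q = 0
      · rw [𝒢.seminorm_eq_zero_of_a_zero_eq_zero hd hzero hq]
        exact mul_pos hε (hr q)
      · have hle := h.seminorm_sub_le q
        have hle' := h'.seminorm_sub_le q
        rw [hx.rpow_radius_shrink hd hinc hs] at hle hle'
        rw [← sub_sub_sub_cancel_right w' w (X.D (X.shrink x w s))]
        linarith [map_sub_le_add (𝒢.seminorm q) (w' - X.D (X.shrink x w s))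
          (w - X.D (X.shrink x w s)), mul_lt_mul_of_pos_right (hsq q hq) (hr q)]
    all_goals exact le_mul_of_one_le_left (hr q).le (by linarith)
  have hneu := htip x x w w' hx (hx.of_shrink hd hinc hs h') hnear
  rw [← sub_eq_zero, ← 𝒢.a_zero_eq_self_iff.2 hneu, hzero]

theorem continuous_of_nearest {W : N → RSpace n} (hW : ∀ z, X.Nearest z (W z)) :
    Continuous W := by
  have hloc := locallyCompactSpace_of_isLocalHomeomorph X.D_local
  refine continuous_iff_continuousAt.2 fun z => ?_
  obtain ⟨Q, hQ, hzQ⟩ := exists_compact_mem_nhds z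
  obtain ⟨T, hT, hTn⟩ := X.isCompact_nearest hd hinc hQ
  refine (tendsto_iff_ultrafilter _ _ _).2 fun u hu => ?_
  have hmem : ∀ᶠ z' in (u : Filter N), (z', W z') ∈ T :=
    mem_of_superset (hu hzQ) fun z' hz' => hTn z' hz' _ (hW z')
  obtain ⟨x, -, hx⟩ := hT.ultrafilter_le_nhds' (u.map fun z' => (z', W z')) hmem
  have hlim : Tendsto W u (𝓝 x.2) :=
    (continuous_snd.tendsto x).comp (show Tendsto (fun z' => (z', W z')) u (𝓝 x) from hx)
  rwa [(hW z).unique hd hinc (Nearest.of_tendsto hd hinc hW hu hlim)] at hlim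

variable (X)

theorem exists_nearest_sub_mem_neutral : ∃ w₀, ∀ z, ∃ w, X.Nearest z w ∧ w - w₀ ∈ 𝒢.neutral := by
  choose W hW using X.exists_nearest hd hinc
  obtain ⟨ε, hε, htip⟩ := X.exists_forall_near_imp_sub_mem_neutral hd hinc
  have hcont := continuous_of_nearest hd hinc hW
  have hlc : IsLocallyConstant fun z => 𝒢.neutral.mkQ (W z) := by
    refine (IsLocallyConstant.iff_eventually_eq _).2 fun z => ?_
    have hpair : ContinuousAt (fun z' => ((z, W z), (z', W z'))) z := by fun_prop
    filter_upwards [hpair.eventually (X.eventually_near hd hinc hε z (W z))] with z' hz'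
    exact (Submodule.Quotient.eq _).2 (htip z z' _ _ (hW z) (hW z') hz')
  obtain ⟨z₀⟩ : Nonempty N := inferInstance
  exact ⟨W z₀, fun z => ⟨W z, hW z,
    (Submodule.Quotient.eq _).1 (hlc.apply_eq_of_preconnectedSpace z z₀)⟩⟩

end RayStructure

section LocallyVisible

variable {E N : Type*} [AddCommGroup E] [Module ℝ E] [TopologicalSpace E] [TopologicalSpace N]
  {D : N → E} {v : E}

/-- `v` has a convex open neighborhood that is visible from every point developing into it. Over
such a neighborhood `D` is a trivial covering. -/
def LocallyVisible (D : N → E) (v : E) : Prop :=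
  ∃ O, IsOpen O ∧ Convex ℝ O ∧ v ∈ O ∧ ∀ z, D z ∈ O → ∀ u ∈ O, Visible D z u

variable (hD : IsLocalHomeomorph D)

include hD

theorem range_eq_connectedComponentIn_of_locallyVisible [PreconnectedSpace N] {S : Set E}
    (hS : ∀ z, D z ∈ S) (h : ∀ v ∈ S, LocallyVisible D v) (z : N) :
    range D = connectedComponentIn S (D z) := by
  refine Subset.antisymm ((isPreconnected_range hD.continuous).subset_connectedComponentIn
    (mem_range_self z) (range_subset_iff.2 hS)) ?_
  refine isPreconnected_connectedComponentIn.subset_of_closure_inter_subset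
    hD.isOpenMap.isOpen_range ⟨D z, mem_connectedComponentIn (hS z), mem_range_self z⟩ ?_
  rintro v ⟨hv, hvS⟩
  obtain ⟨O, hO, -, hvO, hvis⟩ := h v (connectedComponentIn_subset _ _ hvS)
  obtain ⟨_, hyO, y, rfl⟩ := mem_closure_iff.1 hv O hO hvO
  exact ⟨_, (hvis y hyO v hvO).apply_expMap⟩

variable [T2Space N] [IsTopologicalAddGroup E] [ContinuousSMul ℝ E]

theorem LocallyVisible.isEvenlyCovered (h : LocallyVisible D v) :
    IsEvenlyCovered D v (D ⁻¹' {v}) := by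
  obtain ⟨O, hO, hconv, hv, hvis⟩ := h
  have hvis_fiber : ∀ (y : D ⁻¹' {v}) (u : O), Visible D y u := fun y u =>
    hvis y (y.2.symm ▸ hv) u u.2
  let toFun : D ⁻¹' O → O × (D ⁻¹' {v}) := fun z =>
    (⟨D z, z.2⟩, ⟨expMap D z v, (hvis z z.2 v hv).apply_expMap⟩)
  let invFun : O × (D ⁻¹' {v}) → D ⁻¹' O := fun x =>
    ⟨expMap D x.2 x.1, mem_preimage.2 <| by
      rw [(hvis_fiber x.2 x.1).apply_expMap]
      exact x.1.2⟩
  have left_inv : Function.LeftInverse invFun toFun := fun z => Subtype.ext <| by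
    change expMap D (expMap D z v) (D z) = z
    rw [(visible_expMap_of_convex hD hconv (hvis z z.2) hv z.2).2, expMap_self hD]
  have right_inv : Function.RightInverse invFun toFun := fun ⟨u, y⟩ => by
    refine Prod.ext (Subtype.ext (hvis_fiber y u).apply_expMap) (Subtype.ext ?_)
    change expMap D (expMap D y u) v = y
    rw [(visible_expMap_of_convex hD hconv (fun u hu => hvis_fiber y ⟨u, hu⟩) u.2 hv).2]
    exact (congrArg (expMap D y) (show v = D y from y.2.symm)).trans (expMap_self hD _)
  have continuous_toFun : Continuous toFun := by
    refine ((hD.continuous.comp continuous_subtype_val).subtype_mk _).prodMk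
      (Continuous.subtype_mk (continuous_iff_continuousAt.2 fun z => ?_) _)
    exact ((hvis z z.2 v hv).eventually_and_continuousAt_expMap hD).2.comp
      (f := fun z : D ⁻¹' O => ((z : N), v)) (by fun_prop)
  have continuous_invFun : Continuous invFun := by
    refine Continuous.subtype_mk (continuous_iff_continuousAt.2 fun x => ?_) _
    exact ((hvis_fiber x.2 x.1).eventually_and_continuousAt_expMap hD).2.comp
      (f := fun x : O × (D ⁻¹' {v}) => ((x.2 : N), (x.1 : E))) (by fun_prop)
  have discrete : DiscreteTopology (D ⁻¹' {v}) :=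
    have : Subsingleton (D '' (D ⁻¹' {v})) :=
      (subsingleton_singleton.anti (image_preimage_subset D {v})).coe_sort
    (isLocalHomeomorph_iff_isLocalHomeomorphOn_univ.1 hD).mono (subset_univ _)
      |>.discreteTopology_of_image
  exact ⟨discrete, O, hv, hO, hO.preimage hD.continuous,
    ⟨⟨toFun, invFun, left_inv, right_inv⟩, continuous_toFun, continuous_invFun⟩, fun _ => rfl⟩

theorem isCoveringMap_rangeFactorization_of_locallyVisible (h : ∀ z, LocallyVisible D (D z)) :
    IsCoveringMap (rangeFactorization D) := by
  rintro ⟨_, z, rfl⟩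
  have huniv : D ⁻¹' (range D) = univ := eq_univ_of_forall mem_range_self
  exact (((h z).isEvenlyCovered hD).restrictPreimage (range D) (mem_range_self z)).comp_homeomorph
    ((Homeomorph.setCongr huniv).trans (Homeomorph.Set.univ N)).symm |>.to_isEvenlyCovered_preimage

end LocallyVisible

theorem IsIncompleteGeodesic.not_locallyVisible {n : ℕ} {N : Type*} [TopologicalSpace N] [T2Space N]
    {D : N → RSpace n} (hD : IsLocalHomeomorph D) {γ : ℝ → N} {w : RSpace n}
    (h : IsIncompleteGeodesic D γ w) : ¬ LocallyVisible D w := by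
  rintro ⟨O, hO, -, hwO, hvis⟩
  obtain ⟨t, htO, ht⟩ := ((h.tendsto_develop.eventually_mem (hO.mem_nhds hwO)).and
    (Ico_mem_nhdsLT (zero_lt_one' ℝ))).exists
  exact h.not_visible hD ht (hvis _ htO w hwO)

namespace RayStructure

variable {n : ℕ} {𝒢 : RankOneRayGeometry n} {M N : Type*} [TopologicalSpace M] [TopologicalSpace N]
  {X : RayStructure 𝒢 M N}

theorem isInvisibleSubspace_of_locallyVisible [T2Space N] [ConnectedSpace N]
    {I : AffineSubspace ℝ (RSpace n)} (hI : ∀ w ∈ I, ∀ z, ¬ Visible X.D z w)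
    (hIc : ∀ v ∉ I, LocallyVisible X.D v) : X.IsInvisibleSubspace I := by
  have hD := X.D_local
  have havoid : ∀ z, X.D z ∉ I := fun z hz => hI _ hz z (visible_self X.D z)
  have hend : ∀ γ w, IsIncompleteGeodesic X.D γ w → w ∈ I := fun γ w hγ => by
    by_contra hw
    exact hγ.not_locallyVisible hD (hIc w hw)
  refine ⟨fun w => ⟨fun hw => ?_, fun ⟨γ, hγ⟩ => hend γ w hγ⟩, havoid,
    range_eq_connectedComponentIn_of_locallyVisible hD havoid hIc,
    isCoveringMap_rangeFactorization_of_locallyVisible hD fun z => hIc _ (havoid z)⟩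
  obtain ⟨z⟩ : Nonempty N := inferInstance
  obtain ⟨s, hs, γ, -, hγ⟩ := exists_isIncompleteGeodesic_of_not_visible hD (hI w hw z)
  obtain hs₁ | rfl := hs.2.lt_or_eq
  · refine absurd ?_ (havoid z)
    have hz : AffineMap.lineMap w (AffineMap.lineMap (X.D z) w s) (1 - s)⁻¹ = X.D z := by
      rw [← AffineMap.lineMap_apply_one_sub w, AffineMap.lineMap_lineMap_right,
        inv_mul_cancel₀ (sub_pos.2 hs₁).ne', AffineMap.lineMap_apply_one]
    exact hz ▸ AffineMap.lineMap_mem _ hw (hend _ _ hγ)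
  · exact ⟨γ, by rwa [AffineMap.lineMap_apply_one] at hγ⟩

variable (X) in
theorem exists_not_visible [T2Space N] [PathConnectedSpace N] (hX : ¬ X.IsComplete) (z : N) :
    ∃ v, ¬ Visible X.D z v := by
  by_contra! h
  exact hX (isHomeomorph_of_forall_visible X.D_local h)

section Nonneg

variable (hd : ∀ q, 0 ≤ 𝒢.d q) {z : N} {w w' : RSpace n} (hw' : X.Nearest z w')
  (hw : w' - w ∈ 𝒢.neutral)

include hd hw' hw

theorem not_visible_of_nearest_sub_mem_neutral [T2Space N] [SimplyConnectedSpace N]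
    [CompactSpace M] {v : RSpace n} (hv : v - w ∈ 𝒢.neutral) : ¬ Visible X.D z v := by
  have hvw : v - w' ∈ 𝒢.neutral := by
    rw [← sub_sub_sub_cancel_right v w' w]
    exact sub_mem hv hw
  rw [← add_sub_cancel w' v, X.visible_add_iff_of_mem_neutral hd hvw]
  exact hw'.not_visible

theorem seminorm_sub_le_rpow_radius {q : Fin n} (hq : 𝒢.d q ≠ 0) :
    𝒢.seminorm q (w - X.D z) ≤ X.radius z ^ 𝒢.d q := by
  rw [← sub_sub_sub_cancel_left (X.D z) w w']
  have := 𝒢.seminorm_eq_zero_of_mem_neutral hd hw hq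
  calc 𝒢.seminorm q ((w' - X.D z) - (w' - w))
      ≤ 𝒢.seminorm q (w' - X.D z) + 𝒢.seminorm q (w' - w) := map_sub_le_add _ _ _
    _ ≤ X.radius z ^ 𝒢.d q := by
      rw [this, add_zero]
      exact hw'.seminorm_sub_le q

end Nonneg

section Existence

variable [T2Space N] [SimplyConnectedSpace N] [CompactSpace M] (hd : ∀ q, 0 ≤ 𝒢.d q)

include hd

/-- A point near `v` is far from `w`, so that its radius is at least half the distance from `v`
to `w`. -/
theorem locallyVisible_of_seminorm_sub_le_rpow_radius
    (hinc : ∀ z, ∃ v, ¬ Visible X.D z v) {w : RSpace n}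
    (hw : ∀ z q, 𝒢.d q ≠ 0 → 𝒢.seminorm q (w - X.D z) ≤ X.radius z ^ 𝒢.d q)
    {v : RSpace n} (hv : v - w ∉ 𝒢.neutral) : LocallyVisible X.D v := by
  have hne : ∃ q, 𝒢.d q ≠ 0 ∧ 𝒢.seminorm q (v - w) ≠ 0 := by
    by_contra! h
    exact hv (𝒢.mem_neutral_of_forall_seminorm_eq_zero h)
  obtain ⟨q₀, hq₀, hne⟩ := hne
  set m := 𝒢.seminorm q₀ (v - w)
  have hm : 0 < m := (apply_nonneg _ _).lt_of_ne' hne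
  obtain ⟨s, hsq, hs⟩ := ((𝒢.eventually_forall_rpow_lt hd one_half_pos).and
    self_mem_nhdsWithin).exists
  set R := (m / 2) ^ (𝒢.d q₀)⁻¹
  have hR : 0 < R := Real.rpow_pos_of_pos (half_pos hm) _
  have hRq₀ : R ^ 𝒢.d q₀ = m / 2 := Real.rpow_inv_rpow (half_pos hm).le hq₀
  have hsR : ∀ q, 𝒢.d q ≠ 0 → (s * R) ^ 𝒢.d q ≤ 1 / 2 * R ^ 𝒢.d q := fun q hq => by
    rw [Real.mul_rpow (le_of_lt hs) hR.le]
    exact mul_le_mul_of_nonneg_right (hsq q hq).le (Real.rpow_nonneg hR.le _)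
  refine ⟨𝒢.box v (s * R), 𝒢.isOpen_box _ _, 𝒢.convex_box _ _,
    𝒢.mem_box_self _ (mul_pos hs hR), fun z hz u hu => ?_⟩
  have hRz : R ≤ X.radius z := by
    by_contra! hlt
    have hradius := Real.rpow_lt_rpow (X.radius_pos hd hinc z).le hlt ((hd q₀).lt_of_ne' hq₀)
    have htri := map_add_le_add (𝒢.seminorm q₀) (v - X.D z) (X.D z - w)
    rw [sub_add_sub_cancel, map_sub_rev _ v (X.D z), map_sub_rev _ (X.D z) w] at htri
    have hzq₀ := (hz q₀ hq₀).trans_le (hsR q₀ hq₀)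
    linarith [hw z q₀ hq₀]
  refine X.boxVisible_radius hd hinc z u fun q hq => ?_
  rw [← sub_sub_sub_cancel_right u (X.D z) v]
  linarith [map_sub_le_add (𝒢.seminorm q) (u - v) (X.D z - v), (hz q hq).trans_le (hsR q hq),
    (hu q hq).trans_le (hsR q hq), Real.rpow_le_rpow hR.le hRz (hd q)]

theorem exists_isInvisibleSubspace_of_nonneg (hX : ¬ X.IsComplete) :
    ∃ w, X.IsInvisibleSubspace (AffineSubspace.mk' w 𝒢.neutral) := by
  have hinc := X.exists_not_visible hX
  obtain ⟨w, hw⟩ := X.exists_nearest_sub_mem_neutral hd hinc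
  choose W hW hWw using hw
  refine ⟨w, isInvisibleSubspace_of_locallyVisible (fun v hv z => ?_) fun v hv => ?_⟩
  · exact not_visible_of_nearest_sub_mem_neutral hd (hW z) (hWw z) hv
  · exact locallyVisible_of_seminorm_sub_le_rpow_radius hd hinc
      (fun z q => seminorm_sub_le_rpow_radius hd (hW z) (hWw z)) hv

end Existence

end RayStructure

theorem diagMap_neg {n : ℕ} (e : Module.Basis (Fin n) ℝ (RSpace n)) (d : Fin n → ℝ) {β : ℝ}
    (hβ : 0 ≤ β) : diagMap e (-d) β = diagMap e d β⁻¹ := by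
  apply e.ext
  intro q
  simp [diagMap, Real.rpow_neg hβ, Real.inv_rpow hβ]

namespace RankOneRayGeometry

variable {n : ℕ} (𝒢 : RankOneRayGeometry n)

/-- The geometry with the opposite exponents: the group `A`, hence `G`, is the same, with the
inverse parametrization. It reduces nonpositive exponents to nonnegative ones. -/
def reverse : RankOneRayGeometry n where
  e := 𝒢.e
  d := -𝒢.d
  d_ne_zero := 𝒢.d_ne_zero.imp fun q hq => neg_ne_zero.2 hq
  K := 𝒢.K
  K_compact := 𝒢.K_compact
  K_centralizes k hk β hβ x := by
    rw [diagMap_neg _ _ hβ.le]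
    exact 𝒢.K_centralizes k hk _ (inv_pos.2 hβ) x

theorem G_le_G_reverse : 𝒢.G ≤ 𝒢.reverse.G := by
  rintro T ⟨k, hk, β, hβ, hT⟩
  refine ⟨k, hk, β⁻¹, inv_pos.2 hβ, fun x => ?_⟩
  rw [hT, a, a, reverse, diagMap_neg _ _ (inv_pos.2 hβ).le, inv_inv]

theorem neutral_reverse : 𝒢.reverse.neutral = 𝒢.neutral := by
  simp [neutral, reverse]

theorem neutral_eq_bot (hd : ∀ q, 𝒢.d q ≠ 0) : 𝒢.neutral = ⊥ := by
  simp [neutral, hd]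

end RankOneRayGeometry

namespace RayStructure

variable {n : ℕ} {𝒢 : RankOneRayGeometry n} {M N : Type*} [TopologicalSpace M] [TopologicalSpace N]
  {X : RayStructure 𝒢 M N} {I : AffineSubspace ℝ (RSpace n)}

variable (X) in
/-- The same structure on `M`, modelled on the reversed geometry. -/
noncomputable def reverse : RayStructure 𝒢.reverse M N where
  p := X.p
  p_covering := X.p_covering
  p_surjective := X.p_surjective
  D := X.D
  D_local := X.D_local
  ρ := (Subgroup.inclusion 𝒢.G_le_G_reverse).comp X.ρ
  equivariant := X.equivariant

theorem IsInvisibleSubspace.of_reverse (h : X.reverse.IsInvisibleSubspace I) :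
    X.IsInvisibleSubspace I where
  mem_iff := h.mem_iff
  avoids := h.avoids
  range_eq := h.range_eq
  covering := h.covering

theorem exists_isInvisibleSubspace [T2Space N] [SimplyConnectedSpace N] [CompactSpace M]
    (hd : (∀ q, 0 ≤ 𝒢.d q) ∨ ∀ q, 𝒢.d q ≤ 0) (hX : ¬ X.IsComplete) :
    ∃ w, X.IsInvisibleSubspace (AffineSubspace.mk' w 𝒢.neutral) := by
  obtain hd | hd := hd
  · exact exists_isInvisibleSubspace_of_nonneg hd hX
  · obtain ⟨w, hw⟩ :=
      exists_isInvisibleSubspace_of_nonneg (X := X.reverse) (fun q => neg_nonneg.2 (hd q)) hX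
    rw [𝒢.neutral_reverse] at hw
    exact ⟨w, hw.of_reverse⟩

theorem _root_.IsIncompleteGeodesic.deck {γ : ℝ → N} {w : RSpace n}
    (h : IsIncompleteGeodesic X.D γ w) (g : deckGroup X.p) :
    IsIncompleteGeodesic X.D (fun t => (g : N ≃ₜ N) (γ t)) (X.hol g w) where
  continuousOn := (g : N ≃ₜ N).continuous.comp_continuousOn h.continuousOn
  develops t ht := by
    rw [X.equivariant, X.equivariant, h.develops t ht]
    exact (X.hol g).toAffineMap.apply_lineMap _ _ _
  no_completion := by
    rintro ⟨z, hz⟩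
    refine h.no_completion ⟨(g : N ≃ₜ N).symm z, ?_⟩
    simpa [Function.comp_def] using ((g : N ≃ₜ N).symm.continuous.tendsto z).comp hz

theorem IsInvisibleSubspace.isRadiant {w : RSpace n}
    (h : X.IsInvisibleSubspace (AffineSubspace.mk' w ⊥)) : X.IsRadiant := by
  refine ⟨w, fun g => ?_, h⟩
  obtain ⟨γ, hγ⟩ := (h.mem_iff w).1 (AffineSubspace.self_mem_mk' _ _)
  have hgw := (h.mem_iff _).2 ⟨_, hγ.deck g⟩
  rwa [AffineSubspace.mem_mk', Submodule.mem_bot, vsub_eq_zero_iff_eq] at hgw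

end RayStructure

section Compact

variable {A B : Type*} [TopologicalSpace A] [TopologicalSpace B] [T2Space B] {S : Set A}
  (hS : IsCompact S) {f : A → B} (hf : ContinuousOn f S) (hinj : InjOn f S)

include hS hf hinj

theorem tendsto_of_tendsto_comp_of_injOn {ι : Type*} {u : ι → A} {l : Filter ι}
    (hu : ∀ᶠ i in l, u i ∈ S) {x : A} (hx : x ∈ S)
    (h : Tendsto (fun i => f (u i)) l (𝓝 (f x))) : Tendsto u l (𝓝 x) := by
  refine (tendsto_iff_ultrafilter _ _ _).2 fun m hm => ?_
  obtain ⟨a, ha, hma⟩ := hS.ultrafilter_le_nhds' (m.map u) (hm hu)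
  have hua : Tendsto u m (𝓝[S] a) := tendsto_nhdsWithin_iff.2 ⟨hma, hm hu⟩
  have hfax := tendsto_nhds_unique ((hf a ha).tendsto.comp hua) (h.mono_left hm)
  rwa [← hinj ha hx hfax]

theorem continuousOn_invFunOn_of_isCompact [Nonempty A] :
    ContinuousOn (Function.invFunOn f S) (f '' S) := by
  rintro _ ⟨x, hx, rfl⟩
  rw [ContinuousWithinAt, hinj.leftInvOn_invFunOn hx]
  have hev := eventually_mem_nhdsWithin (a := f x) (s := f '' S)
  refine tendsto_of_tendsto_comp_of_injOn hS hf hinj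
    (hev.mono fun y hy => Function.invFunOn_mem hy) hx ?_
  exact (tendsto_nhdsWithin_of_tendsto_nhds tendsto_id).congr'
    (hev.mono fun y hy => (Function.invFunOn_eq hy).symm)

end Compact

theorem IsIncompleteGeodesic.notMem_image_of_devConvex {n : ℕ} {N : Type*} [TopologicalSpace N]
    [T2Space N] {D : N → RSpace n} (hD : IsLocalHomeomorph D) {γ : ℝ → N} {w : RSpace n}
    (h : IsIncompleteGeodesic D γ w) {S : Set N} (hS : IsCompact S) (hconv : DevConvex D S) {t : ℝ}
    (ht : t ∈ Ico (0 : ℝ) 1) (hγ : γ t ∈ S) : w ∉ D '' S := by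
  have : Nonempty N := ⟨γ 0⟩
  intro hw
  refine h.notMem_of_continuousOn_section hD ht
    (continuousOn_invFunOn_of_isCompact hS hD.continuous.continuousOn hconv.1)
    (fun v hv => Function.invFunOn_eq hv) (hconv.1.leftInvOn_invFunOn hγ) (fun r hr => ?_) hw
  exact hconv.2.segment_subset (mem_image_of_mem D hγ) hw (h.develop_mem_segment ht hr)

namespace RayStructure.FriedDynamics

variable {n : ℕ} {𝒢 : RankOneRayGeometry n} {M N : Type*} [MetricSpace M] [TopologicalSpace N]
  {X : RayStructure 𝒢 M N} (𝓕 : X.FriedDynamics)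

theorem Ui_mem_nhds (i : ℕ) : 𝓕.Ui i ∈ 𝓝 (𝓕.yi i) := by
  have : Nonempty N := ⟨𝓕.yi i⟩
  have hbij := 𝓕.Ui_bijOn i
  have hpc := X.p_covering.continuous
  have hp : Tendsto X.p (𝓝 (𝓕.yi i)) (𝓝 𝓕.y) := 𝓕.yi_lift i ▸ hpc.tendsto _
  obtain ⟨V, hV, hyV, hinj⟩ := X.p_covering.isLocalHomeomorph.isLocallyInjective (𝓕.yi i)
  set s := Function.invFunOn X.p (𝓕.Ui i)
  have hs : Tendsto s (𝓝 𝓕.y) (𝓝 (𝓕.yi i)) := by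
    have hcont := continuousOn_invFunOn_of_isCompact (𝓕.Ui_compact i) hpc.continuousOn hbij.injOn
    rw [hbij.image_eq] at hcont
    have hsy : s 𝓕.y = 𝓕.yi i := by
      rw [← 𝓕.yi_lift i]
      exact hbij.injOn.leftInvOn_invFunOn (𝓕.yi_mem i)
    exact hsy ▸ (hcont.continuousAt 𝓕.U_nhds).tendsto
  filter_upwards [hp.eventually ((hs.eventually_mem (hV.mem_nhds hyV)).and 𝓕.U_nhds),
    hV.mem_nhds hyV] with x hx hxV
  have hmem : ∃ a ∈ 𝓕.Ui i, X.p a = X.p x := hbij.surjOn hx.2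
  rw [← hinj hx.1 hxV (Function.invFunOn_eq hmem)]
  exact Function.invFunOn_mem hmem

theorem tendsto_of_deck_eq (i : ℕ) {x : ℕ → N} (hxU : ∀ j, x j ∈ 𝓕.Ui i)
    (hx : ∀ j, (𝓕.g j i : N ≃ₜ N) (x j) = 𝓕.γ (𝓕.t j)) : Tendsto x atTop (𝓝 (𝓕.yi i)) := by
  refine tendsto_of_tendsto_comp_of_injOn (𝓕.Ui_compact i) X.p_covering.continuous.continuousOn
    (𝓕.Ui_bijOn i).injOn (Eventually.of_forall hxU) (𝓕.yi_mem i) ?_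
  rw [𝓕.yi_lift i]
  refine tendsto_iff_dist_tendsto_zero.2 (squeeze_zero (fun _ => dist_nonneg) (fun j => ?_)
    𝓕.ε_tendsto)
  rw [← X.p_deck (𝓕.g j i), hx]
  exact 𝓕.close j

theorem tendsto_develop : Tendsto (fun j => X.D (𝓕.γ (𝓕.t j))) atTop (𝓝 𝓕.w) :=
  𝓕.incomplete.tendsto_develop.comp (tendsto_nhdsWithin_iff.2
    ⟨𝓕.t_tendsto, Eventually.of_forall fun j => (𝓕.t_mem j).2⟩)

theorem seminorm_hol_sub (i j : ℕ) (q : Fin n) (v w : RSpace n) :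
    𝒢.seminorm q (X.hol (𝓕.g j i) v - X.hol (𝓕.g j i) w) =
      𝓕.β j i ^ 𝒢.d q * 𝒢.seminorm q (v - w) := by
  rw [X.hol_sub, 𝓕.linear_eq, ← 𝒢.seminorm_a (𝓕.β_pos j i)]
  exact 𝒢.seminorm_smul (𝓕.k_mem j i) q _

variable {𝓕} in
theorem exists_pos_eventually_lt_of_βLim_ne_zero {i : ℕ} {q : Fin n} (h : 𝓕.βLim i q ≠ 0) :
    ∃ c > 0, ∀ᶠ j in atTop, c < 𝓕.β j i ^ 𝒢.d q := by
  obtain ⟨c, hc₀, hc⟩ := ENNReal.lt_iff_exists_nnreal_btwn.1 (pos_iff_ne_zero.2 h)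
  refine ⟨c, by exact_mod_cast hc₀, ?_⟩
  filter_upwards [(𝓕.β_tendsto i q).eventually_const_lt hc] with j hj
  rwa [← ENNReal.ofReal_coe_nnreal, ENNReal.ofReal_lt_ofReal_iff
    (Real.rpow_pos_of_pos (𝓕.β_pos j i) _)] at hj

variable {𝓕} in
/-- If nothing is contracted, then pulling back `w - D (γ (t j))` by the linear part of `ρ (g j i)`
does not enlarge it by more than a constant factor. -/
theorem tendsto_hol_symm_of_βLim_ne_zero {i : ℕ} (h : ∀ q, 𝓕.βLim i q ≠ 0) :
    Tendsto (fun j => (X.hol (𝓕.g j i)).symm 𝓕.w) atTop (𝓝 (X.D (𝓕.yi i))) := by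
  have hx : ∀ j, ∃ x ∈ 𝓕.Ui i, (𝓕.g j i : N ≃ₜ N) x = 𝓕.γ (𝓕.t j) := fun j => by
    have hγ := 𝓕.γ_mem j
    rwa [← 𝓕.g_image j i] at hγ
  choose x hxU hxγ using hx
  choose c hc₀ hc using fun q => exists_pos_eventually_lt_of_βLim_ne_zero (h q)
  set v : ℕ → RSpace n := fun j => (X.hol (𝓕.g j i)).symm 𝓕.w
  have hseminorm : ∀ q j, 𝒢.seminorm q (𝓕.w - X.D (𝓕.γ (𝓕.t j))) =
      𝓕.β j i ^ 𝒢.d q * 𝒢.seminorm q (v j - X.D (x j)) := fun q j => by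
    rw [← 𝓕.seminorm_hol_sub, ← hxγ, X.equivariant, AffineEquiv.apply_symm_apply]
  have hvx : Tendsto (fun j => v j - X.D (x j)) atTop (𝓝 0) := by
    refine 𝒢.tendsto_of_forall_tendsto_seminorm fun q => ?_
    have hlim : Tendsto (fun j => (c q)⁻¹ * 𝒢.seminorm q (𝓕.w - X.D (𝓕.γ (𝓕.t j)))) atTop
        (𝓝 0) := by
      have := ((𝒢.continuous_seminorm q).tendsto _).comp (𝓕.tendsto_develop.const_sub 𝓕.w)
      rw [sub_self, map_zero] at this
      simpa using this.const_mul (c q)⁻¹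
    refine squeeze_zero' (Eventually.of_forall fun j => apply_nonneg _ _) ?_ hlim
    filter_upwards [hc q] with j hj
    rw [sub_zero, ← div_eq_inv_mul, le_div_iff₀ (hc₀ q), hseminorm, mul_comm]
    exact mul_le_mul_of_nonneg_right hj.le (apply_nonneg _ _)
  simpa using hvx.add
    ((X.D_local.continuous.tendsto _).comp (𝓕.tendsto_of_deck_eq i hxU hxγ))

/-- If nothing were contracted, then `w` would lie in the developed image of some convex set
`Ui j`, which meets `γ`. -/
theorem exists_βLim_eq_zero (i : ℕ) : ∃ q, 𝓕.βLim i q = 0 := by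
  by_contra! h
  have := X.t2Space
  have hnhds : X.D '' 𝓕.Ui i ∈ 𝓝 (X.D (𝓕.yi i)) :=
    X.D_local.isOpenMap.image_mem_nhds (𝓕.Ui_mem_nhds i)
  obtain ⟨j, u, hu, huw⟩ := ((tendsto_hol_symm_of_βLim_ne_zero h).eventually_mem hnhds).exists
  refine 𝓕.incomplete.notMem_image_of_devConvex X.D_local (𝓕.Ui_compact j) (𝓕.Ui_convex j)
    (𝓕.t_mem j) (𝓕.γ_mem j) ⟨(𝓕.g j i : N ≃ₜ N) u, ?_, ?_⟩
  · rw [← 𝓕.g_image j i]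
    exact mem_image_of_mem _ hu
  · rw [X.equivariant, huw]
    exact AffineEquiv.apply_symm_apply _ _

theorem βLim_eq_one {q : Fin n} (hq : 𝒢.d q = 0) (i : ℕ) : 𝓕.βLim i q = 1 :=
  tendsto_nhds_unique (𝓕.β_tendsto i q) (by simp [hq])

theorem ω_eq_one {q : Fin n} (hq : 𝒢.d q = 0) : 𝓕.ω q = 1 :=
  tendsto_nhds_unique (𝓕.βLim_tendsto q) (by simp [𝓕.βLim_eq_one hq])

section Contracted

variable {𝓕} {i : ℕ} {q : Fin n} (hq : 𝓕.βLim i q = 0)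

include hq

theorem d_ne_zero_of_βLim_eq_zero : 𝒢.d q ≠ 0 := fun h =>
  zero_ne_one (hq.symm.trans (𝓕.βLim_eq_one h i))

theorem tendsto_rpow_of_βLim_eq_zero : Tendsto (fun j => 𝓕.β j i ^ 𝒢.d q) atTop (𝓝[>] 0) := by
  have hpos : ∀ j, 0 < 𝓕.β j i ^ 𝒢.d q := fun j => Real.rpow_pos_of_pos (𝓕.β_pos j i) _
  refine tendsto_nhdsWithin_iff.2 ⟨?_, Eventually.of_forall hpos⟩
  have hlim := (ENNReal.tendsto_toReal ENNReal.zero_ne_top).comp (hq ▸ 𝓕.β_tendsto i q)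
  exact hlim.congr fun j => ENNReal.toReal_ofReal (hpos j).le

theorem rpow_eq_rpow_div_of_βLim_eq_zero (j : ℕ) (q' : Fin n) :
    𝓕.β j i ^ 𝒢.d q' = (𝓕.β j i ^ 𝒢.d q) ^ (𝒢.d q' / 𝒢.d q) := by
  rw [← Real.rpow_mul (𝓕.β_pos j i).le, mul_div_cancel₀ _ (d_ne_zero_of_βLim_eq_zero hq)]

theorem βLim_eq_zero_of_div_pos {q' : Fin n} (h : 0 < 𝒢.d q' / 𝒢.d q) : 𝓕.βLim i q' = 0 := by
  have hlim := ((Real.continuous_rpow_const h.le).tendsto 0).comp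
    ((tendsto_rpow_of_βLim_eq_zero hq).mono_right nhdsWithin_le_nhds)
  rw [Real.zero_rpow h.ne'] at hlim
  rw [← ENNReal.ofReal_zero]
  refine tendsto_nhds_unique (𝓕.β_tendsto i q') ((ENNReal.tendsto_ofReal hlim).congr fun j => ?_)
  rw [Function.comp_apply, ← rpow_eq_rpow_div_of_βLim_eq_zero hq]

theorem βLim_eq_top_of_div_neg {q' : Fin n} (h : 𝒢.d q' / 𝒢.d q < 0) : 𝓕.βLim i q' = ⊤ := by
  have hlim := ENNReal.tendsto_ofReal_atTop.comp
    ((tendsto_rpow_neg_nhdsGT_zero h).comp (tendsto_rpow_of_βLim_eq_zero hq))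
  refine tendsto_nhds_unique (𝓕.β_tendsto i q') (hlim.congr fun j => ?_)
  rw [Function.comp_apply, Function.comp_apply, ← rpow_eq_rpow_div_of_βLim_eq_zero hq]

end Contracted

section NotExpanding

variable {𝓕} (hF : 𝓕.F = ⊥)

include hF

theorem ω_ne_top (q : Fin n) : 𝓕.ω q ≠ ⊤ := by
  intro h
  have he : 𝒢.e q ∈ 𝓕.F := Submodule.subset_span (mem_image_of_mem _ h)
  rw [hF, Submodule.mem_bot] at he
  exact 𝒢.e.ne_zero q he

theorem eventually_βLim_ne_top (q : Fin n) : ∀ᶠ i in atTop, 𝓕.βLim i q ≠ ⊤ :=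
  (𝓕.βLim_tendsto q).eventually_ne (ω_ne_top hF q)

theorem ω_eq_zero {q : Fin n} (hq : 𝒢.d q ≠ 0) : 𝓕.ω q = 0 := by
  refine tendsto_nhds_unique (𝓕.βLim_tendsto q) (tendsto_const_nhds.congr' ?_)
  filter_upwards [eventually_βLim_ne_top hF q] with i hi
  obtain ⟨q₀, hq₀⟩ := 𝓕.exists_βLim_eq_zero i
  obtain h | h := (div_ne_zero hq (d_ne_zero_of_βLim_eq_zero hq₀)).lt_or_gt
  · exact absurd (βLim_eq_top_of_div_neg hq₀ h) hi
  · exact (βLim_eq_zero_of_div_pos hq₀ h).symm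

theorem P_eq_neutral : 𝓕.P = 𝒢.neutral := by
  have h : {q | 𝓕.ω q = 1} = {q | 𝒢.d q = 0} := by
    ext q
    refine ⟨fun (h : 𝓕.ω q = 1) => ?_, fun h => 𝓕.ω_eq_one h⟩
    by_contra hq
    exact zero_ne_one ((ω_eq_zero hF hq).symm.trans h)
  rw [P, h, RankOneRayGeometry.neutral]

theorem d_nonneg_or_d_nonpos : (∀ q, 0 ≤ 𝒢.d q) ∨ ∀ q, 𝒢.d q ≤ 0 := by
  by_contra! h
  obtain ⟨⟨q, hq⟩, q', hq'⟩ := h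
  obtain ⟨i, hi, hi'⟩ :=
    ((eventually_βLim_ne_top hF q).and (eventually_βLim_ne_top hF q')).exists
  obtain ⟨q₀, hq₀⟩ := 𝓕.exists_βLim_eq_zero i
  obtain h | h := (d_ne_zero_of_βLim_eq_zero hq₀).lt_or_gt
  · exact hi' (βLim_eq_top_of_div_neg hq₀ (div_neg_of_pos_of_neg hq' h))
  · exact hi (βLim_eq_top_of_div_neg hq₀ (div_neg_of_neg_of_pos hq h))

end NotExpanding

end RayStructure.FriedDynamics

theorem monotone_or_antitone_rpow {b : ℕ → ℝ} (hb : ∀ i, 0 < b i) (h : Monotone b ∨ Antitone b)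
    (d : ℝ) : (Monotone fun i => b i ^ d) ∨ Antitone fun i => b i ^ d := by
  rcases le_total 0 d with hd | hd <;> rcases h with h | h
  · exact .inl fun i j hij => Real.rpow_le_rpow (hb i).le (h hij) hd
  · exact .inr fun i j hij => Real.rpow_le_rpow (hb j).le (h hij) hd
  · exact .inr fun i j hij => Real.rpow_le_rpow_of_nonpos (hb i) (h hij) hd
  · exact .inl fun i j hij => Real.rpow_le_rpow_of_nonpos (hb j) (h hij) hd

theorem exists_tendsto_ofReal_div {c : ℕ → ℝ} (hc : ∀ i, 0 < c i) (h : Monotone c ∨ Antitone c) :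
    ∃ (L : ℕ → ENNReal) (ω : ENNReal),
      (∀ i, Tendsto (fun j => ENNReal.ofReal (c j / c i)) atTop (𝓝 (L i))) ∧
      Tendsto L atTop (𝓝 ω) := by
  obtain ⟨l, hl⟩ : ∃ l, Tendsto (fun i => ENNReal.ofReal (c i)) atTop (𝓝 l) := by
    rcases h with h | h
    · exact ⟨_, tendsto_atTop_iSup fun i j hij => ENNReal.ofReal_le_ofReal (h hij)⟩
    · exact ⟨_, tendsto_atTop_iInf fun i j hij => ENNReal.ofReal_le_ofReal (h hij)⟩
  have hdiv : ∀ i, Tendsto (fun j => ENNReal.ofReal (c j / c i)) atTop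
      (𝓝 (l / ENNReal.ofReal (c i))) := fun i => by
    simp only [ENNReal.ofReal_div_of_pos (hc i)]
    exact ENNReal.Tendsto.div_const hl (.inr (ENNReal.ofReal_pos.2 (hc i)).ne')
  by_cases h0 : l = 0
  · exact ⟨_, 0, hdiv, by simp [h0]⟩
  by_cases ht : l = ⊤
  · exact ⟨_, ⊤, hdiv, by simp [ht, ENNReal.top_div_of_ne_top]⟩
  · exact ⟨_, l / l, hdiv, ENNReal.Tendsto.const_div hl (.inl ht)⟩

theorem exists_strictMono_monotone_or_antitone_comp {α : Type*} [LinearOrder α] (b : ℕ → α) :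
    ∃ φ : ℕ → ℕ, StrictMono φ ∧ (Monotone (b ∘ φ) ∨ Antitone (b ∘ φ)) := by
  obtain ⟨φ, h | h⟩ := exists_increasing_or_nonincreasing_subseq (· < ·) b
  · exact ⟨φ, φ.strictMono, .inl fun i j hij => hij.eq_or_lt.elim (fun e => e ▸ le_rfl)
      fun hlt => (h i j hlt).le⟩
  · exact ⟨φ, φ.strictMono, .inr fun i j hij => hij.eq_or_lt.elim (fun e => e ▸ le_rfl)
      fun hlt => not_lt.1 (h i j hlt)⟩

theorem firstCountableTopology_units (A : Type*) [Monoid A] [TopologicalSpace A]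
    [FirstCountableTopology A] : FirstCountableTopology Aˣ :=
  have : FirstCountableTopology Aᵐᵒᵖ :=
    MulOpposite.opHomeomorph.symm.isInducing.firstCountableTopology
  Units.isEmbedding_embedProduct.isInducing.firstCountableTopology

theorem exists_seq_forall_rel_succ {α : Type*} [Nonempty α] {r : ℕ → α → α → Prop}
    (h : ∀ i a, ∃ b, r i a b) : ∃ u : ℕ → α, ∀ i, r i (u i) (u (i + 1)) := by
  choose f hf using h
  exact ⟨fun i => Nat.rec (Classical.arbitrary α) (fun i a => f i a) i, fun i => hf i _⟩

theorem exists_tendsto_forall_mem_of_mapClusterPt {M : Type*} [PseudoMetricSpace M] {q : ℝ → M}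
    {y : M} (hy : MapClusterPt y (𝓝[<] 1) q) {U : Set M} (hU : U ∈ 𝓝 y)
    (hexit : ∀ t ∈ Ico (0 : ℝ) 1, ∃ s ∈ Ioo t 1, q s ∉ U) :
    ∃ t : ℕ → ℝ, (∀ i, t i ∈ Ico (0 : ℝ) 1) ∧ StrictMono t ∧ Tendsto t atTop (𝓝 1) ∧
      (∀ i, dist (q (t i)) y ≤ 1 / ((i : ℝ) + 1)) ∧ (∀ i, q (t i) ∈ U) ∧
      ∀ i, ∃ s ∈ Ioo (t i) (t (i + 1)), q s ∉ U := by
  have hnext : ∀ (i : ℕ) (a : Ico (0 : ℝ) 1), ∃ b : Ico (0 : ℝ) 1,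
      1 - 1 / ((i : ℝ) + 1) < b ∧ dist (q b) y ≤ 1 / ((i : ℝ) + 1) ∧ q b ∈ U ∧
      ∃ s ∈ Ioo (a : ℝ) b, q s ∉ U := fun i a => by
    obtain ⟨s, hs, hsU⟩ := hexit a a.2
    have hi : 0 < 1 / ((i : ℝ) + 1) := by positivity
    have hreturn :=
      mapClusterPt_iff_frequently.1 hy _ (inter_mem hU (Metric.closedBall_mem_nhds y hi))
    obtain ⟨b, hb, hb'⟩ := (hreturn.and_eventually
      (Ioo_mem_nhdsLT (max_lt hs.2 (sub_lt_self 1 hi)))).exists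
    have hsb := (le_max_left _ _).trans_lt hb'.1
    exact ⟨⟨b, a.2.1.trans (hs.1.trans hsb).le, hb'.2⟩, (le_max_right _ _).trans_lt hb'.1,
      hb.2, hb.1, s, ⟨hs.1, hsb⟩, hsU⟩
  have : Nonempty (Ico (0 : ℝ) 1) := ⟨0, le_rfl, one_pos⟩
  obtain ⟨u, hu⟩ := exists_seq_forall_rel_succ hnext
  have hlim : Tendsto (fun i : ℕ => 1 - 1 / ((i : ℝ) + 1)) atTop (𝓝 1) := by
    simpa only [sub_zero] using (tendsto_one_div_add_atTop_nhds_zero_nat (𝕜 := ℝ)).const_sub 1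
  refine ⟨fun i => u (i + 1), fun i => (u (i + 1)).2, strictMono_nat_of_lt_succ fun i => ?_,
    tendsto_of_tendsto_of_tendsto_of_le_of_le hlim tendsto_const_nhds (fun i => (hu i).1.le)
      fun i => (u (i + 1)).2.2.le,
    fun i => (hu i).2.1, fun i => (hu i).2.2.1, fun i => (hu (i + 1)).2.2.2⟩
  obtain ⟨s, hs, -⟩ := (hu (i + 1)).2.2.2
  exact hs.1.trans hs.2

theorem exists_isCompact_devConvex_mem_nhds {n : ℕ} {N : Type*} [TopologicalSpace N]
    {D : N → RSpace n} (hD : IsLocalHomeomorph D) {x : N} {V : Set N} (hV : V ∈ 𝓝 x) :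
    ∃ S ⊆ V, IsCompact S ∧ S ∈ 𝓝 x ∧ DevConvex D S := by
  obtain ⟨e, hxe, he⟩ := hD x
  have hsymm : Tendsto e.symm (𝓝 (e x)) (𝓝 x) := by
    simpa only [e.left_inv hxe] using (e.symm.continuousAt (e.map_source hxe)).tendsto
  obtain ⟨r, hr, hball⟩ := Metric.nhds_basis_closedBall.mem_iff.1
    (inter_mem (e.open_target.mem_nhds (e.map_source hxe)) (hsymm hV))
  have ht : Metric.closedBall (e x) r ⊆ e.target := fun v hv => (hball hv).1
  refine ⟨e.symm '' Metric.closedBall (e x) r, image_subset_iff.2 fun v hv => (hball hv).2,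
    (isCompact_closedBall _ _).image_of_continuousOn (e.continuousOn_symm.mono ht), ?_, ?_, ?_⟩
  · simpa only [e.left_inv hxe] using
      e.symm.image_mem_nhds (e.map_source hxe) (Metric.closedBall_mem_nhds (e x) hr)
  · rw [he]
    exact e.injOn.mono (image_subset_iff.2 fun v hv => e.map_target (ht hv))
  · rw [he, image_image, image_congr fun v hv => e.right_inv (ht hv), image_id']
    exact convex_closedBall _ _

namespace RankOneRayGeometry

variable {n : ℕ} {𝒢 : RankOneRayGeometry n}

theorem linear_mul_inv {S T : RSpace n ≃ᵃ[ℝ] RSpace n}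
    {k l : (RSpace n →L[ℝ] RSpace n)ˣ} (hl : l ∈ 𝒢.K) {b c : ℝ} (hb : 0 < b) (hc : 0 < c)
    (hS : ∀ x, S.linear x = (k : RSpace n →L[ℝ] RSpace n) (𝒢.a b x))
    (hT : ∀ x, T.linear x = (l : RSpace n →L[ℝ] RSpace n) (𝒢.a c x)) (x : RSpace n) :
    (S * T⁻¹).linear x =
      ((k * l⁻¹ : (RSpace n →L[ℝ] RSpace n)ˣ) : RSpace n →L[ℝ] RSpace n) (𝒢.a (b / c) x) := by
  obtain ⟨y, rfl⟩ := T.linear.surjective x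
  have hsplit : 𝒢.a b y = 𝒢.a (b / c) (𝒢.a c y) := by
    rw [← 𝒢.a_mul (div_pos hb hc).le hc.le, div_mul_cancel₀ _ hc.ne']
  have hcomm : (l : RSpace n →L[ℝ] RSpace n) (𝒢.a b y) = 𝒢.a (b / c) (T.linear y) := by
    rw [hT, hsplit]
    exact 𝒢.K_centralizes l hl (b / c) (div_pos hb hc) (𝒢.a c y)
  calc (S * T⁻¹).linear (T.linear y)
    _ = S.linear y := congrArg S.linear (T.linear.symm_apply_apply y)
    _ = (k : RSpace n →L[ℝ] RSpace n) (𝒢.a b y) := hS y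
    _ = ((k * l⁻¹ * l : (RSpace n →L[ℝ] RSpace n)ˣ) : RSpace n →L[ℝ] RSpace n) (𝒢.a b y) := by
      rw [inv_mul_cancel_right]
    _ = _ := congrArg ((k * l⁻¹ : (RSpace n →L[ℝ] RSpace n)ˣ) : RSpace n →L[ℝ] RSpace n) hcomm

theorem exists_subseq_tendsto_and_monotone_or_antitone (T : ℕ → 𝒢.G) :
    ∃ φ : ℕ → ℕ, StrictMono φ ∧ ∃ (k : ℕ → (RSpace n →L[ℝ] RSpace n)ˣ) (b : ℕ → ℝ),
      (∀ i, k i ∈ 𝒢.K) ∧ (∀ i, 0 < b i) ∧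
      (∀ i x, (T (φ i) : RSpace n ≃ᵃ[ℝ] RSpace n).linear x =
        (k i : RSpace n →L[ℝ] RSpace n) (𝒢.a (b i) x)) ∧
      (∃ k₀, Tendsto k atTop (𝓝 k₀)) ∧ (Monotone b ∨ Antitone b) := by
  have := firstCountableTopology_units (RSpace n →L[ℝ] RSpace n)
  choose k hk b hb hT using fun i => (T i).2
  obtain ⟨k₀, -, φ, hφ, hk₀⟩ := 𝒢.K_compact.tendsto_subseq hk
  obtain ⟨ψ, hψ, hmon⟩ := exists_strictMono_monotone_or_antitone_comp (b ∘ φ)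
  exact ⟨φ ∘ ψ, hφ.comp hψ, k ∘ φ ∘ ψ, b ∘ φ ∘ ψ, fun i => hk _, fun i => hb _, fun i => hT _,
    ⟨k₀, hk₀.comp hψ.tendsto_atTop⟩, hmon⟩

end RankOneRayGeometry

namespace RayStructure

variable {n : ℕ} {𝒢 : RankOneRayGeometry n} {M N : Type*}

section

variable [TopologicalSpace M] [TopologicalSpace N] {X : RayStructure 𝒢 M N}

theorem _root_.DevConvex.deck {S : Set N} (h : DevConvex X.D S) (g : deckGroup X.p) :
    DevConvex X.D ((g : N ≃ₜ N) '' S) := by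
  refine ⟨?_, ?_⟩
  · rintro _ ⟨x, hx, rfl⟩ _ ⟨y, hy, rfl⟩ hxy
    rw [X.equivariant, X.equivariant] at hxy
    rw [h.1 hx hy ((X.hol g).injective hxy)]
  · have himage : X.D '' ((g : N ≃ₜ N) '' S) = (X.hol g).toAffineMap '' (X.D '' S) := by
      rw [image_image, image_image]
      exact image_congr fun x _ => X.equivariant g x
    rw [himage]
    exact h.2.affine_image _

theorem bijOn_deck_image {S : Set N} (h : InjOn X.p S) (g : deckGroup X.p) :
    BijOn X.p ((g : N ≃ₜ N) '' S) (X.p '' S) := by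
  refine ⟨?_, ?_, ?_⟩
  · rintro _ ⟨x, hx, rfl⟩
    exact ⟨x, hx, (X.p_deck g x).symm⟩
  · rintro _ ⟨x, hx, rfl⟩ _ ⟨x', hx', rfl⟩ hxx'
    rw [X.p_deck, X.p_deck] at hxx'
    rw [h hx hx' hxx']
  · rintro _ ⟨x, hx, rfl⟩
    exact ⟨_, mem_image_of_mem _ hx, X.p_deck g x⟩

theorem IsInvisibleSubspace.mk'_eq_of_isIncompleteGeodesic {w w' : RSpace n}
    {V : Submodule ℝ (RSpace n)} (h : X.IsInvisibleSubspace (AffineSubspace.mk' w V)) {γ : ℝ → N}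
    (hγ : IsIncompleteGeodesic X.D γ w') : AffineSubspace.mk' w V = AffineSubspace.mk' w' V := by
  simpa only [AffineSubspace.direction_mk'] using
    (AffineSubspace.mk'_eq ((h.mem_iff w').2 ⟨γ, hγ⟩)).symm

variable [SimplyConnectedSpace N]

/-- Otherwise `γ` would stay in a single lift of `p '' S`, which contains `w` by compactness. -/
theorem _root_.IsIncompleteGeodesic.exists_notMem_image [T2Space M] {γ : ℝ → N} {w : RSpace n}
    (hγ : IsIncompleteGeodesic X.D γ w) {S : Set N} (hS : IsCompact S) (hconv : DevConvex X.D S)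
    (hinj : InjOn X.p S) {t : ℝ} (ht : t ∈ Ico (0 : ℝ) 1) :
    ∃ s ∈ Ioo t 1, X.p (γ s) ∉ X.p '' S := by
  have := X.t2Space
  have : Nonempty N := ⟨γ t⟩
  by_contra! hcon
  obtain ⟨t₁, ht₁⟩ := exists_between ht.2
  have ht₁' : t₁ ∈ Ico (0 : ℝ) 1 := ⟨ht.1.trans ht₁.1.le, ht₁.2⟩
  have hγU : ∀ s ∈ Ico t₁ 1, X.p (γ s) ∈ X.p '' S := fun s hs =>
    hcon s ⟨ht₁.1.trans_le hs.1, hs.2⟩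
  obtain ⟨u, hu, hpu⟩ := hcon t₁ ht₁
  obtain ⟨g, hg⟩ := X.exists_deck_apply_eq hpu
  have hγt : γ t₁ ∈ (g : N ≃ₜ N) '' S := ⟨u, hu, hg⟩
  have hgS : IsCompact ((g : N ≃ₜ N) '' S) := hS.image (g : N ≃ₜ N).continuous
  have hbij := bijOn_deck_image hinj g
  have hpc := X.p_covering.continuous
  have hsec := continuousOn_invFunOn_of_isCompact hgS hpc.continuousOn hbij.injOn
  rw [hbij.image_eq] at hsec
  have hcont : ContinuousOn γ (Ico t₁ 1) := hγ.continuousOn.mono (Ico_subset_Ico_left ht₁'.1)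
  have hlift : EqOn (fun s => Function.invFunOn X.p ((g : N ≃ₜ N) '' S) (X.p (γ s))) γ (Ico t₁ 1) :=
    X.p_covering.eqOn_of_comp_eqOn isPreconnected_Ico
      (hsec.comp (hpc.comp_continuousOn hcont) hγU) hcont
      (fun s hs => Function.invFunOn_eq (hbij.surjOn (hγU s hs))) (left_mem_Ico.2 ht₁.2)
      (hbij.injOn.leftInvOn_invFunOn hγt)
  refine hγ.notMem_image_of_devConvex X.D_local hgS (hconv.deck g) ht₁' hγt ?_
  refine (hgS.image X.D_local.continuous).isClosed.mem_of_tendsto hγ.tendsto_develop ?_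
  filter_upwards [Ico_mem_nhdsLT ht₁.2] with s hs
  refine mem_image_of_mem _ ?_
  rw [← hlift hs]
  exact Function.invFunOn_mem (hbij.surjOn (hγU s hs))

theorem exists_isIncompleteGeodesic [T2Space N] (hX : ¬ X.IsComplete) :
    ∃ γ w, IsIncompleteGeodesic X.D γ w := by
  obtain ⟨z⟩ : Nonempty N := inferInstance
  obtain ⟨v, hv⟩ := X.exists_not_visible hX z
  obtain ⟨s, -, γ, -, hγ⟩ := exists_isIncompleteGeodesic_of_not_visible X.D_local hv
  exact ⟨γ, _, hγ⟩

end

variable [MetricSpace M] [TopologicalSpace N] (X : RayStructure 𝒢 M N)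

/-- The recurrence that underlies a Fried dynamics, before the holonomy is made to converge: the
times `t i → 1` at which the projection of `γ` returns to the projection of a compact convex
neighborhood `S` of a point `y`. The sheet that contains `γ (t i)` is recorded as the translate of
`S` by `g i`. -/
structure Recurrence (γ : ℝ → N) where
  y : N
  S : Set N
  S_compact : IsCompact S
  S_nhds : S ∈ 𝓝 y
  S_convex : DevConvex X.D S
  S_injOn : InjOn X.p S
  t : ℕ → ℝ
  t_mem : ∀ i, t i ∈ Ico (0 : ℝ) 1
  t_strictMono : StrictMono t
  t_tendsto : Tendsto t atTop (𝓝 1)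
  close : ∀ i, dist (X.p (γ (t i))) (X.p y) ≤ 1 / ((i : ℝ) + 1)
  exits : ∀ i, ∃ s ∈ Ioo (t i) (t (i + 1)), X.p (γ s) ∉ X.p '' S
  g : ℕ → deckGroup X.p
  γ_mem : ∀ i, γ (t i) ∈ (g i : N ≃ₜ N) '' S

variable {X} {γ : ℝ → N} {w : RSpace n}

theorem _root_.IsIncompleteGeodesic.nonempty_recurrence [CompactSpace M] [SimplyConnectedSpace N]
    (hγ : IsIncompleteGeodesic X.D γ w) : Nonempty (X.Recurrence γ) := by
  obtain ⟨y, -, hy⟩ := isCompact_univ.exists_mapClusterPt (u := fun t => X.p (γ t))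
    (f := 𝓝[<] (1 : ℝ)) (by simp)
  obtain ⟨y, rfl⟩ := X.p_surjective y
  obtain ⟨V, hV, hyV, hinj⟩ := X.p_covering.isLocalHomeomorph.isLocallyInjective y
  obtain ⟨S, hSV, hS, hSy, hconv⟩ :=
    exists_isCompact_devConvex_mem_nhds X.D_local (hV.mem_nhds hyV)
  have hinjS := hinj.mono hSV
  obtain ⟨t, ht, htm, htl, htd, htU, hte⟩ := exists_tendsto_forall_mem_of_mapClusterPt hy
    (X.p_covering.isLocalHomeomorph.isOpenMap.image_mem_nhds hSy)
    fun t ht => hγ.exists_notMem_image hS hconv hinjS ht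
  choose u hu hpu using htU
  choose g hg using fun i => X.exists_deck_apply_eq (hpu i)
  exact ⟨⟨y, S, hS, hSy, hconv, hinjS, t, ht, htm, htl, htd, hte, g, fun i => ⟨u i, hu i, hg i⟩⟩⟩

namespace Recurrence

/-- The passage to a subsequence of the return times. -/
def comp (R : X.Recurrence γ) {φ : ℕ → ℕ} (hφ : StrictMono φ) : X.Recurrence γ where
  y := R.y
  S := R.S
  S_compact := R.S_compact
  S_nhds := R.S_nhds
  S_convex := R.S_convex
  S_injOn := R.S_injOn
  t := R.t ∘ φ
  t_mem i := R.t_mem _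
  t_strictMono := R.t_strictMono.comp hφ
  t_tendsto := R.t_tendsto.comp hφ.tendsto_atTop
  close i := (R.close (φ i)).trans <| by
    have : (i : ℝ) ≤ φ i := Nat.cast_le.2 hφ.le_apply
    gcongr
  exits i := by
    obtain ⟨s, hs, hsU⟩ := R.exits (φ i)
    exact ⟨s, ⟨hs.1, hs.2.trans_le (R.t_strictMono.monotone (hφ (Nat.lt_succ_self i)))⟩, hsU⟩
  g := R.g ∘ φ
  γ_mem i := R.γ_mem _

/-- The Fried dynamics of a recurrence along which the factors `k i` and `b i` of the holonomy
converge, respectively are monotone. Its `g j i` is `g j * (g i)⁻¹`, so that the factors of the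
holonomy of `g j i` are `k j * (k i)⁻¹` and `b j / b i`. -/
noncomputable def toFriedDynamics (R : X.Recurrence γ) (hγ : IsIncompleteGeodesic X.D γ w)
    {k : ℕ → (RSpace n →L[ℝ] RSpace n)ˣ} {b : ℕ → ℝ} (hk : ∀ i, k i ∈ 𝒢.K) (hb : ∀ i, 0 < b i)
    (hlin : ∀ i x, (X.hol (R.g i)).linear x = (k i : RSpace n →L[ℝ] RSpace n) (𝒢.a (b i) x))
    {k₀ : (RSpace n →L[ℝ] RSpace n)ˣ} (hk₀ : Tendsto k atTop (𝓝 k₀))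
    (hmon : ∀ q, (Monotone fun i => b i ^ 𝒢.d q) ∨ Antitone fun i => b i ^ 𝒢.d q)
    {L : Fin n → ℕ → ENNReal} {ω : Fin n → ENNReal}
    (hL : ∀ q i, Tendsto (fun j => ENNReal.ofReal (b j ^ 𝒢.d q / b i ^ 𝒢.d q)) atTop (𝓝 (L q i)))
    (hω : ∀ q, Tendsto (L q) atTop (𝓝 (ω q))) : X.FriedDynamics where
  γ := γ
  w := w
  incomplete := hγ
  y := X.p R.y
  U := X.p '' R.S
  U_nhds := X.p_covering.isLocalHomeomorph.isOpenMap.image_mem_nhds R.S_nhds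
  U_compact := R.S_compact.image X.p_covering.continuous
  ε i := 1 / ((i : ℝ) + 1)
  ε_antitone _ _ hij := Nat.one_div_le_one_div hij
  ε_tendsto := tendsto_one_div_add_atTop_nhds_zero_nat
  t := R.t
  t_mem := R.t_mem
  t_strictMono := R.t_strictMono
  t_tendsto := R.t_tendsto
  close := R.close
  exits := R.exits
  Ui i := (R.g i : N ≃ₜ N) '' R.S
  Ui_compact i := R.S_compact.image (R.g i : N ≃ₜ N).continuous
  Ui_bijOn i := bijOn_deck_image R.S_injOn _
  Ui_convex i := R.S_convex.deck _
  yi i := (R.g i : N ≃ₜ N) R.y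
  yi_mem i := mem_image_of_mem _ (mem_of_mem_nhds R.S_nhds)
  yi_lift i := X.p_deck _ _
  γ_mem := R.γ_mem
  g j i := R.g j * (R.g i)⁻¹
  g_image j i := by
    rw [image_image]
    exact image_congr fun x _ => congrArg (R.g j : N ≃ₜ N) (X.deck_inv_deck (R.g i) x)
  k j i := k j * (k i)⁻¹
  k_mem j i := 𝒢.K.mul_mem (hk j) (𝒢.K.inv_mem (hk i))
  β j i := b j / b i
  β_pos j i := div_pos (hb j) (hb i)
  linear_eq j i x := by
    rw [map_mul, map_inv]
    exact 𝒢.linear_mul_inv (hk i) (hb j) (hb i) (hlin j) (hlin i) x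
  kLim i := k₀ * (k i)⁻¹
  k_tendsto i := hk₀.mul_const _
  kLim_tendsto := by simpa using hk₀.inv.const_mul k₀
  β_monotone i q := by
    simp only [Real.div_rpow (hb _).le (hb i).le]
    have hpos := (Real.rpow_pos_of_pos (hb i) (𝒢.d q)).le
    exact (hmon q).imp (fun h _ _ _ _ hjj' => div_le_div_of_nonneg_right (h hjj') hpos)
      fun h _ _ _ _ hjj' => div_le_div_of_nonneg_right (h hjj') hpos
  βLim i q := L q i
  β_tendsto i q := by
    simp only [Real.div_rpow (hb _).le (hb i).le]
    exact hL q i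
  ω := ω
  βLim_tendsto := hω

end Recurrence

theorem _root_.IsIncompleteGeodesic.exists_friedDynamics [CompactSpace M] [SimplyConnectedSpace N]
    (hγ : IsIncompleteGeodesic X.D γ w) : ∃ 𝓕 : X.FriedDynamics, 𝓕.γ = γ ∧ 𝓕.w = w := by
  obtain ⟨R⟩ := hγ.nonempty_recurrence
  obtain ⟨φ, hφ, k, b, hk, hb, hlin, ⟨k₀, hk₀⟩, hmon⟩ :=
    RankOneRayGeometry.exists_subseq_tendsto_and_monotone_or_antitone fun i => X.ρ (R.g i)
  have hmonq := fun q => monotone_or_antitone_rpow hb hmon (𝒢.d q)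
  choose L ω hL hω using fun q =>
    exists_tendsto_ofReal_div (fun i => Real.rpow_pos_of_pos (hb i) (𝒢.d q)) (hmonq q)
  exact ⟨(R.comp hφ).toFriedDynamics hγ hk hb hlin hk₀ hmonq hL hω, rfl, rfl⟩

end RayStructure

theorem mainTheorem4 {n : ℕ} (𝒢 : RankOneRayGeometry n) {M N : Type*}
    [MetricSpace M] [CompactSpace M] [TopologicalSpace N] [SimplyConnectedSpace N]
    (X : RayStructure 𝒢 M N) (hX : ¬ X.IsComplete) :
    ((∀ 𝓕 : X.FriedDynamics, 𝓕.F = ⊥) →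
      ∃ I : AffineSubspace ℝ (RSpace n), (I : Set (RSpace n)).Nonempty ∧
        X.IsInvisibleSubspace I ∧
        (∀ (γ : ℝ → N) (w : RSpace n), IsIncompleteGeodesic X.D γ w →
          w ∈ I ∧ ∃ 𝓕 : X.FriedDynamics, 𝓕.γ = γ ∧ 𝓕.w = w) ∧
        ∀ 𝓕 : X.FriedDynamics, I = AffineSubspace.mk' 𝓕.w 𝓕.P) ∧
    ((∀ 𝓕 : X.FriedDynamics, 𝓕.F = ⊥ ∧ 𝓕.P = ⊥) → X.IsRadiant) ∧
    ((∀ q, 0 < 𝒢.d q) → X.IsRadiant) := by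
  have := X.t2Space
  obtain ⟨γ₀, w₀, hγ₀⟩ := RayStructure.exists_isIncompleteGeodesic hX
  obtain ⟨𝓕₀, -, -⟩ := hγ₀.exists_friedDynamics
  have hneutral (hF : 𝓕₀.F = ⊥) : ∃ w, X.IsInvisibleSubspace (AffineSubspace.mk' w 𝒢.neutral) :=
    RayStructure.exists_isInvisibleSubspace
      (RayStructure.FriedDynamics.d_nonneg_or_d_nonpos hF) hX
  refine ⟨fun hF => ?_, fun h => ?_, fun hd => ?_⟩
  · obtain ⟨w, hw⟩ := hneutral (hF 𝓕₀)
    refine ⟨_, ⟨w, AffineSubspace.self_mem_mk' _ _⟩, hw,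
      fun γ v hγ => ⟨(hw.mem_iff v).2 ⟨γ, hγ⟩, hγ.exists_friedDynamics⟩, fun 𝓕 => ?_⟩
    rw [RayStructure.FriedDynamics.P_eq_neutral (hF 𝓕)]
    exact hw.mk'_eq_of_isIncompleteGeodesic 𝓕.incomplete
  · obtain ⟨w, hw⟩ := hneutral (h 𝓕₀).1
    rw [← RayStructure.FriedDynamics.P_eq_neutral (h 𝓕₀).1, (h 𝓕₀).2] at hw
    exact hw.isRadiant
  · obtain ⟨w, hw⟩ := RayStructure.exists_isInvisibleSubspace (.inl fun q => (hd q).le) hX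
    rw [𝒢.neutral_eq_bot fun q => (hd q).ne'] at hw
    exact hw.isRadiant
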